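/- Let $b>2$ be a fixed real number. For each positive integer $n>b$ put $$K_n=\Bigl\{x\in\mathbb R^n:\ x_i>0 \text{ for all } i,\ \sum_{i=1}^n x_i=n,\ \sum_{i=1}^n x_i^2=nb\Bigr\}.$$ The uniform distribution on $K_n$ is the probability measure carried by $K_n$ that is the weak limit, as $\varepsilon\downarrow0$, of the normalized Lebesgue measures on the shells $\{x\in\mathbb R^n:\ x_i>0 \text{ for all } i,\ |\frac1n\sum_i x_i-1|<\varepsilon,\ |\frac1n\sum_i x_i^2-b|<\varepsilon\}$; it exists and is unique. Let $X=X^{(n)}=(X_1,\ldots,X_n)$ be a random vector with this distribution, and let $Z_1,Z_2,\ldots$ be i.i.d. $\mathrm{Exp}(1)$ random variables. Then the following hold. (a) For every fixed $k$, the random vector $(X_1,\ldots,X_k)$ converges in law to $(Z_1,\ldots,Z_k)$ as $n\to\infty$. (b) The second moments do not converge: $\mathbb E(X_1^2)=b$ for every $n>b$, while $\mathbb E(Z_1^2)=2$, so that $\mathbb E(X_1^2)\not\to\mathbb E(Z_1^2)$. (c) Let $M=\max_{1\le i\le n}X_i$. Then $\frac{M^2}{(b-2)n}\to1$ in probability as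 $n\to\infty$. Consequently the sum of squares of all other coordinates is roughly $2n$: $\frac1n\bigl(\sum_{i=1}^n X_i^2-M^2\bigr)\to2$ in probability. (d) Let $M_2$ be the second largest coordinate of $X$ (counted with multiplicity). Then $\frac{M_2^2}{n}\to0$ in probability as $n\to\infty$. -/

import Mathlib

open MeasureTheory ProbabilityTheory Filter Topology
open scoped BoundedContinuousFunction

namespace SimplexSphere

/-- The set `K` of all `x ∈ ℝⁿ` with positive coordinates, `∑ xᵢ = n` and `∑ xᵢ² = n b`. -/
def K (b : ℝ) (n : ℕ) : Set (Fin n → ℝ) :=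
  {x | (∀ i, 0 < x i) ∧ ∑ i, x i = n ∧ ∑ i, x i ^ 2 = n * b}

/-- The shell of thickness `ε` around `K`: all coordinates are positive, the mean of the
coordinates is within `ε` of `1` and the mean of their squares is within `ε` of `b`. -/
def shell (b : ℝ) (n : ℕ) (ε : ℝ) : Set (Fin n → ℝ) :=
  {x | (∀ i, 0 < x i) ∧ |(∑ i, x i) / n - 1| < ε ∧ |(∑ i, x i ^ 2) / n - b| < ε}

/-- `ν` is the uniform distribution on `K`: a probability measure carried by `K` which is the weak
limit, as `ε ↓ 0`, of Lebesgue measure restricted to the shell of thickness `ε` and normalized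
to mass one. -/
structure IsUniformOnK (b : ℝ) (n : ℕ) (ν : Measure (Fin n → ℝ)) : Prop where
  isProbabilityMeasure : IsProbabilityMeasure ν
  carried : ν (K b n) = 1
  tendsto_shell : ∀ f : (Fin n → ℝ) →ᵇ ℝ,
    Tendsto (fun ε : ℝ => ∫ x, f x ∂(cond volume (shell b n ε))) (𝓝[>] 0) (𝓝 (∫ x, f x ∂ν))

/-- The coordinate of `x ∈ ℝⁿ` with (zero-based) number `i`; the value `0` for `i ≥ n` is a
placeholder that makes `i` range over `ℕ`. -/
def coord {n : ℕ} (x : Fin n → ℝ) (i : ℕ) : ℝ :=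
  if h : i < n then x ⟨i, h⟩ else 0

/-- The vector of the first `k` coordinates of `x ∈ ℝⁿ` (used for `k ≤ n`). -/
def firstCoords (k : ℕ) {n : ℕ} (x : Fin n → ℝ) : Fin k → ℝ :=
  fun i => coord x i

/-- The largest coordinate. -/
noncomputable def maxCoord {n : ℕ} (x : Fin n → ℝ) : ℝ :=
  ⨆ i, x i

/-- The second largest coordinate, counted with multiplicity: the entry before the last one when
the coordinates are listed in increasing order (used for `n ≥ 2`). -/
noncomputable def secondMaxCoord {n : ℕ} (x : Fin n → ℝ) : ℝ :=
  if h : 2 ≤ n then x (Tuple.sort x ⟨n - 2, by omega⟩) else 0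

/-- The sum of the squares of all coordinates other than (one occurrence of) the largest. -/
noncomputable def sumSqOthers {n : ℕ} (x : Fin n → ℝ) : ℝ :=
  ∑ i, x i ^ 2 - maxCoord x ^ 2

/-- Convergence in probability to a constant `c` of random variables `Y n`, each of which may be
defined on its own probability space. -/
def TendstoInProb {Ω : ℕ → Type*} [∀ n, MeasurableSpace (Ω n)] (P : ∀ n, Measure (Ω n))
    (Y : ∀ n, Ω n → ℝ) (c : ℝ) : Prop :=
  ∀ ε : ℝ, 0 < ε → Tendsto (fun n => P n {ω | ε ≤ |Y n ω - c|}) atTop (𝓝 0)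

end SimplexSphere

/-! The uniform distribution is compared with the law of i.i.d. exponential variables, whose joint
density depends only on the mean. In polar coordinates around the diagonal (mean `t`, radius `r`,
direction `θ`), `K` is the set of directions on a sphere of radius `R = √(n(b-1))` around `(1, …,
1)` for which all coordinates are positive. Its uniform law is normalized surface measure there: the
shells shrink to one pair of mean and radius, and the boundary directions are negligible. Given mean
and radius, the exponential vector is also uniform on its admissible directions. Whether a direction
is admissible depends only on `r / t`, and lowering this ratio admits more directions. Hence the law
on `K` is dominated by the exponential law on a thin cone just inside `r = R t`, divided by the mass
of a thin cone just outside (`unif_mul_expPi_outerCone_le`).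

The price of this is exponential in `√n`. The outer cone has probability at least `exp(-(√(b-2) +
η)√n)`: one coordinate near `√((b-2)n)` supplies the missing squares while the others follow the law
of large numbers (`eventually_expPi_outerCone_ge`). Any exponential event of probability
`O(exp(-γ√n))` with `γ > √(b-2)` is therefore negligible on `K`, up to a small stretching
(`tendsto_unif_of_expRare`).

Three events are that rare: a wrong mean, squares of coordinates below `ε√n` summing to more than
`(2+δ)n`, and coordinates above `ε√n` summing to more than `(√(b-2)+δ)√n`. Outside them the large
coordinates have sum at most about `√(b-2)√n` but sum of squares at least about `(b-2)n`, which
forces a single large coordinate: this is (c) and (d). For (a), averages of a bounded Lipschitz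
function over disjoint blocks of coordinates concentrate at rate `n`, hence also on `K`, and
exchangeability turns block averages into expectations of the first coordinates. Exchangeability
also gives (b). -/

namespace SimplexSphere

/-! ### Polar coordinates around the diagonal -/

/-- The hyperplane of vectors with vanishing coordinate sum. -/
def zeroSum (n : ℕ) : Submodule ℝ (EuclideanSpace ℝ (Fin n)) where
  carrier := {y | ∑ i, y i = 0}
  add_mem' {x y} hx hy := by
    simp only [Set.mem_ofPred_eq] at hx hy
    simp [Finset.sum_add_distrib, hx, hy]
  zero_mem' := by simp
  smul_mem' c x hx := by
    simp only [Set.mem_ofPred_eq] at hx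
    simp [← Finset.mul_sum, hx]

theorem sum_zeroSum {n : ℕ} (y : zeroSum n) : ∑ i, y.1 i = 0 := y.2

theorem sum_sq_zeroSum {n : ℕ} (y : zeroSum n) : ∑ i, y.1 i ^ 2 = ‖y‖ ^ 2 := by
  rw [Submodule.coe_norm, EuclideanSpace.norm_sq_eq]
  simp

/-- The unit sphere of the hyperplane of vectors with vanishing coordinate sum. -/
abbrev Dir (n : ℕ) := Metric.sphere (0 : zeroSum n) 1

/-- The surface measure on the unit sphere. -/
noncomputable abbrev surf (n : ℕ) : Measure (Dir n) := (volume : Measure (zeroSum n)).toSphere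

/-- The point with mean `t` at distance `r` from `(t, …, t)` in direction `θ`. -/
def pt {n : ℕ} (t r : ℝ) (θ : Dir n) : Fin n → ℝ := fun i => t + r * θ.1.1 i

theorem continuous_pt {n : ℕ} : Continuous fun p : (ℝ × ℝ) × Dir n => pt p.1.1 p.1.2 p.2 := by
  unfold pt
  fun_prop

theorem sum_pt {n : ℕ} (t r : ℝ) (θ : Dir n) : ∑ i, pt t r θ i = n * t := by
  simp [pt, Finset.sum_add_distrib, ← Finset.mul_sum, sum_zeroSum]

theorem sum_sq_pt {n : ℕ} (t r : ℝ) (θ : Dir n) : ∑ i, pt t r θ i ^ 2 = n * t ^ 2 + r ^ 2 := by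
  have h : ∀ i, pt t r θ i ^ 2 = t ^ 2 + 2 * t * r * θ.1.1 i + r ^ 2 * θ.1.1 i ^ 2 := by
    intro i; simp only [pt]; ring
  have h1 : ‖θ.1‖ = 1 := by simp
  simp [h, Finset.sum_add_distrib, ← Finset.mul_sum, sum_zeroSum, sum_sq_zeroSum, h1]

/-- Splitting a vector into its mean and its centred part. -/
noncomputable def meanEquiv (n : ℕ) (hn : 0 < n) : (ℝ × zeroSum n) ≃L[ℝ] (Fin n → ℝ) :=
  LinearEquiv.toContinuousLinearEquiv
  { toFun := fun p i => p.1 + p.2.1 i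
    map_add' := by intro x y; ext i; simp; ring
    map_smul' := by intro c x; ext i; simp; ring
    invFun := fun x => ((∑ i, x i) / n, ⟨WithLp.toLp 2 fun i => x i - (∑ j, x j) / n, by
      have : (n : ℝ) ≠ 0 := by positivity
      change ∑ i, (x i - (∑ j, x j) / n) = 0
      simp
      field_simp
      simp⟩)
    left_inv := by
      rintro ⟨t, y⟩
      have : (n : ℝ) ≠ 0 := by positivity
      have h : (∑ i, (t + y.1 i)) / n = t := by
        simp [Finset.sum_add_distrib, sum_zeroSum, this]
      ext i
      · exact h
      · simp [h]
    right_inv := by intro x; ext i; simp }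

/-- The density `r ^ (d - 1)` on the positive half line, `d` the dimension of the hyperplane. -/
noncomputable def radial (n : ℕ) : Measure ℝ :=
  (volume.restrict (Set.Ioi 0)).withDensity
    fun r => ENNReal.ofReal (r ^ (Module.finrank ℝ (zeroSum n) - 1))

theorem radial_eq_map (n : ℕ) : radial n =
    (Measure.volumeIoiPow (Module.finrank ℝ (zeroSum n) - 1)).map Subtype.val := by
  ext s hs
  rw [radial, withDensity_apply _ hs, Measure.map_apply measurable_subtype_coe hs,
    Measure.volumeIoiPow, withDensity_apply _ (measurable_subtype_coe hs),
    ← map_comap_subtype_coe measurableSet_Ioi, setLIntegral_map hs (by fun_prop)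
      measurable_subtype_coe]

instance (n : ℕ) : SigmaFinite (radial n) := by
  unfold radial
  infer_instance

/-- Mathlib's polar coordinates live on the complement of the origin. The origin is null because the
hyperplane contains `(1, -1, 0, …)` and so is nontrivial. -/
theorem volume_zeroSum (n : ℕ) (hn : 2 ≤ n) : (volume : Measure (zeroSum n)) =
    ((radial n).prod (surf n)).map fun p => p.1 • p.2.1 := by
  have h := (volume : Measure (zeroSum n)).measurePreserving_homeomorphUnitSphereProd
  have hN : Nontrivial (zeroSum n) := by
    refine ⟨⟨0, ⟨WithLp.toLp 2 fun i => if i = ⟨0, by omega⟩ then 1 else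
      if i = ⟨1, by omega⟩ then -1 else 0, ?_⟩, ?_⟩⟩
    · change ∑ i : Fin n, (if i = ⟨0, by omega⟩ then (1 : ℝ) else
        if i = ⟨1, by omega⟩ then -1 else 0) = 0
      have : ∀ i : Fin n, (if i = ⟨0, by omega⟩ then (1 : ℝ) else
        if i = ⟨1, by omega⟩ then -1 else 0) = (if i = ⟨0, by omega⟩ then (1 : ℝ) else 0) +
          (if i = ⟨1, by omega⟩ then -1 else 0) := by
        intro i
        split_ifs with h1 h2 <;> simp_all
      simp [this, Finset.sum_add_distrib]
    · intro h
      have := congrArg (fun y : zeroSum n => y.1 ⟨0, by omega⟩) h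
      simp at this
  have h0 : (volume : Measure (zeroSum n)) = (volume.comap Subtype.val).map
      (Subtype.val : ({0}ᶜ : Set (zeroSum n)) → zeroSum n) := by
    rw [map_comap_subtype_coe (measurableSet_singleton _).compl, restrict_compl_singleton]
  have h1 : (volume.comap Subtype.val : Measure ({0}ᶜ : Set (zeroSum n))) =
      ((surf n).prod (.volumeIoiPow (Module.finrank ℝ (zeroSum n) - 1))).map
        (homeomorphUnitSphereProd (zeroSum n)).symm := by
    exact ((h.symm (homeomorphUnitSphereProd (zeroSum n)).toMeasurableEquiv).map_eq).symm
  rw [h0, h1, Measure.map_map measurable_subtype_coe (Homeomorph.measurable _), radial_eq_map,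
    ← Measure.prod_swap, Measure.map_map (by fun_prop) measurable_swap]
  have h2 : ((Measure.volumeIoiPow (Module.finrank ℝ (zeroSum n) - 1)).map Subtype.val).prod
    (surf n) = ((Measure.volumeIoiPow (Module.finrank ℝ (zeroSum n) - 1)).prod (surf n)).map
      (Prod.map Subtype.val id) := by
    rw [← Measure.map_prod_map _ _ measurable_subtype_coe measurable_id, Measure.map_id]
  rw [h2, Measure.map_map (by fun_prop) (by fun_prop)]
  rfl

/-- Polar coordinates around the diagonal. -/
theorem exists_volume_eq_polar (n : ℕ) (hn : 2 ≤ n) : ∃ c : ENNReal, c ≠ 0 ∧ c ≠ ⊤ ∧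
    (volume : Measure (Fin n → ℝ)) =
      c • (((volume.prod (radial n)).prod (surf n)).map fun p => pt p.1.1 p.1.2 p.2) := by
  have hn0 : 0 < n := by omega
  have hP : (volume : Measure (ℝ × zeroSum n)).IsAddHaarMeasure := by
    rw [Measure.volume_eq_prod]
    infer_instance
  have hL : ((volume : Measure (ℝ × zeroSum n)).map (meanEquiv n hn0)).IsAddHaarMeasure :=
    (meanEquiv n hn0).isAddHaarMeasure_map _
  -- Uniqueness of Haar measure supplies the constant. Its value is irrelevant, since later only
  -- ratios are formed.
  have hc := Measure.addHaarScalarFactor_pos_of_isAddHaarMeasure (volume : Measure (Fin n → ℝ))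
    ((volume : Measure (ℝ × zeroSum n)).map (meanEquiv n hn0))
  refine ⟨_, ENNReal.coe_ne_zero.2 hc.ne', ENNReal.coe_ne_top,
    (Measure.isAddLeftInvariant_eq_smul (volume : Measure (Fin n → ℝ))
      ((volume : Measure (ℝ × zeroSum n)).map (meanEquiv n hn0))).trans ?_⟩
  rw [ENNReal.smul_def]
  congr 1
  rw [Measure.volume_eq_prod]
  conv_lhs => rw [volume_zeroSum n hn]
  have h2 : (volume : Measure ℝ).prod (((radial n).prod (surf n)).map
      fun p => p.1 • p.2.1) = ((volume : Measure ℝ).prod ((radial n).prod (surf n))).map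
      (Prod.map id fun p => p.1 • p.2.1) := by
    rw [← Measure.map_prod_map _ _ measurable_id (by fun_prop), Measure.map_id]
  rw [h2, Measure.map_map (meanEquiv n hn0).continuous.measurable (by fun_prop),
    ← Measure.prodAssoc_prod, Measure.map_map]
  · rfl
  · exact (meanEquiv n hn0).continuous.measurable.comp (by fun_prop)
  · fun_prop

/-! ### Directions with positive coordinates -/

/-- The directions in which the points at distance `R` from `(1, …, 1)` have positive
coordinates. -/
def posDir (n : ℕ) (R : ℝ) : Set (Dir n) := {θ | ∀ i, 0 < pt 1 R θ i}

theorem continuous_pt_right {n : ℕ} (t r : ℝ) : Continuous fun θ : Dir n => pt t r θ :=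
  continuous_pt.comp (by fun_prop : Continuous fun θ : Dir n => ((t, r), θ))

theorem isOpen_posDir (n : ℕ) (R : ℝ) : IsOpen (posDir n R) := by
  simp only [posDir, Set.ofPred_forall]
  exact isOpen_iInter_of_finite fun i =>
    isOpen_lt continuous_const ((continuous_apply i).comp (continuous_pt_right 1 R))

theorem isOpen_pos (n : ℕ) : IsOpen {x : Fin n → ℝ | ∀ i, 0 < x i} := by
  simp only [Set.ofPred_forall]
  exact isOpen_iInter_of_finite fun i => isOpen_lt continuous_const (continuous_apply i)

/-- Only the ratio of radius to mean matters, and lowering it can only help the coordinates in which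
the direction is negative. This monotonicity is what makes the comparison of cones possible. -/
theorem pt_pos_mono {n : ℕ} {t r t' r' : ℝ} {θ : Dir n} (ht : 0 < t) (hr : 0 ≤ r') (ht' : 0 < t')
    (h : r' * t ≤ r * t') (hpos : ∀ i, 0 < pt t r θ i) (i : Fin n) : 0 < pt t' r' θ i := by
  have := hpos i
  simp only [pt] at this ⊢
  rcases le_or_gt 0 (θ.1.1 i) with h0 | h0
  · positivity
  · nlinarith [mul_le_mul_of_nonpos_right h h0.le, mul_pos this ht']

/-- The vector pointing from `(1, …, 1)` to the vertex with number `i` of the simplex. -/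
def vertexDir (n : ℕ) (i : Fin n) : zeroSum n :=
  ⟨WithLp.toLp 2 fun j => (if j = i then (n : ℝ) else 0) - 1, by
    change ∑ j, ((if j = i then (n : ℝ) else 0) - 1) = 0
    simp⟩

theorem vertexDir_apply (n : ℕ) (i j : Fin n) :
    (vertexDir n i).1 j = (if j = i then (n : ℝ) else 0) - 1 := rfl

theorem norm_sq_vertexDir (n : ℕ) (i : Fin n) :
    ‖vertexDir n i‖ ^ 2 = n * (n - 1) := by
  rw [← sum_sq_zeroSum]
  simp only [vertexDir_apply]
  have : ∀ j, ((if j = i then (n : ℝ) else 0) - 1) ^ 2 =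
      (if j = i then (n : ℝ) ^ 2 - 2 * n else 0) + 1 := by
    intro j
    split_ifs <;> ring
  simp [this, Finset.sum_add_distrib]
  ring

theorem norm_vertexDir (n : ℕ) (i : Fin n) :
    ‖vertexDir n i‖ = √(n * (n - 1)) := by
  rw [← norm_sq_vertexDir n i, Real.sqrt_sq (norm_nonneg _)]

/-- A vertex of the simplex is at distance `√(n(n-1))` from its centre, and the segment towards it
stays inside the open simplex until the vertex is reached. -/
theorem posDir_nonempty {n : ℕ} (hn : 2 ≤ n) {R : ℝ} (hR0 : 0 ≤ R) (hR : R ^ 2 < n * (n - 1)) :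
    (posDir n R).Nonempty := by
  have hn0 : 0 < n := by omega
  set y := vertexDir n ⟨0, hn0⟩ with hy
  have hyn : R < ‖y‖ := by
    rw [hy, norm_vertexDir]
    exact Real.lt_sqrt_of_sq_lt hR
  have hy0 : 0 < ‖y‖ := by linarith
  have hmem : ‖y‖⁻¹ • y ∈ Metric.sphere (0 : zeroSum n) 1 := by
    rw [mem_sphere_zero_iff_norm, norm_smul, norm_inv, norm_norm, inv_mul_cancel₀ hy0.ne']
  refine ⟨⟨‖y‖⁻¹ • y, hmem⟩, fun i => ?_⟩
  have hi : -1 ≤ y.1 i := by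
    rw [hy, vertexDir_apply]
    split_ifs <;> simp
  have h1 : R * ‖y‖⁻¹ < 1 := by
    rw [← div_eq_mul_inv, div_lt_one hy0]
    exact hyn
  have h2 : 0 ≤ R * ‖y‖⁻¹ := by positivity
  have : pt 1 R ⟨‖y‖⁻¹ • y, hmem⟩ i = 1 + R * ‖y‖⁻¹ * y.1 i := by
    simp [pt]
    ring
  rw [this]
  nlinarith

theorem surf_posDir_pos {n : ℕ} (hn : 2 ≤ n) {R : ℝ} (hR0 : 0 ≤ R) (hR : R ^ 2 < n * (n - 1)) :
    surf n (posDir n R) ≠ 0 :=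
  (isOpen_posDir n R).measure_ne_zero _ (posDir_nonempty hn hR0 hR)

/-- The directions in which a coordinate vanishes at distance `R` from `(1, …, 1)` are
negligible if the sphere of radius `R` properly crosses the coordinate hyperplanes. -/
theorem surf_coord_eq_zero {n : ℕ} (hn : 2 ≤ n) {R : ℝ} (hR0 : 0 < R) (hR : n < R ^ 2 * (n - 1))
    (i : Fin n) : surf n {θ | pt 1 R θ i = 0} = 0 := by
  have hn0 : 0 < n := by omega
  -- The cone over the directions in question lies in the zero set of this convex function. It is
  -- negative at `-vertexDir n i`, exactly because `n < R ^ 2 * (n - 1)`, so its zero set lies in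
  -- the frontier of a convex set, which is null.
  set g : zeroSum n → ℝ := fun y => ‖y‖ + R * y.1 i with hg
  have hgc : Continuous g := by fun_prop
  have hconv : ConvexOn ℝ Set.univ g := by
    refine (convexOn_univ_norm).add ?_
    refine ⟨convex_univ, fun x _ y _ a b _ _ _ => le_of_eq ?_⟩
    simp
    ring
  have hC : Convex ℝ {y | g y < 0} := by
    have := hconv.convex_lt 0
    simpa using this
  obtain ⟨v, hv⟩ : ∃ v, g v < 0 := by
    refine ⟨-vertexDir n i, ?_⟩
    have h1 : (1 : ℝ) < n := by exact_mod_cast hn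
    have hsq : √(n * (n - 1)) < R * (n - 1) := by
      rw [Real.sqrt_lt' (by nlinarith)]
      nlinarith
    simp only [hg, norm_neg, norm_vertexDir, Submodule.coe_neg, PiLp.neg_apply, vertexDir_apply,
      if_true]
    linarith
  have hsub : {y | g y = 0} ⊆ frontier {y | g y < 0} := by
    intro y hy
    have hopen : IsOpen {y | g y < 0} := isOpen_lt hgc continuous_const
    rw [frontier, hopen.interior_eq]
    refine ⟨?_, by simp_all⟩
    have hlim : Tendsto (fun s : ℝ => (1 - s) • y + s • v) (𝓝[>] 0) (𝓝 y) := by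
      have : Tendsto (fun s : ℝ => (1 - s) • y + s • v) (𝓝 0)
          (𝓝 ((1 - (0 : ℝ)) • y + (0 : ℝ) • v)) :=
        Continuous.tendsto (by fun_prop) 0
      simp only [sub_zero, one_smul, zero_smul, add_zero] at this
      exact this.mono_left nhdsWithin_le_nhds
    refine mem_closure_of_tendsto hlim ?_
    filter_upwards [Ioo_mem_nhdsGT (zero_lt_one (α := ℝ))] with s hs
    have := hconv.2 (Set.mem_univ y) (Set.mem_univ v) (by linarith [hs.2] : 0 ≤ 1 - s) hs.1.le
      (by ring)
    have hy' : g y = 0 := hy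
    simp only [smul_eq_mul, hy', mul_zero, zero_add] at this
    exact this.trans_lt (mul_neg_of_pos_of_neg hs.1 hv)
  have hnull : volume {y | g y = 0} = 0 := measure_mono_null hsub (hC.addHaar_frontier _)
  have hm : MeasurableSet {θ : Dir n | pt 1 R θ i = 0} :=
    (isClosed_eq ((continuous_apply i).comp (continuous_pt_right 1 R))
      continuous_const).measurableSet
  rw [surf, Measure.toSphere_apply' _ hm]
  refine mul_eq_zero_of_right _ (measure_mono_null ?_ hnull)
  rintro _ ⟨r, hr, _, ⟨θ, hθ, rfl⟩, rfl⟩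
  have hθ' : 1 + R * θ.1.1 i = 0 := hθ
  have hr' : |r| = r := abs_of_pos hr.1
  simp only [Set.mem_ofPred_eq, hg, norm_smul, Real.norm_eq_abs, hr',
    mem_sphere_zero_iff_norm.1 θ.2]
  simp
  linear_combination r * hθ'

/-! ### The candidate for the uniform distribution -/

/-- The distance of the points of `K` from `(1, …, 1)`. -/
noncomputable def radius (b : ℝ) (n : ℕ) : ℝ := √(n * (b - 1))

/-- The uniform distribution on `K`, described by the direction from `(1, …, 1)`. -/
noncomputable def unif (b : ℝ) (n : ℕ) : Measure (Fin n → ℝ) :=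
  (cond (surf n) (posDir n (radius b n))).map (pt 1 (radius b n))

section

variable {b : ℝ} {n : ℕ}

theorem radius_sq (hb : 2 < b) : radius b n ^ 2 = n * (b - 1) :=
  Real.sq_sqrt (mul_nonneg (by positivity) (by linarith))

theorem two_lt_of_lt (hb : 2 < b) (hn : b < n) : 2 < n := by
  exact_mod_cast hb.trans hn

theorem radius_pos (hb : 2 < b) (hn : b < n) : 0 < radius b n := by
  have := two_lt_of_lt hb hn
  have : 0 < b - 1 := by linarith
  unfold radius
  positivity

theorem surf_posDir_radius (hb : 2 < b) (hn : b < n) : surf n (posDir n (radius b n)) ≠ 0 := by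
  have := two_lt_of_lt hb hn
  have h0 : (0 : ℝ) < n := by positivity
  refine surf_posDir_pos (by omega) (radius_pos hb hn).le ?_
  rw [radius_sq hb]
  nlinarith

theorem isProbabilityMeasure_unif (hb : 2 < b) (hn : b < n) : IsProbabilityMeasure (unif b n) := by
  have := cond_isProbabilityMeasure (surf_posDir_radius hb hn)
  exact Measure.isProbabilityMeasure_map (continuous_pt_right _ _).measurable.aemeasurable

theorem measurableSet_K : MeasurableSet (K b n) := by
  refine (isOpen_pos n).measurableSet.inter ((isClosed_eq ?_ ?_).measurableSet.inter
    (isClosed_eq ?_ ?_).measurableSet) <;> fun_prop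

theorem unif_K (hb : 2 < b) (hn : b < n) : unif b n (K b n) = 1 := by
  have := cond_isProbabilityMeasure (surf_posDir_radius hb hn)
  rw [unif, Measure.map_apply (continuous_pt_right _ _).measurable measurableSet_K,
    ← prob_compl_eq_zero_iff
      (measurableSet_K.preimage (continuous_pt_right _ _).measurable)]
  have : posDir n (radius b n) ⊆ pt 1 (radius b n) ⁻¹' K b n := by
    intro θ hθ
    refine ⟨hθ, by simp [sum_pt], ?_⟩
    rw [sum_sq_pt, radius_sq hb]
    ring
  refine measure_mono_null (Set.compl_subset_compl.2 this) ?_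
  rw [cond_apply (isOpen_posDir n _).measurableSet]
  simp

theorem isOpen_shell (ε : ℝ) : IsOpen (shell b n ε) := by
  refine (isOpen_pos n).and ((isOpen_lt ?_ ?_).and (isOpen_lt ?_ ?_)) <;> fun_prop

theorem K_subset_shell (hn : 0 < n) {ε : ℝ} (hε : 0 < ε) : K b n ⊆ shell b n ε := by
  have : (n : ℝ) ≠ 0 := by positivity
  rintro x ⟨h1, h2, h3⟩
  refine ⟨h1, ?_, ?_⟩
  · simp [h2, this, hε]
  · rw [h3, mul_div_cancel_left₀ _ this]
    simp [hε]

/-- The shell is open and contains `K`, which is nonempty because it carries the mass of `unif`. -/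
theorem volume_shell_ne_zero (hb : 2 < b) (hn : b < n) {ε : ℝ} (hε : 0 < ε) :
    volume (shell b n ε) ≠ 0 := by
  have h := two_lt_of_lt hb hn
  refine (isOpen_shell ε).measure_ne_zero _ (Set.Nonempty.mono (K_subset_shell (by omega) hε) ?_)
  by_contra h0
  rw [Set.not_nonempty_iff_eq_empty] at h0
  have := unif_K hb hn
  simp [h0] at this

theorem volume_shell_ne_top (hn : 0 < n) (ε : ℝ) : volume (shell b n ε) ≠ ⊤ := by
  have h0 : (0 : ℝ) < n := by positivity
  have : shell b n ε ⊆ Metric.closedBall 0 (n * (1 + |ε|)) := by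
    rintro x ⟨h1, h2, -⟩
    rw [mem_closedBall_zero_iff, pi_norm_le_iff_of_nonneg (by positivity)]
    intro i
    have h3 : x i ≤ ∑ j, x j := Finset.single_le_sum (fun j _ => (h1 j).le) (Finset.mem_univ i)
    have h4 : (∑ j, x j) / n ≤ 1 + |ε| := by
      have := (abs_lt.1 h2).2
      linarith [le_abs_self ε]
    rw [div_le_iff₀ h0] at h4
    rw [Real.norm_eq_abs, abs_of_pos (h1 i)]
    linarith
  exact ((measure_mono this).trans_lt measure_closedBall_lt_top).ne

end

/-! ### The shell limit, existence and uniqueness -/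

instance (n : ℕ) : IsLocallyFiniteMeasure (radial n) := by
  unfold radial
  exact IsLocallyFiniteMeasure.withDensity_ofReal (by fun_prop)

/-- The measure `r ^ (d - 1) dt dr` of mean and radius. -/
noncomputable abbrev meanRadial (n : ℕ) : Measure (ℝ × ℝ) := volume.prod (radial n)

/-- The integral of `f` over the part with positive coordinates of the sphere of radius `p.2`
around `(p.1, …, p.1)`. -/
noncomputable def sphereIntegral {n : ℕ} (f : (Fin n → ℝ) →ᵇ ℝ) (p : ℝ × ℝ) : ℝ :=
  ∫ θ, Set.indicator {x | ∀ i, 0 < x i} f (pt p.1 p.2 θ) ∂(surf n)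

/-- The pairs of a mean and a radius that occur in the shell of thickness `ε`. -/
def shellParam (b : ℝ) (n : ℕ) (ε : ℝ) : Set (ℝ × ℝ) :=
  {p | |p.1 - 1| < ε ∧ |p.1 ^ 2 + p.2 ^ 2 / n - b| < ε ∧ 0 < p.2}

section

variable {b : ℝ} {n : ℕ}

theorem measurableSet_shellParam (ε : ℝ) : MeasurableSet (shellParam b n ε) := by
  refine IsOpen.measurableSet
    ((isOpen_lt ?_ ?_).and ((isOpen_lt ?_ ?_).and (isOpen_lt ?_ ?_))) <;> fun_prop

theorem pt_mem_shell_iff (hn : 0 < n) {t r ε : ℝ} (hr : 0 < r) {θ : Dir n} :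
    pt t r θ ∈ shell b n ε ↔ (∀ i, 0 < pt t r θ i) ∧ (t, r) ∈ shellParam b n ε := by
  have h0 : (n : ℝ) ≠ 0 := by positivity
  simp only [shell, shellParam, Set.mem_ofPred_eq, sum_pt, sum_sq_pt, add_div, hr, and_true,
    mul_div_cancel_left₀ _ h0]

theorem measurable_indicator_pos (f : (Fin n → ℝ) →ᵇ ℝ) :
    StronglyMeasurable (Set.indicator {x : Fin n → ℝ | ∀ i, 0 < x i} f) :=
  f.continuous.stronglyMeasurable.indicator (isOpen_pos n).measurableSet

theorem stronglyMeasurable_sphereIntegral (f : (Fin n → ℝ) →ᵇ ℝ) :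
    StronglyMeasurable (sphereIntegral f) := by
  exact StronglyMeasurable.integral_prod_right'
    (f := fun p : (ℝ × ℝ) × Dir n => Set.indicator {x : Fin n → ℝ | ∀ i, 0 < x i} f
      (pt p.1.1 p.1.2 p.2))
    ((measurable_indicator_pos f).comp_measurable continuous_pt.measurable)

theorem meanRadial_ae_pos : ∀ᵐ p ∂(meanRadial n), 0 < p.2 := by
  have h : ∀ᵐ r ∂(radial n), 0 < r := by
    refine (withDensity_absolutelyContinuous _ _).ae_le ?_
    exact ae_restrict_mem measurableSet_Ioi
  exact Measure.quasiMeasurePreserving_snd.ae h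

/-- Apart from positivity, membership in the shell depends only on mean and radius. One `c` serves
all `f` and `ε`, so it cancels from normalized integrals. -/
theorem setIntegral_shell_eq (hn : 2 ≤ n) : ∃ c : ℝ, 0 < c ∧
    ∀ (f : (Fin n → ℝ) →ᵇ ℝ) (ε : ℝ), ∫ x in shell b n ε, f x =
      c * ∫ p in shellParam b n ε, sphereIntegral f p ∂(meanRadial n) := by
  classical
  obtain ⟨c, hc0, hc, hvol⟩ := exists_volume_eq_polar n hn
  refine ⟨c.toReal, ENNReal.toReal_pos hc0 hc, fun f ε => ?_⟩
  have hms : MeasurableSet (shell b n ε) := (isOpen_shell ε).measurableSet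
  have hint : Integrable ((shell b n ε).indicator f) := by
    rw [integrable_indicator_iff hms]
    have : IsFiniteMeasure (volume.restrict (shell b n ε)) :=
      ⟨by simpa using (volume_shell_ne_top (by omega) ε).lt_top⟩
    exact f.integrable _
  have hpm : Measurable fun p : (ℝ × ℝ) × Dir n => pt p.1.1 p.1.2 p.2 := continuous_pt.measurable
  rw [← integral_indicator hms]
  rw [hvol] at hint ⊢
  rw [integral_smul_measure, smul_eq_mul]
  rw [integrable_smul_measure hc0 hc] at hint
  congr 1
  rw [integral_map hpm.aemeasurable hint.1]
  rw [integrable_map_measure hint.1 hpm.aemeasurable] at hint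
  refine (integral_prod _ hint).trans ?_
  rw [← integral_indicator (measurableSet_shellParam ε)]
  refine integral_congr_ae ?_
  filter_upwards [meanRadial_ae_pos] with p hp
  rw [Set.indicator_apply]
  split_ifs with h
  · unfold sphereIntegral
    congr 1
    ext θ
    rw [Function.comp_apply, Set.indicator_apply, Set.indicator_apply]
    refine if_congr ?_ rfl rfl
    rw [pt_mem_shell_iff (by omega) hp]
    simp [h]
  · rw [← integral_zero]
    congr 1
    ext θ
    rw [Function.comp_apply, Set.indicator_of_notMem]
    rw [pt_mem_shell_iff (by omega) hp]
    simp [h]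

/-- Dominated convergence: the indicator of the positive orthant is discontinuous only where a
coordinate vanishes, and such directions are negligible by `surf_coord_eq_zero`. -/
theorem tendsto_sphereIntegral (hb : 2 < b) (hn : b < n) (f : (Fin n → ℝ) →ᵇ ℝ) :
    Tendsto (sphereIntegral f) (𝓝 (1, radius b n)) (𝓝 (sphereIntegral f (1, radius b n))) := by
  have h2 := two_lt_of_lt hb hn
  refine tendsto_integral_filter_of_dominated_convergence (fun _ => ‖f‖) ?_ ?_ ?_ ?_
  · exact Eventually.of_forall fun p => ((measurable_indicator_pos f).comp_measurable
      (continuous_pt_right _ _).measurable).aestronglyMeasurable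
  · refine Eventually.of_forall fun p => Eventually.of_forall fun θ => ?_
    exact (norm_indicator_le_norm_self _ _).trans (f.norm_coe_le_norm _)
  · exact integrable_const _
  · have h : ∀ i, ∀ᵐ θ ∂(surf n), pt 1 (radius b n) θ i ≠ 0 := by
      intro i
      have h3 : (3 : ℝ) ≤ n := by exact_mod_cast h2
      refine ae_iff.2 ?_
      simp only [not_not]
      refine surf_coord_eq_zero (by omega) (radius_pos hb hn) ?_ i
      rw [radius_sq hb]
      nlinarith [mul_pos (by linarith : (0 : ℝ) < b - 2) (by linarith : (0 : ℝ) < n - 1)]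
    filter_upwards [ae_all_iff.2 h] with θ hθ
    have hcont : Continuous fun p : ℝ × ℝ => pt p.1 p.2 θ :=
      continuous_pt.comp (by fun_prop : Continuous fun p : ℝ × ℝ => (p, θ))
    refine Tendsto.comp (g := Set.indicator {x : Fin n → ℝ | ∀ i, 0 < x i} f)
      (f := fun p : ℝ × ℝ => pt p.1 p.2 θ) (y := 𝓝 (pt 1 (radius b n) θ)) ?_
      (hcont.tendsto (1, radius b n))
    by_cases hpos : ∀ i, 0 < pt 1 (radius b n) θ i
    · have hev : Set.indicator {x : Fin n → ℝ | ∀ i, 0 < x i} f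
          =ᶠ[𝓝 (pt 1 (radius b n) θ)] f := by
        filter_upwards [(isOpen_pos n).mem_nhds hpos] with x hx
        exact Set.indicator_of_mem (show x ∈ {x : Fin n → ℝ | ∀ i, 0 < x i} from hx) _
      rw [Set.indicator_of_mem (show pt 1 (radius b n) θ ∈
          {x : Fin n → ℝ | ∀ i, 0 < x i} from hpos)]
      exact (f.continuous.tendsto _).congr' hev.symm
    · push Not at hpos
      obtain ⟨i, hi⟩ := hpos
      have hi' : pt 1 (radius b n) θ i < 0 := lt_of_le_of_ne hi (hθ i)
      have hev : Set.indicator {x : Fin n → ℝ | ∀ i, 0 < x i} f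
          =ᶠ[𝓝 (pt 1 (radius b n) θ)] fun _ => 0 := by
        filter_upwards [(isOpen_lt (continuous_apply i) continuous_const).mem_nhds hi'] with x hx
        exact Set.indicator_of_notMem
          (show x ∉ {x : Fin n → ℝ | ∀ i, 0 < x i} from fun h => (hx.trans (h i)).false) _
      rw [Set.indicator_of_notMem (show pt 1 (radius b n) θ ∉ {x : Fin n → ℝ | ∀ i, 0 < x i} from
        fun h => (hi'.trans (h i)).false)]
      exact tendsto_const_nhds.congr' hev.symm

theorem tendsto_shellParam (hb : 2 < b) (hn : b < n) :
    Tendsto (shellParam b n) (𝓝[>] 0) (𝓝 (1, radius b n)).smallSets := by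
  have h2 := two_lt_of_lt hb hn
  have h0 : (0 : ℝ) < n := by positivity
  rw [tendsto_smallSets_iff]
  intro U hU
  -- `G` recovers mean and radius continuously from the mean and the mean square, whose deviations
  -- are what the shell bounds.
  set G : ℝ × ℝ → ℝ × ℝ := fun q => (q.1, √(n * (q.2 - q.1 ^ 2))) with hG
  have hGc : Continuous G := by fun_prop
  have hG1 : G (1, b) = (1, radius b n) := by simp [hG, radius]
  have hU' : G ⁻¹' U ∈ 𝓝 (1, b) := hGc.continuousAt (by rwa [hG1])
  obtain ⟨δ, hδ, hball⟩ := Metric.mem_nhds_iff.1 hU'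
  filter_upwards [Ioo_mem_nhdsGT hδ] with ε hε p hp
  have hGp : G (p.1, p.1 ^ 2 + p.2 ^ 2 / n) = p := by
    refine Prod.ext rfl ?_
    simp only [hG]
    rw [add_sub_cancel_left, mul_div_cancel₀ _ h0.ne', Real.sqrt_sq hp.2.2.le]
  rw [← hGp]
  apply hball
  rw [Metric.mem_ball, Prod.dist_eq, max_lt_iff, Real.dist_eq, Real.dist_eq]
  exact ⟨hp.1.trans hε.2, hp.2.1.trans hε.2⟩

theorem isUniformOnK_unif (hb : 2 < b) (hn : b < n) : IsUniformOnK b n (unif b n) where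
  isProbabilityMeasure := isProbabilityMeasure_unif hb hn
  carried := unif_K hb hn
  tendsto_shell f := by
    have h2 := two_lt_of_lt hb hn
    obtain ⟨c, hc, hpolar⟩ := setIntegral_shell_eq (b := b) (n := n) (by omega)
    set m : ℝ → ℝ := fun ε => (meanRadial n).real (shellParam b n ε) with hm
    have hvol : ∀ ε, (volume (shell b n ε)).toReal =
        c * ∫ p in shellParam b n ε, sphereIntegral (n := n) 1 p ∂(meanRadial n) := by
      intro ε
      rw [← hpolar]
      simp [Measure.real]
    have hm0 : ∀ ε, 0 < ε → m ε ≠ 0 := by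
      intro ε hε h
      have hv := volume_shell_ne_zero hb hn hε
      have hv' := hvol ε
      have hne : (volume (shell b n ε)).toReal ≠ 0 :=
        ENNReal.toReal_ne_zero.2 ⟨hv, volume_shell_ne_top (by omega) ε⟩
      apply hne
      rw [hv']
      have hfin : meanRadial n (shellParam b n ε) ≠ ⊤ := by
        have hbd : shellParam b n ε ⊆ Metric.closedBall 0 (1 + ε + √(n * (b + ε))) := by
          intro p hp
          have h1 := abs_lt.1 hp.1
          have h3 := abs_lt.1 hp.2.1
          have h4 : p.2 ≤ √(n * (b + ε)) := by
            refine Real.le_sqrt_of_sq_le ?_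
            have h0 : (0 : ℝ) < n := by positivity
            have : p.2 ^ 2 / n ≤ b + ε := by nlinarith [sq_nonneg p.1]
            rw [div_le_iff₀ h0] at this
            linarith
          have h5 := Real.sqrt_nonneg (n * (b + ε))
          have h6 := hp.2.2
          rw [mem_closedBall_zero_iff, Prod.norm_def, max_le_iff, Real.norm_eq_abs,
            Real.norm_eq_abs, abs_le, abs_le]
          refine ⟨⟨?_, ?_⟩, ?_, ?_⟩ <;> linarith
        exact ((measure_mono hbd).trans_lt measure_closedBall_lt_top).ne
      have hz : meanRadial n (shellParam b n ε) = 0 := by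
        rcases (ENNReal.toReal_eq_zero_iff _).1 h with h | h
        · exact h
        · exact absurd h hfin
      rw [Measure.restrict_eq_zero.2 hz]
      simp
    -- Averages over sets shrinking to a point converge to the value at that point when the function
    -- is continuous there.
    have key : ∀ g : (Fin n → ℝ) →ᵇ ℝ, Tendsto
        (fun ε => (∫ p in shellParam b n ε, sphereIntegral g p ∂(meanRadial n)) / m ε) (𝓝[>] 0)
        (𝓝 (sphereIntegral g (1, radius b n))) := by
      intro g
      have h := Tendsto.integral_sub_linear_isLittleO_ae (μ := meanRadial n)
        ((tendsto_sphereIntegral hb hn g).mono_left inf_le_left)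
        (stronglyMeasurable_sphereIntegral g).stronglyMeasurableAtFilter
        ((meanRadial n).finiteAt_nhds _) (tendsto_shellParam hb hn)
      have h' := h.tendsto_div_nhds_zero
      have h'' := h'.add_const (sphereIntegral g (1, radius b n))
      rw [zero_add] at h''
      refine h''.congr' ?_
      filter_upwards [self_mem_nhdsWithin] with ε hε
      have := hm0 ε hε
      have hme : (meanRadial n).real (shellParam b n ε) = m ε := rfl
      rw [hme, smul_eq_mul]
      field_simp
      ring
    have hsph : ∀ g : (Fin n → ℝ) →ᵇ ℝ, sphereIntegral g (1, radius b n) =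
        ∫ θ in posDir n (radius b n), g (pt 1 (radius b n) θ) ∂(surf n) := by
      intro g
      rw [← integral_indicator (isOpen_posDir n _).measurableSet]
      rfl
    have hne : (surf n (posDir n (radius b n))).toReal ≠ 0 :=
      ENNReal.toReal_ne_zero.2 ⟨surf_posDir_radius hb hn, measure_ne_top _ _⟩
    have h1 : sphereIntegral (n := n) 1 (1, radius b n) =
        (surf n (posDir n (radius b n))).toReal := by
      rw [hsph]
      simp [Measure.real]
    have hlim := (key f).div (key 1) (by rw [h1]; exact hne)
    have hval : ∫ x, f x ∂(unif b n) =
        sphereIntegral f (1, radius b n) / sphereIntegral (n := n) 1 (1, radius b n) := by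
      rw [unif, integral_map (continuous_pt_right _ _).measurable.aemeasurable
        f.continuous.aestronglyMeasurable, ProbabilityTheory.cond, integral_smul_measure, h1, hsph,
        smul_eq_mul,
        ENNReal.toReal_inv]
      ring
    rw [hval]
    refine hlim.congr' ?_
    filter_upwards [self_mem_nhdsWithin] with ε hε
    have := hm0 ε hε
    rw [ProbabilityTheory.cond, integral_smul_measure, smul_eq_mul, ENNReal.toReal_inv,
      hvol, hpolar]
    have h3 : (∫ p in shellParam b n ε, sphereIntegral (n := n) 1 p ∂(meanRadial n)) ≠ 0 := by
      intro h
      have := hvol ε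
      rw [h, mul_zero] at this
      exact ENNReal.toReal_ne_zero.2
        ⟨volume_shell_ne_zero hb hn hε, volume_shell_ne_top (by omega) ε⟩ this
    simp only [Pi.div_apply]
    field_simp

theorem IsUniformOnK.unique {ν ν' : Measure (Fin n → ℝ)} (h : IsUniformOnK b n ν)
    (h' : IsUniformOnK b n ν') : ν = ν' := by
  have := h.isProbabilityMeasure
  have := h'.isProbabilityMeasure
  refine ext_of_forall_integral_eq_of_IsFiniteMeasure fun f => ?_
  exact tendsto_nhds_unique (h.tendsto_shell f) (h'.tendsto_shell f)

theorem IsUniformOnK.eq_unif (hb : 2 < b) (hn : b < n) {ν : Measure (Fin n → ℝ)}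
    (h : IsUniformOnK b n ν) : ν = unif b n :=
  h.unique (isUniformOnK_unif hb hn)

theorem existsUnique_isUniformOnK (hb : 2 < b) (hn : b < n) :
    ∃! ν : Measure (Fin n → ℝ), IsUniformOnK b n ν :=
  ⟨unif b n, isUniformOnK_unif hb hn, fun _ h => h.eq_unif hb hn⟩

end

/-! ### The joint density of independent exponential variables -/

theorem measurableSet_lt_and_le_and_le {Ω : Type*} [MeasurableSpace Ω] {f₁ g₁ f₂ g₂ f₃ g₃ : Ω → ℝ}
    (hf₁ : Measurable f₁) (hg₁ : Measurable g₁) (hf₂ : Measurable f₂) (hg₂ : Measurable g₂)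
    (hf₃ : Measurable f₃) (hg₃ : Measurable g₃) :
    MeasurableSet {x | f₁ x < g₁ x ∧ f₂ x ≤ g₂ x ∧ f₃ x ≤ g₃ x} :=
  (measurableSet_lt hf₁ hg₁).inter ((measurableSet_le hf₂ hg₂).inter (measurableSet_le hf₃ hg₃))

/-- The law of `n` independent exponential random variables with mean one. -/
noncomputable abbrev expPi (n : ℕ) : Measure (Fin n → ℝ) := Measure.pi fun _ => expMeasure 1

instance : IsProbabilityMeasure (expMeasure 1) := isProbabilityMeasure_expMeasure one_pos

/-- The density of the exponential distribution with mean one. -/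
noncomputable def expDensity (x : ℝ) : ℝ := (Set.Ioi 0).indicator (fun x => Real.exp (-x)) x

theorem measurable_expDensity : Measurable expDensity :=
  Measurable.indicator (by fun_prop) measurableSet_Ioi

theorem expDensity_nonneg (x : ℝ) : 0 ≤ expDensity x :=
  Set.indicator_nonneg (fun _ _ => (Real.exp_pos _).le) x

theorem expMeasure_one_eq_withDensity :
    expMeasure 1 = volume.withDensity fun x => ENNReal.ofReal (expDensity x) := by
  change volume.withDensity (gammaPDF 1 1) = _
  refine withDensity_congr_ae ?_
  -- The two densities differ at zero, where `expDensity` vanishes.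
  have h0 : ∀ᵐ x : ℝ, x ≠ 0 := by simp [ae_iff]
  filter_upwards [h0] with x hx
  change exponentialPDF 1 x = _
  rw [exponentialPDF_eq, expDensity]
  rcases lt_or_gt_of_ne hx with h | h
  · simp [h.not_ge, h.not_gt]
  · simp [h.le, h]

theorem integrable_expDensity : Integrable expDensity := by
  unfold expDensity
  rw [integrable_indicator_iff measurableSet_Ioi]
  exact integrableOn_exp_neg_Ioi 0

theorem expPi_eq_withDensity (n : ℕ) : expPi n =
    volume.withDensity fun x => ENNReal.ofReal (∏ i, expDensity (x i)) := by
  refine Measure.pi_eq fun s hs => ?_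
  have hm : MeasurableSet (Set.univ.pi s) := MeasurableSet.univ_pi hs
  have h1 : ∀ i, expMeasure 1 (s i) =
      ENNReal.ofReal (∫ x, (s i).indicator expDensity x) := by
    intro i
    rw [expMeasure_one_eq_withDensity, withDensity_apply _ (hs i), integral_indicator (hs i),
      ofReal_integral_eq_lintegral_ofReal integrable_expDensity.integrableOn
        (Eventually.of_forall expDensity_nonneg)]
  have hint : Integrable fun x : Fin n → ℝ => ∏ i, (s i).indicator expDensity (x i) :=
    Integrable.fintype_prod fun i => integrable_expDensity.indicator (hs i)
  have hnn : ∀ i y, 0 ≤ (s i).indicator expDensity y := fun i y =>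
    Set.indicator_nonneg (fun _ _ => expDensity_nonneg _) y
  rw [withDensity_apply _ hm, ← lintegral_indicator hm]
  simp only [h1]
  rw [← ENNReal.ofReal_prod_of_nonneg fun i _ => integral_nonneg (hnn i),
    ← integral_fintype_prod_volume_eq_prod,
    ofReal_integral_eq_lintegral_ofReal hint
      (Eventually.of_forall fun x => Finset.prod_nonneg fun i _ => hnn i _)]
  refine lintegral_congr fun x => ?_
  by_cases hx : x ∈ Set.univ.pi s
  · rw [Set.indicator_of_mem hx]
    congr 1
    exact Finset.prod_congr rfl fun i _ => (Set.indicator_of_mem (hx i (Set.mem_univ i)) _).symm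
  · rw [Set.indicator_of_notMem hx]
    simp only [Set.mem_pi, Set.mem_univ, true_imp_iff, not_forall] at hx
    obtain ⟨i, hi⟩ := hx
    rw [Finset.prod_eq_zero (Finset.mem_univ i) (Set.indicator_of_notMem hi _)]
    simp

/-- The reason exponential variables are the right comparison: on the positive orthant the density
is constant on each set of fixed mean. -/
theorem prod_expDensity_of_pos {n : ℕ} {x : Fin n → ℝ} (hx : ∀ i, 0 < x i) :
    ∏ i, expDensity (x i) = Real.exp (-∑ i, x i) := by
  rw [← Finset.sum_neg_distrib, Real.exp_sum]
  exact Finset.prod_congr rfl fun i _ => Set.indicator_of_mem (Set.mem_Ioi.2 (hx i)) _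

theorem prod_expDensity_of_not_pos {n : ℕ} {x : Fin n → ℝ} (hx : ¬ ∀ i, 0 < x i) :
    ∏ i, expDensity (x i) = 0 := by
  push Not at hx
  obtain ⟨i, hi⟩ := hx
  exact Finset.prod_eq_zero (Finset.mem_univ i) (Set.indicator_of_notMem (by simpa using hi) _)

theorem expPi_ae_pos (n : ℕ) : ∀ᵐ x ∂(expPi n), ∀ i, 0 < x i := by
  have hm : Measurable fun x : Fin n → ℝ => ENNReal.ofReal (∏ i, expDensity (x i)) :=
    (Finset.measurable_prod _ fun i _ =>
      measurable_expDensity.comp (measurable_pi_apply i)).ennreal_ofReal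
  rw [expPi_eq_withDensity, ae_withDensity_iff hm]
  refine Eventually.of_forall fun x hx => ?_
  by_contra h
  exact hx (by rw [prod_expDensity_of_not_pos h]; simp)

/-! ### Comparing the uniform and the exponential law through thin cones -/

/-- The mean of the coordinates. -/
noncomputable def mean {n : ℕ} (x : Fin n → ℝ) : ℝ := (∑ i, x i) / n

/-- The distance of `x` from the diagonal. -/
noncomputable def offDiag {n : ℕ} (x : Fin n → ℝ) : ℝ := √(∑ i, x i ^ 2 - n * mean x ^ 2)

/-- The projection of `x` along rays from the diagonal onto the sphere with radius `radius b n`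
around `(1, …, 1)`. -/
noncomputable def sphereProj (b : ℝ) {n : ℕ} (x : Fin n → ℝ) : Fin n → ℝ :=
  fun i => 1 + radius b n / offDiag x * (x i - mean x)

section

variable {b : ℝ} {n : ℕ}

theorem mean_pt (hn : 0 < n) (t r : ℝ) (θ : Dir n) : mean (pt t r θ) = t := by
  have : (n : ℝ) ≠ 0 := by positivity
  rw [mean, sum_pt, mul_div_cancel_left₀ _ this]

theorem offDiag_pt (hn : 0 < n) (t : ℝ) {r : ℝ} (hr : 0 ≤ r) (θ : Dir n) :
    offDiag (pt t r θ) = r := by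
  rw [offDiag, mean_pt hn, sum_sq_pt, add_sub_cancel_left, Real.sqrt_sq hr]

theorem sphereProj_pt (hn : 0 < n) (t : ℝ) {r : ℝ} (hr : 0 < r) (θ : Dir n) :
    sphereProj b (pt t r θ) = pt 1 (radius b n) θ := by
  ext i
  rw [sphereProj, mean_pt hn, offDiag_pt hn t hr.le]
  simp only [pt]
  field_simp
  ring

theorem measurable_mean : Measurable (mean : (Fin n → ℝ) → ℝ) := by
  unfold mean
  fun_prop

theorem measurable_offDiag : Measurable (offDiag : (Fin n → ℝ) → ℝ) := by
  have := measurable_mean (n := n)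
  unfold offDiag
  fun_prop

theorem measurable_sphereProj : Measurable (sphereProj b : (Fin n → ℝ) → (Fin n → ℝ)) := by
  have := measurable_mean (n := n)
  have := measurable_offDiag (n := n)
  unfold sphereProj
  fun_prop

/-- The vectors that are by a factor in `[1, α]` closer to the diagonal than those
proportional to elements of `K`. -/
def innerCone (b : ℝ) (n : ℕ) (α : ℝ) : Set (Fin n → ℝ) :=
  {x | 0 < mean x ∧ radius b n * mean x ≤ α * offDiag x ∧ offDiag x ≤ radius b n * mean x}

/-- The vectors that are by a factor in `[1, α]` farther from the diagonal than those
proportional to elements of `K`. -/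
def outerCone (b : ℝ) (n : ℕ) (α : ℝ) : Set (Fin n → ℝ) :=
  {x | 0 < mean x ∧ radius b n * mean x ≤ offDiag x ∧ offDiag x ≤ α * (radius b n * mean x)}

theorem measurableSet_innerCone (α : ℝ) : MeasurableSet (innerCone b n α) := by
  have h1 := measurable_mean (n := n)
  have h2 := measurable_offDiag (n := n)
  refine measurableSet_lt_and_le_and_le ?_ ?_ ?_ ?_ ?_ ?_ <;> fun_prop

theorem measurableSet_outerCone (α : ℝ) : MeasurableSet (outerCone b n α) := by
  have h1 := measurable_mean (n := n)
  have h2 := measurable_offDiag (n := n)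
  refine measurableSet_lt_and_le_and_le ?_ ?_ ?_ ?_ ?_ ?_ <;> fun_prop

theorem expPi_eq_polar (hn : 2 ≤ n) : ∃ c : ENNReal, ∀ s : Set (Fin n → ℝ), MeasurableSet s →
    expPi n s = c * ∫⁻ p, ∫⁻ θ, s.indicator (fun x => ENNReal.ofReal (∏ i, expDensity (x i)))
      (pt p.1 p.2 θ) ∂(surf n) ∂(meanRadial n) := by
  obtain ⟨c, -, -, hvol⟩ := exists_volume_eq_polar n hn
  refine ⟨c, fun s hs => ?_⟩
  have hm : Measurable (s.indicator fun x : Fin n → ℝ => ENNReal.ofReal (∏ i, expDensity (x i))) :=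
    (Finset.measurable_prod _ fun i _ =>
      measurable_expDensity.comp (measurable_pi_apply i)).ennreal_ofReal.indicator hs
  have hpm : Measurable fun p : (ℝ × ℝ) × Dir n => pt p.1.1 p.1.2 p.2 := continuous_pt.measurable
  rw [expPi_eq_withDensity, withDensity_apply _ hs, ← lintegral_indicator hs, hvol,
    lintegral_smul_measure, lintegral_map hm hpm, smul_eq_mul]
  congr 1
  exact lintegral_prod _ (hm.comp hpm).aemeasurable

/-- Bounding the density `r ^ (d - 1)` by its extreme values on the two intervals loses the factor
`α ^ (2 * (d - 1) + 1)`. This crude bound suffices, as `α` will be `1 + κ / √n` and the loss at most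
`exp (2κ√n)` with `κ` small. -/
theorem radial_Icc_le (hn : 0 < n) {a α : ℝ} (ha : 0 < a) (hα : 1 < α) :
    radial n (Set.Icc a (α * a)) ≤ ENNReal.ofReal (α ^ (2 * n)) * radial n (Set.Icc (a / α) a) := by
  set d := Module.finrank ℝ (zeroSum n) with hd
  have hdn : d ≤ n := by
    have := Submodule.finrank_le (zeroSum n)
    simpa using this
  have hα0 : 0 < α := by linarith
  have hrad : ∀ u v : ℝ, 0 < u → radial n (Set.Icc u v) =
      ∫⁻ r in Set.Icc u v, ENNReal.ofReal (r ^ (d - 1)) := by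
    intro u v hu
    rw [radial, withDensity_apply _ measurableSet_Icc, Measure.restrict_restrict measurableSet_Icc,
      Set.inter_eq_left.2 fun x (hx : x ∈ Set.Icc u v) => Set.mem_Ioi.2 (hu.trans_le hx.1)]
  have hup : radial n (Set.Icc a (α * a)) ≤
      ENNReal.ofReal ((α * a) ^ (d - 1) * (α * a - a)) := by
    rw [hrad _ _ ha, ENNReal.ofReal_mul (by positivity)]
    refine (setLIntegral_mono (g := fun _ => ENNReal.ofReal ((α * a) ^ (d - 1))) measurable_const
      fun r hr => ENNReal.ofReal_le_ofReal ?_).trans ?_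
    · exact pow_le_pow_left₀ (ha.le.trans hr.1) hr.2 _
    · rw [setLIntegral_const, Real.volume_Icc]
  have hlow : ENNReal.ofReal ((a / α) ^ (d - 1) * (a - a / α)) ≤ radial n (Set.Icc (a / α) a) := by
    rw [hrad _ _ (by positivity), ENNReal.ofReal_mul (by positivity)]
    refine le_trans ?_ (setLIntegral_mono (f := fun _ => ENNReal.ofReal ((a / α) ^ (d - 1)))
      (by fun_prop) fun r hr => ENNReal.ofReal_le_ofReal ?_)
    · rw [setLIntegral_const, Real.volume_Icc]
    · exact pow_le_pow_left₀ (by positivity) hr.1 _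
  refine hup.trans (le_trans ?_ (mul_le_mul_right hlow _))
  rw [← ENNReal.ofReal_mul (by positivity)]
  refine ENNReal.ofReal_le_ofReal ?_
  have h1 : (α * a) ^ (d - 1) * (α * a - a) =
      α ^ (2 * (d - 1) + 1) * ((a / α) ^ (d - 1) * (a - a / α)) := by
    have : α * a = α ^ 2 * (a / α) := by field_simp
    rw [this, mul_pow, ← pow_mul, pow_succ]
    field_simp
    ring
  rw [h1]
  have h2 : 0 ≤ (a / α) ^ (d - 1) * (a - a / α) := by
    refine mul_nonneg (by positivity) (sub_nonneg.2 ?_)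
    rw [div_le_iff₀ hα0]
    nlinarith
  exact mul_le_mul_of_nonneg_right (pow_le_pow_right₀ hα.le (by omega)) h2

/-- Fix mean and radius. In the inner cone every direction of `posDir n R` is admissible, so the
slice over `A` has at least the surface measure of the corresponding part of `posDir n R`. In the
outer cone only directions of `posDir n R` are admissible. The remaining weights of mean and radius
differ by at most `α ^ (2 * n)`. -/
theorem unif_mul_expPi_outerCone_le (hb : 2 < b) (hn : b < n) {α : ℝ} (hα : 1 < α)
    {A : Set (Fin n → ℝ)} (hA : MeasurableSet A) :
    unif b n A * expPi n (outerCone b n α) ≤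
      ENNReal.ofReal (α ^ (2 * n)) * expPi n (innerCone b n α ∩ sphereProj b ⁻¹' A) := by
  have h2 := two_lt_of_lt hb hn
  have hn0 : 0 < n := by omega
  have hα0 : 0 < α := by linarith
  have hR := radius_pos hb hn
  set R := radius b n with hRdef
  obtain ⟨c, hc⟩ := expPi_eq_polar (n := n) (by omega)
  have hP : MeasurableSet (posDir n R) := (isOpen_posDir n R).measurableSet
  have hBm : MeasurableSet (posDir n R ∩ pt 1 R ⁻¹' A) :=
    hP.inter (hA.preimage (continuous_pt_right 1 R).measurable)
  -- The weight of the pairs with mean `t > 0` and radius between `u t` and `v t`, where `exp (-(n *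
  -- t))` is the exponential density.
  set J : ℝ → ℝ → ENNReal := fun u v => ∫⁻ t in Set.Ioi (0 : ℝ),
    ENNReal.ofReal (Real.exp (-(n * t))) * radial n (Set.Icc (u * t) (v * t)) with hJ
  have hbox : ∀ u v : ℝ, MeasurableSet
      {p : ℝ × ℝ | 0 < p.1 ∧ p.2 ∈ Set.Icc (u * p.1) (v * p.1)} := by
    intro u v
    refine measurableSet_lt_and_le_and_le ?_ ?_ ?_ ?_ ?_ ?_ <;> fun_prop
  have hJeq : ∀ u v : ℝ, ∫⁻ p, {p : ℝ × ℝ | 0 < p.1 ∧ p.2 ∈ Set.Icc (u * p.1) (v * p.1)}.indicator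
      (fun p => ENNReal.ofReal (Real.exp (-(n * p.1)))) p ∂(meanRadial n) = J u v := by
    intro u v
    rw [lintegral_prod _ (Measurable.indicator (by fun_prop) (hbox u v)).aemeasurable]
    simp only [hJ]
    rw [← lintegral_indicator measurableSet_Ioi]
    refine lintegral_congr fun t => ?_
    by_cases ht : 0 < t
    · rw [Set.indicator_of_mem (Set.mem_Ioi.2 ht), ← setLIntegral_const,
        ← lintegral_indicator measurableSet_Icc]
      refine lintegral_congr fun r => ?_
      by_cases hr : r ∈ Set.Icc (u * t) (v * t)
      · rw [Set.indicator_of_mem hr, Set.indicator_of_mem]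
        exact ⟨ht, hr⟩
      · rw [Set.indicator_of_notMem hr, Set.indicator_of_notMem]
        exact fun h => hr h.2
    · rw [Set.indicator_of_notMem (by simpa using ht)]
      rw [← lintegral_zero (μ := radial n)]
      refine lintegral_congr fun r => Set.indicator_of_notMem ?_ _
      exact fun h => ht h.1
  have hdens : ∀ {t r : ℝ} {θ : Dir n}, (∀ i, 0 < pt t r θ i) →
      ENNReal.ofReal (∏ i, expDensity (pt t r θ i)) = ENNReal.ofReal (Real.exp (-(n * t))) := by
    intro t r θ h
    rw [prod_expDensity_of_pos h, sum_pt]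
  have hlow : c * (surf n (posDir n R ∩ pt 1 R ⁻¹' A) * J (R / α) R) ≤
      expPi n (innerCone b n α ∩ sphereProj b ⁻¹' A) := by
    rw [hc _ ((measurableSet_innerCone α).inter (hA.preimage measurable_sphereProj)),
      ← hJeq, ← lintegral_const_mul _ (Measurable.indicator (by fun_prop) (hbox _ _))]
    refine mul_le_mul_right (lintegral_mono_ae ?_) _
    filter_upwards [meanRadial_ae_pos] with p hp
    by_cases hbx : p ∈ {p : ℝ × ℝ | 0 < p.1 ∧ p.2 ∈ Set.Icc (R / α * p.1) (R * p.1)}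
    · obtain ⟨ht, hr1, hr2⟩ := id hbx
      rw [Set.indicator_of_mem hbx, mul_comm, ← lintegral_indicator_const hBm]
      refine lintegral_mono fun θ => ?_
      by_cases hθ : θ ∈ posDir n R ∩ pt 1 R ⁻¹' A
      · have hpos := pt_pos_mono (θ := θ) one_pos hp.le ht (by linarith) hθ.1
        rw [Set.indicator_of_mem hθ, Set.indicator_of_mem, hdens hpos]
        refine ⟨⟨?_, ?_, ?_⟩, ?_⟩
        · rwa [mean_pt hn0]
        · rw [mean_pt hn0, offDiag_pt hn0 _ hp.le]
          rw [div_mul_eq_mul_div, div_le_iff₀ hα0] at hr1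
          linarith
        · rwa [mean_pt hn0, offDiag_pt hn0 _ hp.le]
        · rw [Set.mem_preimage, sphereProj_pt hn0 _ hp]
          exact hθ.2
      · rw [Set.indicator_of_notMem hθ]
        exact zero_le
    · rw [Set.indicator_of_notMem hbx, mul_zero]
      exact zero_le
  have hup : expPi n (outerCone b n α) ≤ c * (surf n (posDir n R) * J R (α * R)) := by
    rw [hc _ (measurableSet_outerCone α),
      ← hJeq, ← lintegral_const_mul _ (Measurable.indicator (by fun_prop) (hbox _ _))]
    refine mul_le_mul_right (lintegral_mono_ae ?_) _
    filter_upwards [meanRadial_ae_pos] with p hp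
    by_cases hbx : p ∈ {p : ℝ × ℝ | 0 < p.1 ∧ p.2 ∈ Set.Icc (R * p.1) (α * R * p.1)}
    · obtain ⟨ht, hr1, hr2⟩ := id hbx
      rw [Set.indicator_of_mem hbx, mul_comm, ← lintegral_indicator_const hP]
      refine lintegral_mono fun θ => ?_
      by_cases hpos : ∀ i, 0 < pt p.1 p.2 θ i
      · have hθ : θ ∈ posDir n R := pt_pos_mono (θ := θ) ht hR.le one_pos (by linarith) hpos
        rw [Set.indicator_of_mem hθ, ← hdens hpos]
        exact Set.indicator_le_self _ _ _
      · refine le_trans (Set.indicator_le_self _ _ _) ?_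
        rw [prod_expDensity_of_not_pos hpos]
        simp
    · rw [Set.indicator_of_notMem hbx, mul_zero, nonpos_iff_eq_zero, ← lintegral_zero (μ := surf n)]
      refine lintegral_congr fun θ => Set.indicator_of_notMem ?_ _
      rintro ⟨h1, h2, h3⟩
      rw [mean_pt hn0] at h1
      rw [mean_pt hn0, offDiag_pt hn0 _ hp.le] at h2 h3
      exact hbx ⟨h1, h2, by rw [mul_assoc]; exact h3⟩
  have hJle : J R (α * R) ≤ ENNReal.ofReal (α ^ (2 * n)) * J (R / α) R := by
    rw [hJ, ← lintegral_const_mul' _ _ ENNReal.ofReal_ne_top]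
    refine setLIntegral_mono' measurableSet_Ioi fun t ht => ?_
    have h := radial_Icc_le (n := n) hn0 (mul_pos hR (Set.mem_Ioi.1 ht)) hα
    have e1 : α * R * t = α * (R * t) := by ring
    have e2 : R / α * t = R * t / α := by ring
    rw [e1, e2, mul_left_comm (ENNReal.ofReal (α ^ (2 * n)))]
    exact mul_le_mul_right h _
  have hU : unif b n A * surf n (posDir n R) = surf n (posDir n R ∩ pt 1 R ⁻¹' A) := by
    rw [unif, Measure.map_apply (continuous_pt_right _ _).measurable hA, cond_apply hP, mul_comm,
      ← mul_assoc, ENNReal.mul_inv_cancel (surf_posDir_radius hb hn) (measure_ne_top _ _), one_mul]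
  calc unif b n A * expPi n (outerCone b n α)
      ≤ unif b n A *
          (c * (surf n (posDir n R) * (ENNReal.ofReal (α ^ (2 * n)) * J (R / α) R))) := by
        gcongr
        exact hup.trans (by gcongr)
    _ = ENNReal.ofReal (α ^ (2 * n)) * (c * ((unif b n A * surf n (posDir n R)) *
          J (R / α) R)) := by
        ring
    _ ≤ _ := by
        rw [hU]
        gcongr

end

/-! ### Moments and exponential moments of the exponential distribution -/

theorem expMeasure_one_eq_withDensity_restrict :
    expMeasure 1 = (volume.restrict (Set.Ioi 0)).withDensity
      fun x => ENNReal.ofReal (Real.exp (-x)) := by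
  rw [expMeasure_one_eq_withDensity, ← withDensity_indicator measurableSet_Ioi]
  congr 1
  ext x
  by_cases hx : x ∈ Set.Ioi (0 : ℝ)
  · rw [expDensity, Set.indicator_of_mem hx, Set.indicator_of_mem hx]
  · rw [expDensity, Set.indicator_of_notMem hx, Set.indicator_of_notMem hx, ENNReal.ofReal_zero]

theorem integrable_expMeasure_iff {f : ℝ → ℝ} :
    Integrable f (expMeasure 1) ↔ IntegrableOn (fun x => Real.exp (-x) * f x) (Set.Ioi 0) := by
  rw [expMeasure_one_eq_withDensity_restrict,
    integrable_withDensity_iff_integrable_smul' (by fun_prop) (by simp)]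
  simp only [ENNReal.toReal_ofReal (Real.exp_pos _).le, smul_eq_mul, IntegrableOn]

theorem integral_expMeasure (f : ℝ → ℝ) :
    ∫ x, f x ∂(expMeasure 1) = ∫ x in Set.Ioi 0, Real.exp (-x) * f x := by
  rw [expMeasure_one_eq_withDensity_restrict,
    integral_withDensity_eq_integral_toReal_smul (by fun_prop) (by simp)]
  simp only [ENNReal.toReal_ofReal (Real.exp_pos _).le, smul_eq_mul]

theorem expMeasure_ae_pos : ∀ᵐ x ∂(expMeasure 1), 0 < x := by
  rw [expMeasure_one_eq_withDensity_restrict]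
  exact (withDensity_absolutelyContinuous _ _).ae_le (ae_restrict_mem measurableSet_Ioi)

theorem integrable_pow_mul_exp_expMeasure (k : ℕ) {a : ℝ} (ha : a < 1) :
    Integrable (fun x => x ^ k * Real.exp (a * x)) (expMeasure 1) := by
  rw [integrable_expMeasure_iff]
  have h := integrableOn_rpow_mul_exp_neg_mul_rpow (p := 1) (s := k) (b := 1 - a)
    (by linarith [(k.cast_nonneg : (0 : ℝ) ≤ k)]) one_pos (by linarith)
  refine h.congr_fun (fun x _ => ?_) measurableSet_Ioi
  simp only [Real.rpow_one, Real.rpow_natCast]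
  rw [mul_left_comm, ← Real.exp_add]
  ring_nf

theorem integrable_pow_expMeasure (k : ℕ) : Integrable (fun x => x ^ k) (expMeasure 1) := by
  simpa using integrable_pow_mul_exp_expMeasure k (a := 0) one_pos

theorem integral_pow_expMeasure (k : ℕ) : ∫ x, x ^ k ∂(expMeasure 1) = k.factorial := by
  rw [integral_expMeasure, ← Real.Gamma_nat_eq_factorial, Real.Gamma_eq_integral (by positivity)]
  refine setIntegral_congr_fun measurableSet_Ioi fun x _ => ?_
  simp

theorem integrable_exp_mul_expMeasure {a : ℝ} (ha : a < 1) :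
    Integrable (fun x => Real.exp (a * x)) (expMeasure 1) := by
  simpa using integrable_pow_mul_exp_expMeasure 0 ha

theorem integral_exp_mul_expMeasure {a : ℝ} (ha : a < 1) :
    ∫ x, Real.exp (a * x) ∂(expMeasure 1) = (1 - a)⁻¹ := by
  rw [integral_expMeasure]
  have h := integral_exp_mul_Ioi (a := a - 1) (by linarith) 0
  have h1 : a - 1 ≠ 0 := by linarith
  have h2 : 1 - a ≠ 0 := by linarith
  calc ∫ x in Set.Ioi 0, Real.exp (-x) * Real.exp (a * x)
      = ∫ x in Set.Ioi 0, Real.exp ((a - 1) * x) := by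
        refine setIntegral_congr_fun measurableSet_Ioi fun x _ => ?_
        simp only [← Real.exp_add]
        ring_nf
    _ = (1 - a)⁻¹ := by
        rw [h, mul_zero, Real.exp_zero]
        field_simp
        ring

theorem integral_exp_mul_expMeasure_le {a : ℝ} (ha : a ≤ 1 / 2) :
    ∫ x, Real.exp (a * x) ∂(expMeasure 1) ≤ Real.exp (a + 2 * a ^ 2) := by
  rw [integral_exp_mul_expMeasure (by linarith)]
  refine le_trans ?_ (Real.add_one_le_exp _)
  rw [inv_le_iff_one_le_mul₀ (by linarith)]
  -- `(1 - a)(1 + a + 2a²) = 1 + a²(1 - 2a)`.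
  nlinarith [sq_nonneg a, mul_nonneg (sq_nonneg a) (by linarith : 0 ≤ 1 - 2 * a)]

/-! ### Events that are exponentially rare on the scale `√n` -/

/-- Chernoff's bound for sums of functions of independent exponential random variables. -/
theorem expPi_sum_ge_le (n : ℕ) {g : ℝ → ℝ} {lam m : ℝ} (hlam : 0 ≤ lam)
    (hint : Integrable (fun x => Real.exp (lam * g x)) (expMeasure 1))
    (hm : ∫ x, Real.exp (lam * g x) ∂(expMeasure 1) ≤ Real.exp m) (a : ℝ) :
    (expPi n).real {z | a ≤ ∑ i, g (z i)} ≤ Real.exp (-lam * a + n * m) := by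
  have h1 : ∀ z : Fin n → ℝ, Real.exp (lam * ∑ i, g (z i)) = ∏ i, Real.exp (lam * g (z i)) := by
    intro z
    rw [Finset.mul_sum, Real.exp_sum]
  have hint' : Integrable (fun z : Fin n → ℝ => Real.exp (lam * ∑ i, g (z i))) (expPi n) := by
    simp only [h1]
    exact Integrable.fintype_prod fun _ => hint
  refine (measure_ge_le_exp_mul_mgf a hlam hint').trans ?_
  rw [Real.exp_add, mgf]
  simp only [h1]
  rw [integral_fintype_prod_eq_prod (μ := fun _ => expMeasure 1)
    (fun (_ : Fin n) x => Real.exp (lam * g x)), Finset.prod_const, Finset.card_univ,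
    Fintype.card_fin, Real.exp_nat_mul]
  gcongr

/-- The sets `B n` have exponentially small probability on the scale `√n` with rate `γ`. -/
def ExpRare (γ : ℝ) (B : ∀ n : ℕ, Set (Fin n → ℝ)) : Prop :=
  ∃ C : ℝ, ∀ᶠ n : ℕ in atTop, (expPi n).real (B n) ≤ C * Real.exp (-(γ * √n))

theorem ExpRare.union {γ : ℝ} {B B' : ∀ n : ℕ, Set (Fin n → ℝ)} (h : ExpRare γ B)
    (h' : ExpRare γ B') : ExpRare γ fun n => B n ∪ B' n := by
  obtain ⟨C, hC⟩ := h
  obtain ⟨C', hC'⟩ := h'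
  refine ⟨C + C', ?_⟩
  filter_upwards [hC, hC'] with n h1 h2
  refine (measureReal_union_le _ _).trans ?_
  rw [add_mul]
  exact add_le_add h1 h2

theorem ExpRare.mono {γ : ℝ} {B B' : ∀ n : ℕ, Set (Fin n → ℝ)} (h : ExpRare γ B)
    (h' : ∀ᶠ n in atTop, B' n ⊆ B n) : ExpRare γ B' := by
  obtain ⟨C, hC⟩ := h
  refine ⟨C, ?_⟩
  filter_upwards [hC, h'] with n h1 h2
  exact (measureReal_mono h2).trans h1

theorem tendsto_sqrt_natCast : Tendsto (fun n : ℕ => √(n : ℝ)) atTop atTop :=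
  Real.tendsto_sqrt_atTop.comp tendsto_natCast_atTop_atTop

/-- If `E exp (λ g_n) ≤ exp (λ m + C λ²)` for `λ = c / √n`, then `∑ g_n ≥ n (m + δ)` has
probability at most of order `exp (- c δ √n)`. -/
theorem expRare_sum_ge {g : ℕ → ℝ → ℝ} {c C m δ γ : ℝ} (hc : 0 ≤ c) (hγ : γ ≤ c * δ)
    (h : ∀ᶠ n : ℕ in atTop, Integrable (fun x => Real.exp (c / √n * g n x)) (expMeasure 1) ∧
      ∫ x, Real.exp (c / √n * g n x) ∂(expMeasure 1) ≤
        Real.exp (c / √n * m + C * (c / √n) ^ 2)) :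
    ExpRare γ fun n => {z | n * (m + δ) ≤ ∑ i, g n (z i)} := by
  refine ⟨Real.exp (C * c ^ 2), ?_⟩
  filter_upwards [h, eventually_gt_atTop 0] with n hn hn0
  have h0 : (0 : ℝ) < √n := by positivity
  have hsq : √(n : ℝ) ^ 2 = n := Real.sq_sqrt (by positivity)
  refine (expPi_sum_ge_le n (by positivity) hn.1 hn.2 _).trans ?_
  rw [← Real.exp_add]
  refine Real.exp_le_exp.2 ?_
  -- With `λ = c / √n` the quadratic term contributes only the constant `C c²`, while the excess `δ`
  -- contributes `-c δ √n`.
  have e : ∀ s : ℝ, 0 < s → -(c / s) * (s ^ 2 * (m + δ)) + s ^ 2 * (c / s * m + C * (c / s) ^ 2) =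
      C * c ^ 2 - c * δ * s := by
    intro s hs
    field_simp
    ring
  have e' := e (√n) h0
  rw [hsq] at e'
  rw [e']
  nlinarith

theorem eventually_div_sqrt_le (c : ℝ) {a : ℝ} (ha : 0 < a) :
    ∀ᶠ n : ℕ in atTop, c / √n ≤ a := by
  have h : Tendsto (fun n : ℕ => c / √n) atTop (𝓝 0) :=
    tendsto_sqrt_natCast.const_div_atTop c
  exact (h.eventually (gt_mem_nhds ha)).mono fun _ h => h.le

/-- Every rate `γ` is attainable: take `λ = (γ / δ) / √n`, which for large `n` is within the range
of finite exponential moments. -/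
theorem expRare_mean {δ : ℝ} (hδ : 0 < δ) {γ : ℝ} (hγ : 0 < γ) :
    ExpRare γ fun _ => {z | δ ≤ |mean z - 1|} := by
  have hc : 0 < γ / δ := by positivity
  have hγδ : γ ≤ γ / δ * δ := by rw [div_mul_cancel₀ _ hδ.ne']
  have hup : ExpRare γ fun n => {z : Fin n → ℝ | n * (1 + δ) ≤ ∑ i, z i} := by
    refine expRare_sum_ge (g := fun _ x => x) (C := 2) hc.le hγδ ?_
    filter_upwards [eventually_div_sqrt_le (γ / δ) (a := 1 / 2) (by norm_num)] with n hn
    refine ⟨integrable_exp_mul_expMeasure (by linarith), ?_⟩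
    rw [mul_one]
    exact integral_exp_mul_expMeasure_le hn
  have hlow : ExpRare γ fun n => {z : Fin n → ℝ | n * (-1 + δ) ≤ ∑ i, -z i} := by
    refine expRare_sum_ge (g := fun _ x => -x) (C := 2) hc.le hγδ ?_
    refine Eventually.of_forall fun n => ?_
    have h0 : -(γ / δ / √n) ≤ 0 := by
      rw [neg_nonpos]
      positivity
    have e : ∀ x, Real.exp (γ / δ / √n * -x) = Real.exp (-(γ / δ / √n) * x) := fun x => by
      congr 1
      ring
    simp only [e]
    refine ⟨integrable_exp_mul_expMeasure (by linarith), ?_⟩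
    refine (integral_exp_mul_expMeasure_le (by linarith)).trans (le_of_eq ?_)
    congr 1
    ring
  refine (hup.union hlow).mono ?_
  filter_upwards [eventually_gt_atTop 0] with n hn z hz
  have h0 : (0 : ℝ) < n := by positivity
  simp only [Set.mem_ofPred_eq, mean] at hz
  rcases le_abs.1 hz with h | h
  · left
    have : 1 + δ ≤ (∑ i, z i) / n := by linarith
    rw [le_div_iff₀ h0] at this
    rw [Set.mem_ofPred_eq]
    linarith
  · right
    have : (∑ i, z i) / n ≤ 1 - δ := by linarith
    rw [div_le_iff₀ h0] at this
    rw [Set.mem_ofPred_eq, Finset.sum_neg_distrib]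
    linarith

/-- The sum of the squares of the coordinates up to `t`. -/
noncomputable def smallSq {n : ℕ} (t : ℝ) (z : Fin n → ℝ) : ℝ :=
  ∑ i, (Set.Iic t).indicator (fun x => x ^ 2) (z i)

/-- The sum of the coordinates larger than `t`. -/
noncomputable def largeSum {n : ℕ} (t : ℝ) (z : Fin n → ℝ) : ℝ :=
  ∑ i, (Set.Ioi t).indicator (fun x => x) (z i)

/-- For `x < 1`, multiply `(1 - x) exp x ≤ 1` by `1 + x`; for `x ≥ 1` the last term alone suffices.
-/
theorem exp_le_one_add_add_sq {x : ℝ} (hx : 0 ≤ x) :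
    Real.exp x ≤ 1 + x + x ^ 2 * Real.exp x := by
  have h1 : 1 - x ≤ Real.exp (-x) := by linarith [Real.add_one_le_exp (-x)]
  have h2 : Real.exp (-x) * Real.exp x = 1 := by rw [← Real.exp_add]; simp
  have h3 := Real.exp_pos x
  have h4 := Real.add_one_le_exp x
  rcases le_or_gt 1 x with h | h
  · have h5 : 1 * Real.exp x ≤ x ^ 2 * Real.exp x := by
      gcongr
      nlinarith
    linarith
  · have h5 : (1 - x) * Real.exp x ≤ 1 := by nlinarith
    have h6 : Real.exp x * (1 - x ^ 2) ≤ 1 + x := by nlinarith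
    linarith

theorem integral_one_add_mul_add_mul {Ω : Type*} [MeasurableSpace Ω] {μ : Measure Ω}
    [IsProbabilityMeasure μ] {f g : Ω → ℝ} (hf : Integrable f μ) (hg : Integrable g μ) (a b : ℝ) :
    ∫ x, (1 + a * f x + b * g x) ∂μ = 1 + a * ∫ x, f x ∂μ + b * ∫ x, g x ∂μ := by
  have h1 : Integrable (fun x => 1 + a * f x) μ := (integrable_const _).add (hf.const_mul _)
  rw [integral_add h1 (hg.const_mul _), integral_add (integrable_const _) (hf.const_mul _),
    integral_const_mul, integral_const_mul]
  simp

/-- Squares of exponential variables have no exponential moments, but below the cutoff `ε√n` one has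
`(c / √n) x² ≤ c ε x ≤ x / 2` as soon as `ε ≤ 1 / (2c)`. The second-order remainder is then
dominated by `λ² x⁴ exp (x / 2)`, which is integrable. -/
theorem exists_expRare_smallSq {δ : ℝ} (hδ : 0 < δ) {γ : ℝ} (hγ : 0 < γ) :
    ∃ ε₀ > 0, ∀ ε, 0 < ε → ε ≤ ε₀ →
      ExpRare γ fun n => {z | n * (2 + δ) ≤ smallSq (ε * √n) z} := by
  have hc : 0 < γ / δ := by positivity
  set c := γ / δ with hcdef
  set D := ∫ x, x ^ 4 * Real.exp (1 / 2 * x) ∂(expMeasure 1) with hD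
  refine ⟨1 / (2 * c), by positivity, fun ε hε hεc => ?_⟩
  refine expRare_sum_ge (g := fun n => (Set.Iic (ε * √n)).indicator fun x => x ^ 2)
    (c := c) (C := D)
    hc.le (by rw [hcdef, div_mul_cancel₀ _ hδ.ne']) ?_
  filter_upwards [eventually_gt_atTop 0] with n hn
  have h0 : (0 : ℝ) < √n := by positivity
  set lam := c / √n with hlam
  have hlam0 : 0 < lam := by positivity
  have hbound : ∀ᵐ x ∂(expMeasure 1),
      Real.exp (lam * (Set.Iic (ε * √n)).indicator (fun x => x ^ 2) x) ≤
        1 + lam * x ^ 2 + lam ^ 2 * (x ^ 4 * Real.exp (1 / 2 * x)) := by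
    filter_upwards [expMeasure_ae_pos] with x hx
    by_cases hxt : x ∈ Set.Iic (ε * √n)
    · rw [Set.indicator_of_mem hxt]
      have h1 : lam * x ^ 2 ≤ 1 / 2 * x := by
        have h2 : lam * x ≤ 1 / 2 := by
          calc lam * x ≤ c / √n * (ε * √n) := by gcongr; exact hxt
            _ = c * ε := by field_simp
            _ ≤ c * (1 / (2 * c)) := by gcongr
            _ = 1 / 2 := by field_simp
        nlinarith
      have h3 := exp_le_one_add_add_sq (x := lam * x ^ 2) (by positivity)
      have h4 : (lam * x ^ 2) ^ 2 * Real.exp (lam * x ^ 2) ≤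
          (lam * x ^ 2) ^ 2 * Real.exp (1 / 2 * x) := by gcongr
      nlinarith
    · rw [Set.indicator_of_notMem hxt, mul_zero, Real.exp_zero]
      have : 0 ≤ lam * x ^ 2 + lam ^ 2 * (x ^ 4 * Real.exp (1 / 2 * x)) := by positivity
      linarith
  have hint4 := integrable_pow_mul_exp_expMeasure 4 (a := 1 / 2) (by norm_num)
  have hint2 := integrable_pow_expMeasure 2
  have hintb : Integrable (fun x : ℝ => 1 + lam * x ^ 2 + lam ^ 2 * (x ^ 4 * Real.exp (1 / 2 * x)))
      (expMeasure 1) :=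
    ((integrable_const _).add (hint2.const_mul _)).add (hint4.const_mul _)
  have hmeas : Measurable fun x : ℝ =>
      Real.exp (lam * (Set.Iic (ε * √n)).indicator (fun x => x ^ 2) x) :=
    (((by fun_prop : Measurable fun x : ℝ => x ^ 2).indicator measurableSet_Iic).const_mul _).exp
  have hint : Integrable (fun x => Real.exp (lam * (Set.Iic (ε * √n)).indicator (fun x => x ^ 2) x))
      (expMeasure 1) := by
    refine hintb.mono' hmeas.aestronglyMeasurable ?_
    filter_upwards [hbound] with x hx
    rwa [Real.norm_eq_abs, abs_of_pos (Real.exp_pos _)]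
  refine ⟨hint, (integral_mono_ae hint hintb hbound).trans ?_⟩
  have hval := integral_one_add_mul_add_mul hint2 hint4 lam (lam ^ 2)
  have h2fac : ∫ x, x ^ 2 ∂(expMeasure 1) = 2 := by
    rw [integral_pow_expMeasure]
    norm_num [Nat.factorial]
  rw [h2fac] at hval
  rw [hval]
  have := Real.add_one_le_exp (lam * 2 + D * lam ^ 2)
  rw [← hD]
  linarith

/-- Here Chernoff's parameter is the fixed number `θ = γ / a < 1`. Since exceeding `ε√n` is
exponentially unlikely, the exponential moment of one summand is `1 + O(exp (-(1-θ)ε√n))`, and its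
`n`-th power stays bounded; what remains is `exp (-θ a √n) = exp (-γ√n)`. -/
theorem expRare_largeSum {ε γ a : ℝ} (hε : 0 < ε) (hγ : 0 < γ) (ha : γ < a) :
    ExpRare γ fun n => {z | a * √n ≤ largeSum (ε * √n) z} := by
  have ha0 : 0 < a := hγ.trans ha
  set θ := γ / a with hθ
  have hθ0 : 0 < θ := by positivity
  have hθ1 : θ < 1 := by rwa [hθ, div_lt_one ha0]
  have hη : 0 < 1 - θ := by linarith
  refine ⟨Real.exp 1, ?_⟩
  have hlim : Tendsto (fun n : ℕ => (n : ℝ) * (Real.exp (-((1 - θ) * (ε * √n))) / (1 - θ)))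
      atTop (𝓝 0) := by
    have h := (Real.tendsto_pow_mul_exp_neg_atTop_nhds_zero 2).comp
      (tendsto_sqrt_natCast.const_mul_atTop (mul_pos hη hε))
    have h' := h.const_mul (1 / (((1 - θ) * ε) ^ 2 * (1 - θ)))
    rw [mul_zero] at h'
    refine h'.congr fun n => ?_
    have hsq : √(n : ℝ) ^ 2 = n := Real.sq_sqrt (by positivity)
    simp only [Function.comp_apply]
    rw [mul_pow _ (√(n : ℝ)), hsq, mul_assoc (1 - θ)]
    field_simp
  filter_upwards [hlim.eventually (gt_mem_nhds one_pos), eventually_gt_atTop 0] with n hn hn0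
  set t := ε * √n with ht
  set w := Real.exp (-((1 - θ) * t)) / (1 - θ) with hw
  have hbound : ∀ x, Real.exp (θ * (Set.Ioi t).indicator (fun x => x) x) ≤
      1 + (Set.Ioi t).indicator (fun x => Real.exp (θ * x)) x := by
    intro x
    by_cases hx : x ∈ Set.Ioi t
    · rw [Set.indicator_of_mem hx, Set.indicator_of_mem hx]
      linarith
    · rw [Set.indicator_of_notMem hx, Set.indicator_of_notMem hx]
      simp
  have hintθ := (integrable_exp_mul_expMeasure hθ1).indicator (measurableSet_Ioi (a := t))
  have hintb : Integrable (fun x => 1 + (Set.Ioi t).indicator (fun x => Real.exp (θ * x)) x)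
      (expMeasure 1) := (integrable_const _).add hintθ
  have hmeas : Measurable fun x : ℝ => Real.exp (θ * (Set.Ioi t).indicator (fun x => x) x) :=
    ((measurable_id.indicator measurableSet_Ioi).const_mul _).exp
  have hint : Integrable (fun x => Real.exp (θ * (Set.Ioi t).indicator (fun x => x) x))
      (expMeasure 1) := by
    refine hintb.mono' hmeas.aestronglyMeasurable (Eventually.of_forall fun x => ?_)
    rw [Real.norm_eq_abs, abs_of_pos (Real.exp_pos _)]
    exact hbound x
  have ht0 : 0 ≤ t := by positivity
  have hval : ∫ x, (Set.Ioi t).indicator (fun x => Real.exp (θ * x)) x ∂(expMeasure 1) = w := by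
    rw [integral_expMeasure]
    have e : ∀ x, Real.exp (-x) * (Set.Ioi t).indicator (fun x => Real.exp (θ * x)) x =
        (Set.Ioi t).indicator (fun x => Real.exp ((θ - 1) * x)) x := by
      intro x
      by_cases hx : x ∈ Set.Ioi t
      · rw [Set.indicator_of_mem hx, Set.indicator_of_mem hx, ← Real.exp_add]
        ring_nf
      · rw [Set.indicator_of_notMem hx, Set.indicator_of_notMem hx, mul_zero]
    simp only [e]
    rw [setIntegral_indicator measurableSet_Ioi,
      Set.inter_eq_right.2 (Set.Ioi_subset_Ioi ht0), integral_exp_mul_Ioi (by linarith), hw]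
    have e1 : -((1 - θ) * t) = (θ - 1) * t := by ring
    rw [e1, ← neg_sub 1 θ]
    field_simp
  have hm : ∫ x, Real.exp (θ * (Set.Ioi t).indicator (fun x => x) x) ∂(expMeasure 1) ≤
      Real.exp w := by
    refine (integral_mono hint hintb hbound).trans ?_
    rw [integral_add (integrable_const _) hintθ, hval]
    have := Real.add_one_le_exp w
    simp
    linarith
  refine (expPi_sum_ge_le n hθ0.le hint hm _).trans ?_
  rw [← Real.exp_add]
  refine Real.exp_le_exp.2 ?_
  have e : -θ * (a * √n) = -(γ * √n) := by
    rw [hθ]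
    field_simp
  rw [e]
  linarith

/-! ### Lower bound for the outer cone: one big coordinate -/

/-- The weak law of large numbers for functions of independent exponential variables. -/
theorem tendsto_expPi_abs_sum_sub {g : ℝ → ℝ} (hg : MemLp g 2 (expMeasure 1)) {δ : ℝ} (hδ : 0 < δ) :
    Tendsto (fun m : ℕ => (expPi m).real
      {w | δ * m ≤ |∑ i, g (w i) - m * ∫ x, g x ∂(expMeasure 1)|}) atTop (𝓝 0) := by
  set V := variance g (expMeasure 1)
  have hlim : Tendsto (fun m : ℕ => V / δ ^ 2 / m) atTop (𝓝 0) :=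
    tendsto_const_div_atTop_nhds_zero_nat _
  refine squeeze_zero' (Eventually.of_forall fun _ => measureReal_nonneg) ?_ hlim
  filter_upwards [eventually_gt_atTop 0] with m hm
  have hm0 : (0 : ℝ) < m := by positivity
  have hmem : ∀ i : Fin m, MemLp (fun w : Fin m → ℝ => g (w i)) 2 (expPi m) := fun i =>
    hg.comp_measurePreserving (measurePreserving_eval (fun _ => expMeasure 1) i)
  have hsum : MemLp (∑ i : Fin m, fun w : Fin m → ℝ => g (w i)) 2 (expPi m) :=
    memLp_finsetSum' _ fun i _ => hmem i
  have hmean : ∫ w, (∑ i : Fin m, fun w : Fin m → ℝ => g (w i)) w ∂(expPi m) =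
      m * ∫ x, g x ∂(expMeasure 1) := by
    simp only [Finset.sum_apply]
    rw [integral_finsetSum _ fun i _ => (hmem i).integrable (by norm_num)]
    have : ∀ i : Fin m, ∫ w : Fin m → ℝ, g (w i) ∂(expPi m) = ∫ x, g x ∂(expMeasure 1) := by
      intro i
      have h := measurePreserving_eval (fun _ : Fin m => expMeasure 1) i
      have hg' : AEStronglyMeasurable g ((expPi m).map (Function.eval i)) := by
        rw [h.map_eq]
        exact hg.1
      exact (integral_map (measurable_pi_apply i).aemeasurable hg').symm.trans (by rw [h.map_eq])
    simp [this]
  have hvar : variance (∑ i : Fin m, fun w : Fin m → ℝ => g (w i)) (expPi m) = m * V := by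
    rw [variance_sum_pi fun _ => hg]
    simp [V]
  have h := meas_ge_le_variance_div_sq hsum (c := δ * m) (by positivity)
  rw [hmean, hvar] at h
  simp only [Finset.sum_apply] at h
  have h' := ENNReal.toReal_mono ENNReal.ofReal_ne_top h
  rw [ENNReal.toReal_ofReal (by have := variance_nonneg g (expMeasure 1); positivity)] at h'
  refine h'.trans (le_of_eq ?_)
  field_simp

/-- Here `a₁` and `a₂` are the sum and the sum of squares of all coordinates but one. A value `y₀`
of the remaining coordinate puts the vector exactly on the cone through `K`, by the intermediate
value theorem; raising that coordinate by `u` moves the vector outward, by a controlled amount. -/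
theorem exists_root_of_sum_sq_deficit {b n a₁ a₂ Y : ℝ} (ha₁ : 0 ≤ a₁) (hb : 0 ≤ b) (hbn : b ≤ n)
    (h0 : n * a₂ < b * a₁ ^ 2) (hY0 : 0 ≤ Y) (hY : b * (Y + a₁) ^ 2 ≤ n * (Y ^ 2 + a₂)) :
    ∃ y₀, 0 ≤ y₀ ∧ y₀ ≤ Y ∧ ∀ u, 0 ≤ u →
      b * (y₀ + u + a₁) ^ 2 ≤ n * ((y₀ + u) ^ 2 + a₂) ∧
      n * ((y₀ + u) ^ 2 + a₂) ≤ b * (y₀ + u + a₁) ^ 2 + u * (n * (2 * Y + u)) := by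
  have hcont : ContinuousOn (fun y : ℝ => n * (y ^ 2 + a₂) - b * (y + a₁) ^ 2) (Set.Icc 0 Y) := by
    fun_prop
  obtain ⟨y₀, ⟨hy0, hyY⟩, hy⟩ := intermediate_value_Icc hY0 hcont
    (show (0 : ℝ) ∈ Set.Icc _ _ from ⟨by nlinarith, by linarith⟩)
  simp only at hy
  refine ⟨y₀, hy0, hyY, fun u hu => ?_⟩
  -- By the equation for the root this product equals `b a₁² - n a₂`. Its positivity makes the
  -- quadratic increase beyond `y₀`.
  have h1 : 0 < y₀ * ((n - b) * y₀ - 2 * b * a₁) := by nlinarith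
  have h2 : 0 < (n - b) * y₀ - 2 * b * a₁ := by
    by_contra h
    push Not at h
    nlinarith
  have e : n * ((y₀ + u) ^ 2 + a₂) - b * (y₀ + u + a₁) ^ 2 =
      u * ((n - b) * (2 * y₀ + u) - 2 * b * a₁) := by linear_combination hy
  constructor
  · have : 0 ≤ u * ((n - b) * (2 * y₀ + u) - 2 * b * a₁) := by
      refine mul_nonneg hu ?_
      nlinarith [mul_nonneg (sub_nonneg.2 hbn) hy0, mul_nonneg (sub_nonneg.2 hbn) hu]
    linarith
  · have : u * ((n - b) * (2 * y₀ + u) - 2 * b * a₁) ≤ u * (n * (2 * Y + u)) := by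
      refine mul_le_mul_of_nonneg_left ?_ hu
      have h3 : (n - b) * (2 * y₀ + u) ≤ n * (2 * Y + u) := by
        refine mul_le_mul (by linarith) (by linarith) (by linarith) (by linarith)
      nlinarith [mul_nonneg hb ha₁]
    linarith

theorem expMeasure_Ioc_ge {y u : ℝ} (hy : 0 ≤ y) :
    ENNReal.ofReal (u * Real.exp (-(y + u))) ≤ expMeasure 1 (Set.Ioc y (y + u)) := by
  rw [expMeasure_one_eq_withDensity_restrict, withDensity_apply _ measurableSet_Ioc,
    Measure.restrict_restrict measurableSet_Ioc,
    Set.inter_eq_left.2 fun x (hx : x ∈ Set.Ioc y (y + u)) => Set.mem_Ioi.2 (hy.trans_lt hx.1)]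
  refine le_trans ?_ (setLIntegral_mono (f := fun _ => ENNReal.ofReal (Real.exp (-(y + u))))
    (by fun_prop) fun x hx => ENNReal.ofReal_le_ofReal ?_)
  · rw [setLIntegral_const, Real.volume_Ioc, add_sub_cancel_left, mul_comm,
      ENNReal.ofReal_mul (Real.exp_pos _).le]
  · exact Real.exp_le_exp.2 (by linarith [hx.2])

/-- A lower bound on a probability by conditioning on all coordinates but the first. -/
theorem expPi_succ_ge {m : ℕ} {s : Set (Fin (m + 1) → ℝ)} (hs : MeasurableSet s)
    {G : Set (Fin m → ℝ)} (hG : MeasurableSet G) {Y u : ℝ} (hu : 0 ≤ u)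
    (h : ∀ w ∈ G, ∃ y, 0 ≤ y ∧ y ≤ Y ∧ ∀ v, 0 ≤ v → v ≤ u → Fin.cons (y + v) w ∈ s) :
    u * Real.exp (-(Y + u)) * (expPi m).real G ≤ (expPi (m + 1)).real s := by
  have hmp := measurePreserving_piFinSuccAbove (fun _ : Fin (m + 1) => expMeasure 1) 0
  have hs' : MeasurableSet
      ((MeasurableEquiv.piFinSuccAbove (fun _ : Fin (m + 1) => ℝ) 0).symm ⁻¹' s) :=
    hs.preimage (MeasurableEquiv.measurable _)
  have e1 : expPi (m + 1) s = (expMeasure 1).prod (expPi m)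
      ((MeasurableEquiv.piFinSuccAbove (fun _ : Fin (m + 1) => ℝ) 0).symm ⁻¹' s) :=
    ((hmp.symm _).measure_preimage hs.nullMeasurableSet).symm
  have key : ENNReal.ofReal (u * Real.exp (-(Y + u))) * expPi m G ≤ expPi (m + 1) s := by
    rw [e1, Measure.prod_apply_symm hs', ← setLIntegral_const]
    refine le_trans ?_ (setLIntegral_le_lintegral G _)
    refine setLIntegral_mono' hG fun w hw => ?_
    obtain ⟨y, hy0, hyY, hy⟩ := h w hw
    have h1 : Set.Ioc y (y + u) ⊆ (fun x => (x, w)) ⁻¹'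
        ((MeasurableEquiv.piFinSuccAbove (fun _ : Fin (m + 1) => ℝ) 0).symm ⁻¹' s) := by
      intro x hx
      have := hy (x - y) (by linarith [hx.1]) (by linarith [hx.2])
      rw [add_sub_cancel] at this
      simpa [MeasurableEquiv.piFinSuccAbove, Fin.insertNthEquiv] using this
    refine le_trans ?_ ((expMeasure_Ioc_ge (u := u) hy0).trans (measure_mono h1))
    refine ENNReal.ofReal_le_ofReal (mul_le_mul_of_nonneg_left (Real.exp_le_exp.2 ?_) hu)
    linarith
  have := ENNReal.toReal_mono (measure_ne_top _ _) key
  rwa [ENNReal.toReal_mul, ENNReal.toReal_ofReal (by positivity)] at this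

theorem mem_outerCone_of_le {b : ℝ} {n : ℕ} (hb : 2 < b) (hn : 0 < n) {α : ℝ} (hα : 0 ≤ α)
    {z : Fin n → ℝ} (h0 : 0 < ∑ i, z i) (h1 : b * (∑ i, z i) ^ 2 ≤ n * ∑ i, z i ^ 2)
    (h2 : n * ∑ i, z i ^ 2 ≤ (1 + α ^ 2 * (b - 1)) * (∑ i, z i) ^ 2) : z ∈ outerCone b n α := by
  have hn0 : (0 : ℝ) < n := by positivity
  have hm : mean z * n = ∑ i, z i := by
    rw [mean, div_mul_cancel₀ _ hn0.ne']
  have hm0 : 0 < mean z := div_pos h0 hn0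
  rw [← hm] at h1 h2
  refine ⟨hm0, ?_, ?_⟩
  · rw [offDiag]
    refine Real.le_sqrt_of_sq_le ?_
    rw [mul_pow, radius_sq hb]
    nlinarith
  · rw [offDiag]
    refine Real.sqrt_le_iff.2 ⟨by unfold radius; positivity, ?_⟩
    rw [mul_pow, mul_pow, radius_sq hb]
    nlinarith

theorem memLp_pow_expMeasure (k : ℕ) : MemLp (fun x : ℝ => x ^ k) 2 (expMeasure 1) := by
  rw [memLp_two_iff_integrable_sq (by fun_prop)]
  simpa only [← pow_mul] using integrable_pow_expMeasure (k * 2)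

/-- At `δ = 0` the last two inequalities read `2 < b` and `b < q ^ 2 + 2`; use continuity. -/
theorem exists_small_tolerance {b q : ℝ} (hb : 2 < b) (hq : b < q ^ 2 + 2) :
    ∃ δ > 0, δ ≤ 1 / 2 ∧ 2 + δ < b * (1 - δ) ^ 2 ∧ b * (1 + 2 * δ) ^ 2 < q ^ 2 + 2 - δ := by
  have h1 : ∀ᶠ δ in 𝓝[>] (0 : ℝ), 2 + δ < b * (1 - δ) ^ 2 := by
    refine Eventually.filter_mono nhdsWithin_le_nhds ?_
    refine ContinuousAt.eventually_lt (f := fun δ : ℝ => 2 + δ) (by fun_prop) (by fun_prop) ?_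
    simpa using hb
  have h2 : ∀ᶠ δ in 𝓝[>] (0 : ℝ), b * (1 + 2 * δ) ^ 2 < q ^ 2 + 2 - δ := by
    refine Eventually.filter_mono nhdsWithin_le_nhds ?_
    refine ContinuousAt.eventually_lt (f := fun δ : ℝ => b * (1 + 2 * δ) ^ 2) (by fun_prop)
      (by fun_prop) ?_
    simpa using hq
  have h3 : ∀ᶠ δ in 𝓝[>] (0 : ℝ), δ ∈ Set.Ioo (0 : ℝ) (1 / 2) := Ioo_mem_nhdsGT (by norm_num)
  obtain ⟨δ, h1, h2, h3⟩ := (h1.and (h2.and h3)).exists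
  exact ⟨δ, h3.1, h3.2.le, h1, h2⟩

/-- For `a₁ ≈ n` and `a₂ ≈ 2n` the squares fall short of the cone through `K` when the extra
coordinate is `0`, since `2 < b`, and suffice when it is `q√n`, since `b < q² + 2`. These are the
endpoint conditions of `exists_root_of_sum_sq_deficit`. -/
theorem quadratic_bounds_of_typical {b q δ n s a₁ a₂ : ℝ} (hb : 2 < b) (hδ : 0 < δ)
    (hδ2 : δ ≤ 1 / 2) (hd1 : 2 + δ < b * (1 - δ) ^ 2) (hd2 : b * (1 + 2 * δ) ^ 2 < q ^ 2 + 2 - δ)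
    (hq : 0 < q) (hs : 0 < s) (hss : s ^ 2 = n) (hδn : 8 ≤ n * δ) (hqs : q ≤ s * δ)
    (h1 : -(δ / 2 * (n - 1)) < a₁ - (n - 1) * 1 ∧ a₁ - (n - 1) * 1 < δ / 2 * (n - 1))
    (h2 : -(δ / 2 * (n - 1)) < a₂ - (n - 1) * 2 ∧ a₂ - (n - 1) * 2 < δ / 2 * (n - 1)) :
    n / 2 ≤ a₁ ∧ n * a₂ < b * a₁ ^ 2 ∧ b * (q * s + a₁) ^ 2 ≤ n * ((q * s) ^ 2 + a₂) := by
  have hn0 : 0 < n := by rw [← hss]; positivity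
  have hnδ : n * δ ≤ n * (1 / 2) := by gcongr
  have ha1l : (1 - δ) * n ≤ a₁ := by linarith
  have ha1u : a₁ ≤ (1 + δ) * n := by linarith
  have ha2l : (2 - δ) * n ≤ a₂ := by linarith
  have ha2u : a₂ ≤ (2 + δ) * n := by linarith
  refine ⟨by linarith, ?_, ?_⟩
  · have h5 : ((1 - δ) * n) ^ 2 ≤ a₁ ^ 2 := pow_le_pow_left₀ (by linarith) ha1l 2
    have h6 : n * a₂ ≤ n * ((2 + δ) * n) := by gcongr
    have h7 : (2 + δ) * n ^ 2 < b * (1 - δ) ^ 2 * n ^ 2 := by gcongr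
    have h8 : b * ((1 - δ) * n) ^ 2 ≤ b * a₁ ^ 2 := by gcongr
    linarith
  · have h4 : q * s ≤ s * δ * s := by gcongr
    have h4' : s * δ * s = δ * n := by rw [← hss]; ring
    have h5 : q * s + a₁ ≤ (1 + 2 * δ) * n := by linarith
    have hqs0 : 0 ≤ q * s := by positivity
    have h6 : (q * s + a₁) ^ 2 ≤ ((1 + 2 * δ) * n) ^ 2 := pow_le_pow_left₀ (by linarith) h5 2
    have h7 : b * (1 + 2 * δ) ^ 2 * n ^ 2 ≤ (q ^ 2 + 2 - δ) * n ^ 2 := by gcongr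
    have h8 : n * ((2 - δ) * n) ≤ n * a₂ := by gcongr
    have h9 : b * (q * s + a₁) ^ 2 ≤ b * ((1 + 2 * δ) * n) ^ 2 := by gcongr
    rw [mul_pow q, hss]
    linarith

/-- The first coordinate is put into a window of fixed length `u` starting below `(√(b-2) + η/2)√n`;
the others are typical with probability at least one half. A cone of relative width `κ / √n` is wide
enough for such a window. -/
theorem eventually_expPi_outerCone_ge {b : ℝ} (hb : 2 < b) {η κ : ℝ} (hη : 0 < η) (hκ : 0 < κ) :
    ∀ᶠ n : ℕ in atTop, Real.exp (-((√(b - 2) + η) * √n)) ≤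
      (expPi n).real (outerCone b n (1 + κ / √n)) := by
  set β := √(b - 2) with hβ
  have hβ0 : 0 < β := Real.sqrt_pos.2 (by linarith)
  have hβsq : β ^ 2 = b - 2 := Real.sq_sqrt (by linarith)
  -- One half of `η` makes `q² + 2 > b`; the other half absorbs the constants `u`, `exp u` and `1 /
  -- 2`.
  set q := β + η / 2 with hq
  have hq0 : 0 < q := by positivity
  obtain ⟨δ, hδ, hδ2, hd1, hd2⟩ := exists_small_tolerance (q := q) hb (by rw [hq]; nlinarith)
  -- The linear term in `1 + (1 + κ/s)²(b-1) ≥ b + κ₁/s`. The window length `u` is chosen so that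
  -- the overshoot `u n (2qs + s)` is at most `(κ₁/s)(n/2)²`, the sum of the coordinates being at
  -- least `n/2`.
  set κ₁ := 2 * (b - 1) * κ with hκ₁
  have hκ₁0 : 0 < κ₁ := mul_pos (by linarith) hκ
  set u := min 1 (κ₁ / (4 * (2 * q + 1))) with hu
  have hu0 : 0 < u := lt_min one_pos (by positivity)
  have hu1 : u ≤ 1 := min_le_left _ _
  have hu2 : u * (4 * (2 * q + 1)) ≤ κ₁ := by
    have := min_le_right 1 (κ₁ / (4 * (2 * q + 1)))
    rwa [← hu, le_div_iff₀ (by positivity)] at this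
  set G : ∀ m : ℕ, Set (Fin m → ℝ) := fun m =>
    {w | δ / 2 * m ≤ |∑ i, w i ^ 1 - m * ∫ x, x ^ 1 ∂(expMeasure 1)|} ∪
      {w | δ / 2 * m ≤ |∑ i, w i ^ 2 - m * ∫ x, x ^ 2 ∂(expMeasure 1)|} with hG
  have hGlim : Tendsto (fun m => (expPi m).real (G m)) atTop (𝓝 0) := by
    have h1 := tendsto_expPi_abs_sum_sub (memLp_pow_expMeasure 1) (half_pos hδ)
    have h2 := tendsto_expPi_abs_sum_sub (memLp_pow_expMeasure 2) (half_pos hδ)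
    have h := h1.add h2
    rw [add_zero] at h
    exact squeeze_zero (fun _ => measureReal_nonneg) (fun m => measureReal_union_le _ _) h
  have hGm : ∀ m, MeasurableSet (G m) := by
    intro m
    refine MeasurableSet.union (measurableSet_le ?_ ?_) (measurableSet_le ?_ ?_) <;> fun_prop
  have key : ∀ᶠ m : ℕ in atTop, Real.exp (-((β + η) * √((m + 1 : ℕ) : ℝ))) ≤
      (expPi (m + 1)).real (outerCone b (m + 1) (1 + κ / √((m + 1 : ℕ) : ℝ))) := by
    have ev1 := hGlim.eventually (gt_mem_nhds (by norm_num : (0 : ℝ) < 1 / 2))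
    have htop : Tendsto (fun m : ℕ => (((m + 1 : ℕ) : ℝ))) atTop atTop :=
      tendsto_natCast_atTop_atTop.comp (tendsto_add_atTop_nat 1)
    have ev2 := htop.eventually_ge_atTop (max b (8 / δ))
    have hsqrt : Tendsto (fun m : ℕ => √((m + 1 : ℕ) : ℝ)) atTop atTop :=
      Real.tendsto_sqrt_atTop.comp htop
    have ev3 := hsqrt.eventually_ge_atTop (max 1 (q / δ))
    have hexp : Tendsto (fun m : ℕ => Real.exp (η / 2 * √((m + 1 : ℕ) : ℝ))) atTop atTop :=
      Real.tendsto_exp_atTop.comp (hsqrt.const_mul_atTop (half_pos hη))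
    have ev4 := hexp.eventually_ge_atTop (2 * Real.exp u / u)
    filter_upwards [ev1, ev2, ev3, ev4] with m h1 h2 h3 h4
    set n := m + 1 with hn
    set s := √(n : ℝ) with hs
    have hn0 : (0 : ℝ) < n := by positivity
    have hs0 : 0 < s := Real.sqrt_pos.2 hn0
    have hss : s ^ 2 = n := Real.sq_sqrt hn0.le
    have hbn : b ≤ n := (le_max_left _ _).trans h2
    have hδn : 8 ≤ n * δ := by
      have := (le_max_right _ _).trans h2
      rwa [div_le_iff₀ hδ] at this
    have hs1 : 1 ≤ s := (le_max_left _ _).trans h3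
    have hqs : q ≤ s * δ := by
      have := (le_max_right _ _).trans h3
      rwa [div_le_iff₀ hδ] at this
    have hmn : (m : ℝ) = n - 1 := by simp [hn]
    have hGc : 1 / 2 ≤ (expPi m).real (G m)ᶜ := by
      rw [probReal_compl_eq_one_sub (hGm m)]
      linarith
    have hlow := expPi_succ_ge (m := m) (measurableSet_outerCone (b := b) (1 + κ / s))
      (hGm m).compl (Y := q * s) (u := u) hu0.le ?_
    · refine le_trans ?_ hlow
      have h5 : u * Real.exp (-(q * s + u)) * (1 / 2) ≤
          u * Real.exp (-(q * s + u)) * (expPi m).real (G m)ᶜ := by gcongr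
      refine le_trans ?_ h5
      rw [div_le_iff₀ hu0] at h4
      have e1 : Real.exp (-(q * s + u)) = Real.exp (-((β + η) * s)) * Real.exp (η / 2 * s) *
          (Real.exp u)⁻¹ := by
        rw [← Real.exp_neg u, ← Real.exp_add, ← Real.exp_add, hq]
        ring_nf
      rw [e1]
      have h6 : 1 ≤ u * Real.exp (η / 2 * s) * (Real.exp u)⁻¹ * (1 / 2) := by
        rw [mul_assoc, mul_assoc, mul_comm (Real.exp u)⁻¹, ← mul_assoc, ← mul_assoc,
          ← div_eq_mul_inv, le_div_iff₀ (Real.exp_pos u)]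
        linarith
      have h7 := Real.exp_pos (-((β + η) * s))
      calc Real.exp (-((β + η) * s)) = Real.exp (-((β + η) * s)) * 1 := by ring
        _ ≤ Real.exp (-((β + η) * s)) * (u * Real.exp (η / 2 * s) * (Real.exp u)⁻¹ * (1 / 2)) := by
          gcongr
        _ = _ := by ring
    · intro w hw
      simp only [hG, Set.mem_compl_iff, Set.mem_union, Set.mem_ofPred_eq, not_or, not_le, pow_one,
        integral_pow_expMeasure, hmn] at hw
      have hI : ∫ x, x ∂(expMeasure 1) = 1 := by simpa using integral_pow_expMeasure 1
      have hF : ((Nat.factorial 2 : ℕ) : ℝ) = 2 := by norm_num [Nat.factorial]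
      rw [hI, hF] at hw
      obtain ⟨hw1, hw2⟩ := hw
      rw [abs_lt] at hw1 hw2
      set a₁ := ∑ i, w i with ha₁
      set a₂ := ∑ i, w i ^ 2 with ha₂
      obtain ⟨ha1p, hphi0, hphiY⟩ := quadratic_bounds_of_typical hb hδ hδ2 hd1 hd2 hq0 hs0 hss hδn
        hqs hw1 hw2
      obtain ⟨y, hy0, hyY, hy⟩ := exists_root_of_sum_sq_deficit (by linarith) (by linarith) hbn
        hphi0 (by positivity) hphiY
      refine ⟨y, hy0, hyY, fun v hv0 hvu => ?_⟩
      obtain ⟨hlo, hhi⟩ := hy v hv0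
      have hsum : ∑ i, (Fin.cons (y + v) w : Fin (m + 1) → ℝ) i = y + v + a₁ := by
        simp [Fin.sum_univ_succ, ha₁]
      have hsum2 : ∑ i, (Fin.cons (y + v) w : Fin (m + 1) → ℝ) i ^ 2 = (y + v) ^ 2 + a₂ := by
        simp [Fin.sum_univ_succ, ha₂]
      refine mem_outerCone_of_le hb (by omega) (by positivity) ?_ ?_ ?_
      · rw [hsum]
        linarith
      · rw [hsum, hsum2]
        exact hlo
      · rw [hsum, hsum2]
        refine hhi.trans ?_
        have hbig : (n : ℝ) / 2 ≤ y + v + a₁ := by linarith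
        have h5 : v * (n * (2 * (q * s) + v)) ≤ u * (n * (2 * (q * s) + 1 * s)) := by
          gcongr
          linarith
        have h6 : u * (n * (2 * (q * s) + 1 * s)) ≤ κ₁ / s * ((n : ℝ) / 2) ^ 2 := by
          have e : κ₁ / s * ((n : ℝ) / 2) ^ 2 = n * s * (κ₁ / 4) := by
            rw [← hss]
            field_simp
            ring
          rw [e]
          have : n * s * (u * (2 * q + 1)) ≤ n * s * (κ₁ / 4) := by
            gcongr
            linarith
          linarith
        have h7 : κ₁ / s * ((n : ℝ) / 2) ^ 2 ≤ κ₁ / s * (y + v + a₁) ^ 2 := by gcongr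
        have h8 : b + κ₁ / s ≤ 1 + (1 + κ / s) ^ 2 * (b - 1) := by
          have : κ₁ / s = 2 * (b - 1) * (κ / s) := by rw [hκ₁]; ring
          rw [this]
          have h10 : 0 ≤ (κ / s) ^ 2 * (b - 1) := mul_nonneg (sq_nonneg _) (by linarith)
          linarith
        have h9 := mul_le_mul_of_nonneg_right h8 (sq_nonneg (y + v + a₁))
        linarith
  have := (tendsto_sub_atTop_nat 1).eventually key
  filter_upwards [this, eventually_ge_atTop 1] with n hn h1
  rwa [Nat.sub_add_cancel h1] at hn

/-! ### Transfer of rare events to the uniform distribution -/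

/-- The vector `(1, …, 1) + ρ (z / mean z - (1, …, 1))`. -/
noncomputable def stretch {n : ℕ} (ρ : ℝ) (z : Fin n → ℝ) : Fin n → ℝ :=
  fun i => 1 + ρ * (z i / mean z - 1)

/-- The factor is `ρ = radius b n * mean z / offDiag z`; the inner cone is precisely where it lies
in `[1, α]`. For `α` near one and mean near one the projection barely moves `z`. -/
theorem exists_sphereProj_eq_stretch {b : ℝ} {n : ℕ} (hb : 2 < b) (hn : b < n) {α : ℝ}
    {z : Fin n → ℝ} (hz : z ∈ innerCone b n α) :
    ∃ ρ, 1 ≤ ρ ∧ ρ ≤ α ∧ sphereProj b z = stretch ρ z ∧ ∑ i, stretch ρ z i ^ 2 = n * b := by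
  obtain ⟨hm, h1, h2⟩ := hz
  have hn0 : (0 : ℝ) < n := by linarith
  have hR := radius_pos hb hn
  have hD : 0 < offDiag z := by
    refine lt_of_le_of_ne (Real.sqrt_nonneg _) fun h => ?_
    rw [← h, mul_zero] at h1
    exact absurd h1 (not_le.2 (mul_pos hR hm))
  have hDsq : offDiag z ^ 2 = ∑ i, z i ^ 2 - n * mean z ^ 2 :=
    Real.sq_sqrt (Real.sqrt_pos.1 hD).le
  refine ⟨radius b n * mean z / offDiag z, ?_, ?_, ?_, ?_⟩
  · rwa [one_le_div hD]
  · rwa [div_le_iff₀ hD]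
  · ext i
    simp only [sphereProj, stretch]
    field_simp
  · set ρ := radius b n * mean z / offDiag z with hρ
    have hsum : ∑ i, z i = n * mean z := by
      rw [mean, mul_div_cancel₀ _ hn0.ne']
    have e : ∀ i, stretch ρ z i ^ 2 = (1 - ρ) ^ 2 + 2 * ((1 - ρ) * ρ / mean z) * z i +
        ρ ^ 2 / mean z ^ 2 * z i ^ 2 := by
      intro i
      simp only [stretch]
      field_simp
      ring
    simp only [e, Finset.sum_add_distrib, ← Finset.mul_sum, hsum, Finset.sum_const,
      Finset.card_univ, Fintype.card_fin, nsmul_eq_mul]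
    have hS : ∑ i, z i ^ 2 = offDiag z ^ 2 + n * mean z ^ 2 := by rw [hDsq]; ring
    have hρ2 : ρ ^ 2 / mean z ^ 2 * offDiag z ^ 2 = n * (b - 1) := by
      rw [← radius_sq hb, hρ]
      field_simp
    rw [hS, mul_add, hρ2]
    field_simp
    ring

/-- Events that are rare for independent exponential variables have a small probability
for the uniform distribution on `K`. -/
theorem tendsto_unif_of_expRare {b : ℝ} (hb : 2 < b) {γ : ℝ} (hγ : √(b - 2) < γ) {δ : ℝ}
    (hδ : 0 < δ)
    {A B : ∀ n : ℕ, Set (Fin n → ℝ)} (hA : ∀ n, MeasurableSet (A n)) (hB : ExpRare γ B)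
    (h : ∀ᶠ n : ℕ in atTop, ∀ z : Fin n → ℝ, (∀ i, 0 < z i) → z ∉ B n → ∀ ρ, 1 ≤ ρ → ρ ≤ 1 + δ →
      ∑ i, stretch ρ z i ^ 2 = n * b → stretch ρ z ∉ A n) :
    Tendsto (fun n => (unif b n).real (A n)) atTop (𝓝 0) := by
  set g := γ - √(b - 2) with hg
  have hg0 : 0 < g := sub_pos.2 hγ
  obtain ⟨C, hC⟩ := hB
  have hlim : Tendsto (fun n : ℕ => C * Real.exp (-(g / 2 * √n))) atTop (𝓝 (C * 0)) :=
    (Real.tendsto_exp_neg_atTop_nhds_zero.comp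
      (tendsto_sqrt_natCast.const_mul_atTop (half_pos hg0))).const_mul C
  rw [mul_zero] at hlim
  refine squeeze_zero' (Eventually.of_forall fun _ => measureReal_nonneg) ?_ hlim
  -- The budget is `γ = √(b-2) + g`. The outer cone bound costs `g / 4`, the factor `α ^ (2 * n)`
  -- with `κ = g / 8` costs another `g / 4`, and `g / 2` is left for decay.
  have hκ : 0 < g / 8 := by positivity
  filter_upwards [h, hC, eventually_expPi_outerCone_ge hb (show 0 < g / 4 by positivity) hκ,
    eventually_div_sqrt_le (g / 8) hδ, tendsto_natCast_atTop_atTop.eventually_gt_atTop b,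
    eventually_gt_atTop 0] with n h1 h2 h3 h4 h5 h6
  have hs0 : 0 < √(n : ℝ) := by positivity
  have hss : √(n : ℝ) ^ 2 = n := Real.sq_sqrt (by positivity)
  set s := √(n : ℝ) with hs
  set α := 1 + g / 8 / s with hα
  have hα1 : 1 < α := by
    have : 0 < g / 8 / s := by positivity
    linarith
  have hcomp := unif_mul_expPi_outerCone_le hb h5 hα1 (hA n)
  have hsub : (expPi n) (innerCone b n α ∩ sphereProj b ⁻¹' A n) ≤ (expPi n) (B n) := by
    refine measure_mono_ae ?_
    filter_upwards [expPi_ae_pos n] with z hz hmem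
    by_contra hzB
    obtain ⟨ρ, hρ1, hρα, he, hsq⟩ := exists_sphereProj_eq_stretch hb h5 hmem.1
    have hmemA : sphereProj b z ∈ A n := hmem.2
    rw [he] at hmemA
    exact h1 z hz hzB ρ hρ1 (hρα.trans (by linarith)) hsq hmemA
  have hle := ENNReal.toReal_mono (ENNReal.mul_ne_top ENNReal.ofReal_ne_top (measure_ne_top _ _))
    (hcomp.trans (mul_le_mul_right hsub _))
  rw [ENNReal.toReal_mul, ENNReal.toReal_mul, ENNReal.toReal_ofReal (by positivity)] at hle
  change (unif b n).real (A n) * (expPi n).real (outerCone b n α) ≤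
    α ^ (2 * n) * (expPi n).real (B n) at hle
  have hpow : α ^ (2 * n) ≤ Real.exp (g / 4 * s) := by
    have : α ≤ Real.exp (g / 8 / s) := by linarith [Real.add_one_le_exp (g / 8 / s)]
    refine (pow_le_pow_left₀ (by linarith) this _).trans (le_of_eq ?_)
    rw [← Real.exp_nat_mul]
    congr 1
    push_cast
    rw [← hss]
    field_simp
    ring
  have hfin : (unif b n).real (A n) * Real.exp (-((√(b - 2) + g / 4) * s)) ≤
      Real.exp (g / 4 * s) * (C * Real.exp (-(γ * s))) := by
    calc _ ≤ (unif b n).real (A n) * (expPi n).real (outerCone b n α) := by gcongr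
      _ ≤ α ^ (2 * n) * (expPi n).real (B n) := hle
      _ ≤ _ := by gcongr
  have hrw : Real.exp (g / 4 * s) * (C * Real.exp (-(γ * s))) =
      C * Real.exp (-(g / 2 * s)) * Real.exp (-((√(b - 2) + g / 4) * s)) := by
    rw [mul_left_comm, mul_assoc, ← Real.exp_add, ← Real.exp_add, hg]
    ring_nf
  rw [hrw] at hfin
  exact le_of_mul_le_mul_right hfin (Real.exp_pos _)

/-! ### Typical vectors have one large coordinate -/

/-- The vectors that are atypical for independent exponential variables: the mean is not close
to one, the sum of squares of the coordinates up to `ε √n` is too large, or the sum of the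
coordinates above `ε √n` is too large. -/
def atypical (b δ ε : ℝ) (n : ℕ) : Set (Fin n → ℝ) :=
  ({z | δ ≤ |mean z - 1|} ∪ {z | n * (2 + δ) ≤ smallSq (ε * √n) z}) ∪
    {z | (√(b - 2) + δ) * √n ≤ largeSum (ε * √n) z}

/-- The rate has to exceed `√(b-2)` for the transfer and stay below the threshold `√(b-2) + δ` of
the third event; `δ / 2` lies between. -/
theorem exists_expRare_atypical {b : ℝ} (hb : 2 < b) {δ : ℝ} (hδ : 0 < δ) :
    ∃ ε₀ > 0, ∀ ε, 0 < ε → ε ≤ ε₀ → ExpRare (√(b - 2) + δ / 2) (atypical b δ ε) := by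
  have hβ : 0 < √(b - 2) := Real.sqrt_pos.2 (by linarith)
  have hγ : 0 < √(b - 2) + δ / 2 := by positivity
  obtain ⟨ε₀, hε₀, h⟩ := exists_expRare_smallSq hδ hγ
  exact ⟨ε₀, hε₀, fun ε hε hε' => ((expRare_mean hδ hγ).union (h ε hε hε')).union
    (expRare_largeSum hε hγ (by linarith))⟩

/-- A lower bound for the mean of the squares. -/
noncomputable def sqLower (b δ : ℝ) : ℝ := (1 - δ) ^ 2 * (1 + (b - 1) / (1 + δ) ^ 2)

/-- A lower bound for the largest coordinate on the scale `√n`. -/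
noncomputable def maxLower (b δ : ℝ) : ℝ := (sqLower b δ - 2 - δ) / (√(b - 2) + δ)

theorem continuousAt_maxLower {b : ℝ} (hb : 2 < b) : ContinuousAt (maxLower b) 0 := by
  have hβ : 0 < √(b - 2) := Real.sqrt_pos.2 (by linarith)
  unfold maxLower sqLower
  refine ContinuousAt.div ?_ (by fun_prop) (by simpa using hβ.ne')
  refine ContinuousAt.sub (ContinuousAt.sub (ContinuousAt.mul (by fun_prop)
    (ContinuousAt.add (by fun_prop) (ContinuousAt.div (by fun_prop) (by fun_prop) ?_)))
    (by fun_prop)) (by fun_prop)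
  simp

theorem maxLower_zero {b : ℝ} (hb : 2 < b) : maxLower b 0 = √(b - 2) := by
  have hβ : 0 < √(b - 2) := Real.sqrt_pos.2 (by linarith)
  have hsq : √(b - 2) ^ 2 = b - 2 := Real.sq_sqrt (by linarith)
  simp only [maxLower, sqLower]
  rw [div_eq_iff (by linarith)]
  linear_combination -hsq

section

variable {b δ ε : ℝ} {n : ℕ} {z : Fin n → ℝ} {ρ : ℝ}

/-- Solving the hypothesis gives `∑ zᵢ² = n (mean z)² (1 + (b-1)/ρ²)`, to be bounded by `mean z ≥ 1
- δ` and `ρ ≤ 1 + δ`. -/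
theorem sum_sq_ge_of_stretch (hn : 0 < n) (hb : 2 < b) (hδ1 : δ < 1)
    (hm : |mean z - 1| < δ) (hρ1 : 1 ≤ ρ) (hρ : ρ ≤ 1 + δ)
    (hsq : ∑ i, stretch ρ z i ^ 2 = n * b) : n * sqLower b δ ≤ ∑ i, z i ^ 2 := by
  have hn0 : (0 : ℝ) < n := by positivity
  rw [abs_lt] at hm
  have hm0 : 0 < mean z := by linarith
  have hρ0 : 0 < ρ := by linarith
  have hsum : ∑ i, z i = n * mean z := by
    rw [mean, mul_div_cancel₀ _ hn0.ne']
  have e : ∀ i, stretch ρ z i ^ 2 = (1 - ρ) ^ 2 + 2 * ((1 - ρ) * ρ / mean z) * z i +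
      ρ ^ 2 / mean z ^ 2 * z i ^ 2 := by
    intro i
    simp only [stretch]
    field_simp
    ring
  simp only [e, Finset.sum_add_distrib, ← Finset.mul_sum, hsum, Finset.sum_const,
    Finset.card_univ, Fintype.card_fin, nsmul_eq_mul] at hsq
  have hS : ∑ i, z i ^ 2 = n * (mean z ^ 2 * (1 + (b - 1) / ρ ^ 2)) := by
    have h1 : ρ ^ 2 / mean z ^ 2 * ∑ i, z i ^ 2 = n * (b - 1) + n * ρ ^ 2 := by
      have h2 : 2 * ((1 - ρ) * ρ / mean z) * (n * mean z) = 2 * ((1 - ρ) * ρ) * n := by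
        field_simp
      rw [h2] at hsq
      linear_combination hsq
    have h3 : ∑ i, z i ^ 2 = mean z ^ 2 / ρ ^ 2 * (ρ ^ 2 / mean z ^ 2 * ∑ i, z i ^ 2) := by
      field_simp
    rw [h3, h1]
    field_simp
    ring
  rw [hS, sqLower]
  have hb1 : 0 ≤ b - 1 := by linarith
  have h4 : (1 - δ) ^ 2 ≤ mean z ^ 2 := pow_le_pow_left₀ (by linarith) (by linarith) 2
  gcongr

theorem sum_sq_eq_smallSq_add (t : ℝ) :
    ∑ i, z i ^ 2 = smallSq t z + ∑ i, (Set.Ioi t).indicator (fun x => x ^ 2) (z i) := by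
  rw [smallSq, ← Finset.sum_add_distrib]
  refine Finset.sum_congr rfl fun i _ => ?_
  by_cases h : z i ≤ t
  · rw [Set.indicator_of_mem (Set.mem_Iic.2 h), Set.indicator_of_notMem (by simpa using h),
      add_zero]
  · rw [Set.indicator_of_notMem (by simpa using h),
      Set.indicator_of_mem (by simpa using h : z i ∈ Set.Ioi t), zero_add]

theorem largeSq_le_mul_largeSum {t M : ℝ} (ht : 0 ≤ t) (hM : ∀ i, z i ≤ M) :
    ∑ i, (Set.Ioi t).indicator (fun x => x ^ 2) (z i) ≤ M * largeSum t z := by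
  rw [largeSum, Finset.mul_sum]
  refine Finset.sum_le_sum fun i _ => ?_
  by_cases h : z i ∈ Set.Ioi t
  · rw [Set.indicator_of_mem h, Set.indicator_of_mem h, sq]
    exact mul_le_mul_of_nonneg_right (hM i) (ht.trans (Set.mem_Ioi.1 h).le)
  · rw [Set.indicator_of_notMem h, Set.indicator_of_notMem h, mul_zero]

theorem indicator_Ioi_nonneg {t : ℝ} (ht : 0 ≤ t) (x : ℝ) :
    0 ≤ (Set.Ioi t).indicator (fun x => x) x :=
  Set.indicator_nonneg (fun _ hx => ht.trans (Set.mem_Ioi.1 hx).le) x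

theorem le_largeSum {t : ℝ} (ht : 0 ≤ t) {i : Fin n} (hi : t < z i) : z i ≤ largeSum t z := by
  have h := Finset.single_le_sum (f := fun i => (Set.Ioi t).indicator (fun x => x) (z i))
    (fun i _ => indicator_Ioi_nonneg ht (z i)) (Finset.mem_univ i)
  rwa [Set.indicator_of_mem (Set.mem_Ioi.2 hi)] at h

theorem add_le_largeSum {t : ℝ} (ht : 0 ≤ t) {i j : Fin n} (hij : i ≠ j) (hi : t < z i)
    (hj : t < z j) : z i + z j ≤ largeSum t z := by
  have h := Finset.sum_le_univ_sum_of_nonneg (s := {i, j})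
    (f := fun i => (Set.Ioi t).indicator (fun x => x) (z i)) fun i => indicator_Ioi_nonneg ht (z i)
  rw [Finset.sum_pair hij, Set.indicator_of_mem (Set.mem_Ioi.2 hi),
    Set.indicator_of_mem (Set.mem_Ioi.2 hj)] at h
  exact h

/-- The squares of the coordinates above `ε√n` have to make up about `(b-2)n`. Their sum is at most
the maximum times `largeSum`, and the latter is below `(√(b-2) + δ)√n`. -/
theorem maxLower_mul_le_of_typical (hn : 0 < n) (hb : 2 < b) (hδ : 0 < δ) (hδ1 : δ < 1)
    (hε : 0 < ε) (hz : ∀ i, 0 < z i) (htyp : z ∉ atypical b δ ε n) (hρ1 : 1 ≤ ρ) (hρ : ρ ≤ 1 + δ)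
    (hsq : ∑ i, stretch ρ z i ^ 2 = n * b) {i₀ : Fin n} (hi₀ : ∀ i, z i ≤ z i₀) :
    maxLower b δ * √n ≤ z i₀ := by
  simp only [atypical, Set.mem_union, Set.mem_ofPred_eq, not_or, not_le] at htyp
  obtain ⟨⟨hm, hS⟩, hL⟩ := htyp
  have hβ : 0 < √(b - 2) := Real.sqrt_pos.2 (by linarith)
  have hs0 : 0 < √(n : ℝ) := by positivity
  have hss : √(n : ℝ) ^ 2 = n := Real.sq_sqrt (by positivity)
  have h1 := sum_sq_ge_of_stretch hn hb hδ1 hm hρ1 hρ hsq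
  rw [sum_sq_eq_smallSq_add (ε * √n)] at h1
  have h2 := largeSq_le_mul_largeSum (z := z) (t := ε * √n) (by positivity) hi₀
  have h3 : z i₀ * largeSum (ε * √n) z ≤ z i₀ * ((√(b - 2) + δ) * √n) :=
    mul_le_mul_of_nonneg_left hL.le (hz i₀).le
  have h4 : n * (sqLower b δ - 2 - δ) ≤ z i₀ * ((√(b - 2) + δ) * √n) := by linarith
  have h4' : √n ^ 2 * (sqLower b δ - 2 - δ) ≤ z i₀ * ((√(b - 2) + δ) * √n) := by rwa [hss]
  have h5 : (sqLower b δ - 2 - δ) * √n ≤ z i₀ * (√(b - 2) + δ) := by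
    refine le_of_mul_le_mul_right ?_ hs0
    linarith
  rw [maxLower, div_mul_eq_mul_div, div_le_iff₀ (by positivity)]
  exact h5

end

/-! ### The largest and the second largest coordinate under the uniform distribution -/

theorem measurable_maxCoord {n : ℕ} : Measurable (maxCoord : (Fin n → ℝ) → ℝ) :=
  Measurable.iSup fun i => measurable_pi_apply i

theorem maxCoord_eq {n : ℕ} {x : Fin n → ℝ} {i₀ : Fin n} (h : ∀ i, x i ≤ x i₀) :
    maxCoord x = x i₀ := by
  have : Nonempty (Fin n) := ⟨i₀⟩
  exact le_antisymm (ciSup_le h) (le_ciSup (Set.finite_range x).bddAbove i₀)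

/-- The maximum is bounded below by `maxLower_mul_le_of_typical` and above by `largeSum`, of which
it is one term. Both bounds tend to `√(b-2)√n` as `δ` tends to zero, and stretching changes them by
factors near one plus a shift of at most `δ√n`. -/
theorem tendsto_unif_maxCoord {b : ℝ} (hb : 2 < b) {τ : ℝ} (hτ : 0 < τ) :
    Tendsto (fun n : ℕ => (unif b n).real {x | τ ≤ |maxCoord x ^ 2 / ((b - 2) * n) - 1|}) atTop
      (𝓝 0) := by
  have hb2 : 0 < b - 2 := by linarith
  set β := √(b - 2) with hβdef
  have hβ : 0 < β := Real.sqrt_pos.2 hb2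
  have hβsq : β ^ 2 = b - 2 := Real.sq_sqrt hb2.le
  have hev : ∀ᶠ δ in 𝓝[>] (0 : ℝ), (0 < δ ∧ δ < 1) ∧ 0 < maxLower b δ ∧
      1 - τ < (maxLower b δ / (1 + δ)) ^ 2 / (b - 2) ∧
      (δ + (1 + δ) * (β + δ) / (1 - δ)) ^ 2 / (b - 2) < 1 + τ := by
    have hc := continuousAt_maxLower hb
    have hz := maxLower_zero hb
    refine (eventually_mem_set.2 (Ioo_mem_nhdsGT one_pos)).and
      (Eventually.and ?_ (Eventually.and ?_ ?_))
    · refine Eventually.filter_mono nhdsWithin_le_nhds (hc.eventually (lt_mem_nhds ?_))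
      rwa [hz]
    · have hf : ContinuousAt (fun δ => (maxLower b δ / (1 + δ)) ^ 2 / (b - 2)) 0 :=
        ((hc.div (by fun_prop) (by simp)).pow 2).div_const _
      refine Eventually.filter_mono nhdsWithin_le_nhds (hf.eventually (lt_mem_nhds ?_))
      simp only [hz, add_zero, div_one]
      rw [← hβdef, hβsq, div_self hb2.ne']
      linarith
    · have hf : ContinuousAt (fun δ => (δ + (1 + δ) * (β + δ) / (1 - δ)) ^ 2 / (b - 2)) 0 := by
        refine ContinuousAt.div_const (ContinuousAt.pow (ContinuousAt.add (by fun_prop)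
          (ContinuousAt.div (by fun_prop) (by fun_prop) (by simp))) 2) _
      refine Eventually.filter_mono nhdsWithin_le_nhds (hf.eventually (gt_mem_nhds ?_))
      have : (0 + (1 + 0) * (β + 0) / (1 - 0)) ^ 2 / (b - 2) = 1 := by
        rw [div_eq_one_iff_eq hb2.ne', ← hβsq]
        ring
      exact lt_of_eq_of_lt this (by linarith)
  obtain ⟨δ, ⟨hδ, hδ1⟩, hpos, hlo, hhi⟩ := hev.exists
  obtain ⟨ε₀, hε₀, hrare⟩ := exists_expRare_atypical hb hδ
  -- The cutoff must lie below the lower bound for the maximum, so that the maximum counts in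
  -- `largeSum`.
  set ε := min ε₀ (maxLower b δ / 2) with hεdef
  have hε : 0 < ε := lt_min hε₀ (half_pos hpos)
  have hεl : ε < maxLower b δ := (min_le_right _ _).trans_lt (half_lt_self hpos)
  refine tendsto_unif_of_expRare hb (show β < β + δ / 2 by linarith) hδ (fun n => ?_)
    (hrare ε hε (min_le_left _ _)) ?_
  · have := measurable_maxCoord (n := n)
    exact measurableSet_le measurable_const (by fun_prop)
  filter_upwards [eventually_div_sqrt_le 1 hδ, eventually_gt_atTop 0] with n hδs hn z hz htyp ρ hρ1
    hρ hsq hmem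
  have hn0 : (0 : ℝ) < n := by positivity
  have hs0 : 0 < √(n : ℝ) := by positivity
  have hss : √(n : ℝ) ^ 2 = n := Real.sq_sqrt hn0.le
  rw [div_le_iff₀ hs0] at hδs
  have : Nonempty (Fin n) := ⟨⟨0, hn⟩⟩
  obtain ⟨i₀, hi₀⟩ := Finite.exists_max z
  have hlow := maxLower_mul_le_of_typical hn hb hδ hδ1 hε hz htyp hρ1 hρ hsq hi₀
  simp only [atypical, Set.mem_union, Set.mem_ofPred_eq, not_or, not_le] at htyp
  obtain ⟨⟨hm, -⟩, hL⟩ := htyp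
  rw [abs_lt] at hm
  have hm0 : 0 < mean z := by linarith
  have hup : z i₀ ≤ (β + δ) * √n := by
    refine (le_largeSum (t := ε * √n) (by positivity) ?_).trans hL.le
    exact lt_of_lt_of_le (by gcongr) hlow
  have hmax : maxCoord (stretch ρ z) = stretch ρ z i₀ := by
    refine maxCoord_eq fun i => ?_
    simp only [stretch]
    have := hi₀ i
    gcongr
  have hmean : mean z ≤ z i₀ := by
    rw [mean, div_le_iff₀ hn0]
    have := Finset.sum_le_card_nsmul Finset.univ z (z i₀) fun i _ => hi₀ i
    simp only [Finset.card_univ, Fintype.card_fin, nsmul_eq_mul] at this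
    linarith
  have h1 : maxLower b δ / (1 + δ) * √n ≤ stretch ρ z i₀ := by
    have h2 : maxLower b δ / (1 + δ) * √n ≤ z i₀ / mean z := by
      rw [div_mul_eq_mul_div]
      exact div_le_div₀ (hz i₀).le hlow hm0 (by linarith)
    have h3 : 1 ≤ z i₀ / mean z := by rwa [one_le_div hm0]
    simp only [stretch]
    nlinarith
  have h4 : stretch ρ z i₀ ≤ (δ + (1 + δ) * (β + δ) / (1 - δ)) * √n := by
    have h5 : z i₀ / mean z ≤ (β + δ) * √n / (1 - δ) :=
      div_le_div₀ (by positivity) hup (by linarith) (by linarith)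
    have h6 : ρ * (z i₀ / mean z) ≤ (1 + δ) * ((β + δ) * √n / (1 - δ)) := by
      refine mul_le_mul hρ h5 (div_nonneg (hz i₀).le hm0.le) (by linarith)
    have h7 : (1 + δ) * ((β + δ) * √n / (1 - δ)) = (1 + δ) * (β + δ) / (1 - δ) * √n := by ring
    simp only [stretch]
    linarith
  have h8 : 0 ≤ maxLower b δ / (1 + δ) * √n := by positivity
  have h9 := pow_le_pow_left₀ h8 h1 2
  have h10 := pow_le_pow_left₀ (h8.trans h1) h4 2
  rw [mul_pow, hss] at h9 h10
  have hmem' : τ ≤ |maxCoord (stretch ρ z) ^ 2 / ((b - 2) * n) - 1| := hmem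
  rw [hmax] at hmem'
  refine absurd hmem' (not_le.2 (abs_lt.2 ⟨?_, ?_⟩))
  · have : (maxLower b δ / (1 + δ)) ^ 2 / (b - 2) ≤ stretch ρ z i₀ ^ 2 / ((b - 2) * n) := by
      rw [div_le_div_iff₀ hb2 (by positivity)]
      nlinarith
    linarith
  · have : stretch ρ z i₀ ^ 2 / ((b - 2) * n) ≤
        (δ + (1 + δ) * (β + δ) / (1 - δ)) ^ 2 / (b - 2) := by
      rw [div_le_div_iff₀ (by positivity) hb2]
      nlinarith
    linarith

theorem measurableSet_two_large {n : ℕ} (t : ℝ) :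
    MeasurableSet {x : Fin n → ℝ | ∃ i j, i ≠ j ∧ t ≤ x i ∧ t ≤ x j} := by
  have e : {x : Fin n → ℝ | ∃ i j, i ≠ j ∧ t ≤ x i ∧ t ≤ x j} =
      ⋃ i, ⋃ j, {_x | i ≠ j} ∩ ({x | t ≤ x i} ∩ {x | t ≤ x j}) := by
    ext x
    simp
  rw [e]
  exact MeasurableSet.iUnion fun i => MeasurableSet.iUnion fun j => (MeasurableSet.const _).inter
    ((measurableSet_le measurable_const (measurable_pi_apply i)).inter
      (measurableSet_le measurable_const (measurable_pi_apply j)))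

/-- A second coordinate of order `τ√n` would push `largeSum` above `(maxLower b δ + τ/2)√n`. For
small `δ` this exceeds the bound `(√(b-2) + δ)√n` for typical vectors, because `maxLower b δ` tends
to `√(b-2)`. -/
theorem tendsto_unif_two_large {b : ℝ} (hb : 2 < b) {τ : ℝ} (hτ : 0 < τ) :
    Tendsto (fun n : ℕ => (unif b n).real
      {x | ∃ i j, i ≠ j ∧ τ * √n ≤ x i ∧ τ * √n ≤ x j}) atTop (𝓝 0) := by
  have hb2 : 0 < b - 2 := by linarith
  set β := √(b - 2) with hβdef
  have hβ : 0 < β := Real.sqrt_pos.2 hb2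
  have hev : ∀ᶠ δ in 𝓝[>] (0 : ℝ), (0 < δ ∧ δ < 1) ∧ 0 < maxLower b δ ∧
      τ / 2 < (τ - δ) * (1 - δ) / (1 + δ) ∧ β + δ < maxLower b δ + τ / 2 := by
    have hc := continuousAt_maxLower hb
    have hz := maxLower_zero hb
    refine (eventually_mem_set.2 (Ioo_mem_nhdsGT one_pos)).and
      (Eventually.and ?_ (Eventually.and ?_ ?_))
    · refine Eventually.filter_mono nhdsWithin_le_nhds (hc.eventually (lt_mem_nhds ?_))
      rwa [hz]
    · have hf : ContinuousAt (fun δ => (τ - δ) * (1 - δ) / (1 + δ)) 0 :=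
        ContinuousAt.div (by fun_prop) (by fun_prop) (by simp)
      refine Eventually.filter_mono nhdsWithin_le_nhds (hf.eventually (lt_mem_nhds ?_))
      simp only [sub_zero, mul_one, add_zero, div_one]
      linarith
    · refine Eventually.filter_mono nhdsWithin_le_nhds (ContinuousAt.eventually_lt
        (f := fun δ => β + δ) (g := fun δ => maxLower b δ + τ / 2) (by fun_prop)
        (hc.add continuousAt_const) ?_)
      rw [hz]
      linarith
  obtain ⟨δ, ⟨hδ, hδ1⟩, hpos, hτδ, hlt⟩ := hev.exists
  obtain ⟨ε₀, hε₀, hrare⟩ := exists_expRare_atypical hb hδ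
  set ε := min ε₀ (min (maxLower b δ / 2) (τ / 2)) with hεdef
  have hε : 0 < ε := lt_min hε₀ (lt_min (half_pos hpos) (half_pos hτ))
  have hεl : ε < maxLower b δ :=
    ((min_le_right _ _).trans (min_le_left _ _)).trans_lt (half_lt_self hpos)
  have hετ : ε ≤ τ / 2 := (min_le_right _ _).trans (min_le_right _ _)
  refine tendsto_unif_of_expRare hb (show β < β + δ / 2 by linarith) hδ (fun n => ?_)
    (hrare ε hε (min_le_left _ _)) ?_
  · exact measurableSet_two_large _
  filter_upwards [eventually_div_sqrt_le 1 hδ, eventually_gt_atTop 0] with n hδs hn z hz htyp ρ hρ1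
    hρ hsq hmem
  have hs0 : 0 < √(n : ℝ) := by positivity
  rw [div_le_iff₀ hs0] at hδs
  have : Nonempty (Fin n) := ⟨⟨0, hn⟩⟩
  obtain ⟨i₀, hi₀⟩ := Finite.exists_max z
  have hlow := maxLower_mul_le_of_typical hn hb hδ hδ1 hε hz htyp hρ1 hρ hsq hi₀
  simp only [atypical, Set.mem_union, Set.mem_ofPred_eq, not_or, not_le] at htyp
  obtain ⟨⟨hm, -⟩, hL⟩ := htyp
  rw [abs_lt] at hm
  have hm0 : 0 < mean z := by linarith
  have hlarge : ∀ j, τ * √n ≤ stretch ρ z j → τ / 2 * √n < z j := by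
    intro j hj
    simp only [stretch] at hj
    have h1 : ρ * (z j / mean z) ≤ (1 + δ) * (z j / (1 - δ)) := by
      refine mul_le_mul hρ (div_le_div_of_nonneg_left (hz j).le (by linarith) (by linarith))
        (div_nonneg (hz j).le hm0.le) (by linarith)
    have h2 : (τ - δ) * √n ≤ (1 + δ) * (z j / (1 - δ)) := by linarith
    have h3 : (τ - δ) * (1 - δ) / (1 + δ) * √n ≤ z j := by
      have h4 : 0 < 1 - δ := by linarith
      have e : (1 + δ) * (z j / (1 - δ)) = (1 + δ) * z j / (1 - δ) := by ring
      rw [e, le_div_iff₀ h4] at h2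
      rw [div_mul_eq_mul_div, div_le_iff₀ (by linarith)]
      linarith
    exact lt_of_lt_of_le (by gcongr) h3
  have hcontra : ∀ j, j ≠ i₀ → τ * √n ≤ stretch ρ z j → False := by
    intro j hj hjl
    have h1 := hlarge j hjl
    have h2 := add_le_largeSum (z := z) (t := ε * √n) (by positivity) hj.symm
      (lt_of_lt_of_le (by gcongr) hlow) (lt_of_le_of_lt (by gcongr) h1)
    have h3 : (β + δ) * √n < (maxLower b δ + τ / 2) * √n := by gcongr
    linarith
  obtain ⟨i, j, hij, hi, hj⟩ := hmem
  by_cases h : i = i₀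
  · exact hcontra j (fun h' => hij (h.trans h'.symm)) hj
  · exact hcontra i h hi

/-! ### Convergence in probability: parts (c) and (d) -/

theorem exists_pair_ge_secondMaxCoord {n : ℕ} (hn : 2 ≤ n) (x : Fin n → ℝ) :
    ∃ i j, i ≠ j ∧ secondMaxCoord x ≤ x i ∧ secondMaxCoord x ≤ x j := by
  refine ⟨Tuple.sort x ⟨n - 2, by omega⟩, Tuple.sort x ⟨n - 1, by omega⟩, ?_, ?_, ?_⟩
  · intro h
    have := (Tuple.sort x).injective h
    simp only [Fin.mk.injEq] at this
    omega
  · rw [secondMaxCoord, dif_pos hn]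
  · rw [secondMaxCoord, dif_pos hn]
    exact Tuple.monotone_sort x (Fin.mk_le_mk.2 (by omega))

theorem secondMaxCoord_pos {n : ℕ} (hn : 2 ≤ n) {x : Fin n → ℝ} (hx : ∀ i, 0 < x i) :
    0 < secondMaxCoord x := by
  rw [secondMaxCoord, dif_pos hn]
  exact hx _

/-- Only a measurable cover `A n` of the exceptional set within `K` is needed, so measurability of
`F n` does not enter. For the second largest coordinate this avoids measurability of the sorting
permutation. -/
theorem tendstoInProb_of_unif {b : ℝ} (hb : 2 < b) {Ω : ℕ → Type*} [∀ n, MeasurableSpace (Ω n)]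
    {P : ∀ n, Measure (Ω n)} {X : ∀ n, Ω n → Fin n → ℝ}
    (hXm : ∀ n, AEMeasurable (X n) (P n))
    (hX : ∀ n : ℕ, b < n → IsUniformOnK b n ((P n).map (X n)))
    {F : ∀ n : ℕ, (Fin n → ℝ) → ℝ} {c : ℝ}
    (h : ∀ ε, 0 < ε → ∃ A : ∀ n : ℕ, Set (Fin n → ℝ), (∀ n, MeasurableSet (A n)) ∧
      Tendsto (fun n => (unif b n).real (A n)) atTop (𝓝 0) ∧
      ∀ᶠ n in atTop, ∀ x ∈ K b n, ε ≤ |F n x - c| → x ∈ A n) :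
    TendstoInProb P (fun n ω => F n (X n ω)) c := by
  intro ε hε
  obtain ⟨A, hA, hlim, hsub⟩ := h ε hε
  have hlim' : Tendsto (fun n => ENNReal.ofReal ((unif b n).real (A n))) atTop (𝓝 0) := by
    simpa using ENNReal.tendsto_ofReal hlim
  refine tendsto_of_tendsto_of_tendsto_of_le_of_le' tendsto_const_nhds hlim'
    (Eventually.of_forall fun _ => zero_le) ?_
  filter_upwards [hsub, tendsto_natCast_atTop_atTop.eventually_gt_atTop b] with n hn hbn
  have hlaw := (hX n hbn).eq_unif hb hbn
  have := isProbabilityMeasure_unif hb hbn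
  rw [ofReal_measureReal]
  have hK : unif b n (K b n)ᶜ = 0 := by
    rw [prob_compl_eq_zero_iff measurableSet_K]
    exact unif_K hb hbn
  calc P n {ω | ε ≤ |F n (X n ω) - c|} ≤ P n (X n ⁻¹' (A n ∪ (K b n)ᶜ)) := by
        refine measure_mono fun ω hω => ?_
        by_cases hKω : X n ω ∈ K b n
        · exact Or.inl (hn _ hKω hω)
        · exact Or.inr hKω
    _ = unif b n (A n ∪ (K b n)ᶜ) := by
        rw [← hlaw, Measure.map_apply_of_aemeasurable (hXm n) ((hA n).union measurableSet_K.compl)]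
    _ ≤ unif b n (A n) + unif b n (K b n)ᶜ := measure_union_le _ _
    _ = unif b n (A n) := by rw [hK, add_zero]

section

variable {b : ℝ} {Ω : ℕ → Type*} [∀ n, MeasurableSpace (Ω n)]
    {P : ∀ n, Measure (Ω n)} {X : ∀ n, Ω n → Fin n → ℝ}

theorem tendstoInProb_maxCoord (hb : 2 < b) (hXm : ∀ n, AEMeasurable (X n) (P n))
    (hX : ∀ n : ℕ, b < n → IsUniformOnK b n ((P n).map (X n))) :
    TendstoInProb P (fun n ω => maxCoord (X n ω) ^ 2 / ((b - 2) * n)) 1 := by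
  refine tendstoInProb_of_unif hb hXm hX
    (F := fun n x => maxCoord x ^ 2 / ((b - 2) * n)) fun ε hε => ⟨_, fun n => ?_,
    tendsto_unif_maxCoord hb hε, Eventually.of_forall fun n x _ h => h⟩
  have := measurable_maxCoord (n := n)
  exact measurableSet_le measurable_const (by fun_prop)

/-- On `K` the total sum of squares is the constant `n b`, so the deviation is `-(b-2)` times the
one for the maximum. -/
theorem tendstoInProb_sumSqOthers (hb : 2 < b) (hXm : ∀ n, AEMeasurable (X n) (P n))
    (hX : ∀ n : ℕ, b < n → IsUniformOnK b n ((P n).map (X n))) :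
    TendstoInProb P (fun n ω => sumSqOthers (X n ω) / n) 2 := by
  have hb2 : 0 < b - 2 := by linarith
  refine tendstoInProb_of_unif hb hXm hX (F := fun n x => sumSqOthers x / n)
    fun ε hε => ⟨_, fun n => ?_, tendsto_unif_maxCoord hb (div_pos hε hb2), ?_⟩
  · have := measurable_maxCoord (n := n)
    exact measurableSet_le measurable_const (by fun_prop)
  filter_upwards [eventually_gt_atTop 0] with n hn x hx h
  have hn0 : (0 : ℝ) < n := by positivity
  have e : sumSqOthers x / n - 2 = -((b - 2) * (maxCoord x ^ 2 / ((b - 2) * n) - 1)) := by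
    rw [sumSqOthers, hx.2.2]
    field_simp
    ring
  rw [e, abs_neg, abs_mul, abs_of_pos hb2] at h
  change ε / (b - 2) ≤ |maxCoord x ^ 2 / ((b - 2) * n) - 1|
  rw [div_le_iff₀ hb2]
  linarith

theorem tendstoInProb_secondMaxCoord (hb : 2 < b) (hXm : ∀ n, AEMeasurable (X n) (P n))
    (hX : ∀ n : ℕ, b < n → IsUniformOnK b n ((P n).map (X n))) :
    TendstoInProb P (fun n ω => secondMaxCoord (X n ω) ^ 2 / n) 0 := by
  refine tendstoInProb_of_unif hb hXm hX (F := fun n x => secondMaxCoord x ^ 2 / n)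
    fun ε hε => ⟨_, fun n => ?_, tendsto_unif_two_large hb (Real.sqrt_pos.2 hε), ?_⟩
  · exact measurableSet_two_large _
  filter_upwards [eventually_ge_atTop 2] with n hn x hx h
  have hn0 : (0 : ℝ) < n := by positivity
  have hpos := secondMaxCoord_pos hn hx.1
  rw [sub_zero, abs_of_nonneg (by positivity), le_div_iff₀ hn0] at h
  have hle : √ε * √n ≤ secondMaxCoord x := by
    rw [← Real.sqrt_mul hε.le]
    exact Real.sqrt_le_iff.2 ⟨hpos.le, h⟩
  obtain ⟨i, j, hij, hi, hj⟩ := exists_pair_ge_secondMaxCoord hn x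
  exact ⟨i, j, hij, hle.trans hi, hle.trans hj⟩

end

/-! ### Exchangeability -/

section exchangeable

variable {b : ℝ} {n : ℕ}

theorem measurePreserving_comp_perm (e : Equiv.Perm (Fin n)) :
    MeasurePreserving (fun (x : Fin n → ℝ) i => x (e i)) :=
  volume_preserving_arrowCongr' e.symm (MeasurableEquiv.refl ℝ) (MeasurePreserving.id _)

theorem measurableEmbedding_comp_perm (e : Equiv.Perm (Fin n)) :
    MeasurableEmbedding (fun (x : Fin n → ℝ) i => x (e i)) :=
  (MeasurableEquiv.arrowCongr' e.symm (MeasurableEquiv.refl ℝ)).measurableEmbedding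

theorem comp_perm_mem_K (e : Equiv.Perm (Fin n)) (x : Fin n → ℝ) :
    (fun i => x (e i)) ∈ K b n ↔ x ∈ K b n := by
  simp only [K, Set.mem_ofPred_eq, e.forall_congr_right (q := fun i => 0 < x i),
    Equiv.sum_comp e x, Equiv.sum_comp e (fun i => x i ^ 2)]

theorem comp_perm_mem_shell (e : Equiv.Perm (Fin n)) (x : Fin n → ℝ) (ε : ℝ) :
    (fun i => x (e i)) ∈ shell b n ε ↔ x ∈ shell b n ε := by
  simp only [shell, Set.mem_ofPred_eq, e.forall_congr_right (q := fun i => 0 < x i),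
    Equiv.sum_comp e x, Equiv.sum_comp e (fun i => x i ^ 2)]

/-- Lebesgue measure, the shells and `K` are all invariant under permutations of the coordinates.
With uniqueness this makes the uniform distribution exchangeable. -/
theorem IsUniformOnK.map_comp_perm {ν : Measure (Fin n → ℝ)} (h : IsUniformOnK b n ν)
    (e : Equiv.Perm (Fin n)) : IsUniformOnK b n (ν.map fun x i => x (e i)) := by
  have hm := measurableEmbedding_comp_perm e
  have := h.isProbabilityMeasure
  refine ⟨Measure.isProbabilityMeasure_map hm.measurable.aemeasurable, ?_, fun f => ?_⟩
  · rw [hm.map_apply, ← h.carried]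
    congr 1
    ext x
    exact comp_perm_mem_K e x
  · rw [hm.integral_map]
    have hc : Continuous fun (x : Fin n → ℝ) i => x (e i) := by fun_prop
    refine (h.tendsto_shell (f.compContinuous ⟨_, hc⟩)).congr fun ε => ?_
    have hs : (fun (x : Fin n → ℝ) i => x (e i)) ⁻¹' shell b n ε = shell b n ε := by
      ext x
      exact comp_perm_mem_shell e x ε
    have := (measurePreserving_comp_perm e).setIntegral_preimage_emb hm f (shell b n ε)
    rw [hs] at this
    simp only [ProbabilityTheory.cond, integral_smul_measure, ← this]
    rfl

theorem map_comp_perm_unif (hb : 2 < b) (hn : b < n) (e : Equiv.Perm (Fin n)) :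
    (unif b n).map (fun x i => x (e i)) = unif b n :=
  ((isUniformOnK_unif hb hn).map_comp_perm e).eq_unif hb hn

theorem integral_unif_comp_perm (hb : 2 < b) (hn : b < n) (e : Equiv.Perm (Fin n))
    (f : (Fin n → ℝ) → ℝ) :
    ∫ x, f (fun i => x (e i)) ∂(unif b n) = ∫ x, f x ∂(unif b n) := by
  conv_rhs => rw [← map_comp_perm_unif hb hn e, (measurableEmbedding_comp_perm e).integral_map]

theorem unif_ae_mem_K (hb : 2 < b) (hn : b < n) : ∀ᵐ x ∂(unif b n), x ∈ K b n := by
  have := (isUniformOnK_unif hb hn).isProbabilityMeasure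
  exact (mem_ae_iff_prob_eq_one measurableSet_K).2 (isUniformOnK_unif hb hn).carried

theorem integrable_sq_apply_unif (hb : 2 < b) (hn : b < n) (i : Fin n) :
    Integrable (fun x => x i ^ 2) (unif b n) := by
  have := (isUniformOnK_unif hb hn).isProbabilityMeasure
  refine Integrable.of_bound (by fun_prop : Measurable _).aestronglyMeasurable (n * b) ?_
  filter_upwards [unif_ae_mem_K hb hn] with x hx
  rw [Real.norm_of_nonneg (sq_nonneg _), ← hx.2.2]
  exact Finset.single_le_sum (f := fun j => x j ^ 2) (fun j _ => sq_nonneg _) (Finset.mem_univ i)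

/-- The `n` second moments agree by exchangeability and add up to `n b`. -/
theorem integral_sq_apply_unif (hb : 2 < b) (hn : b < n) (i : Fin n) :
    ∫ x, x i ^ 2 ∂(unif b n) = b := by
  have := (isUniformOnK_unif hb hn).isProbabilityMeasure
  have hn0 : (n : ℝ) ≠ 0 := by linarith
  have h1 : ∀ j, ∫ x, x j ^ 2 ∂(unif b n) = ∫ x, x i ^ 2 ∂(unif b n) := fun j => by
    have := integral_unif_comp_perm hb hn (Equiv.swap i j) (fun x => x i ^ 2)
    simpa using this
  have h2 : ∑ j, ∫ x, x j ^ 2 ∂(unif b n) = n * b := by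
    rw [← integral_finsetSum _ fun j _ => integrable_sq_apply_unif hb hn j]
    rw [integral_congr_ae ((unif_ae_mem_K hb hn).mono fun x hx => hx.2.2)]
    simp
  simp only [h1, Finset.sum_const, Finset.card_univ, Fintype.card_fin, nsmul_eq_mul] at h2
  exact mul_left_cancel₀ hn0 h2

end exchangeable

/-! ### Second moments: part (b) -/

theorem measurable_coord {n : ℕ} (i : ℕ) : Measurable fun x : Fin n → ℝ => coord x i := by
  unfold coord
  split_ifs <;> fun_prop

theorem measurable_firstCoords (k n : ℕ) :
    Measurable fun x : Fin n → ℝ => firstCoords k x :=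
  measurable_pi_lambda _ fun i => measurable_coord i

theorem firstCoords_eq {k n : ℕ} (h : k ≤ n) (x : Fin n → ℝ) :
    firstCoords k x = fun i => x (Fin.castLE h i) := by
  ext i
  exact dif_pos _

theorem integral_map_eq_unif {b : ℝ} (hb : 2 < b) {n : ℕ} (hn : b < n) {Ω : Type*}
    [MeasurableSpace Ω] {P : Measure Ω} {X : Ω → Fin n → ℝ} (hXm : AEMeasurable X P)
    (hX : IsUniformOnK b n (P.map X)) {f : (Fin n → ℝ) → ℝ} (hf : Measurable f) :
    ∫ ω, f (X ω) ∂P = ∫ x, f x ∂(unif b n) := by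
  rw [← hX.eq_unif hb hn, integral_map hXm hf.aestronglyMeasurable]

theorem integrable_integral_sq_coord_zero {b : ℝ} (hb : 2 < b) {n : ℕ} (hn : b < n) {Ω : Type*}
    [MeasurableSpace Ω] {P : Measure Ω} {X : Ω → Fin n → ℝ} (hXm : AEMeasurable X P)
    (hX : IsUniformOnK b n (P.map X)) :
    Integrable (fun ω => coord (X ω) 0 ^ 2) P ∧ ∫ ω, coord (X ω) 0 ^ 2 ∂P = b := by
  have hn0 : 0 < n := by
    have := two_lt_of_lt hb hn
    omega
  have e : ∀ x : Fin n → ℝ, coord x 0 = x ⟨0, hn0⟩ := fun x => dif_pos hn0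
  simp only [e]
  refine ⟨?_, ?_⟩
  · have := integrable_sq_apply_unif hb hn ⟨0, hn0⟩
    rw [← hX.eq_unif hb hn] at this
    exact this.comp_aemeasurable hXm
  · rw [← integral_sq_apply_unif hb hn ⟨0, hn0⟩]
    exact integral_map_eq_unif hb hn hXm hX (f := fun x => x ⟨0, hn0⟩ ^ 2) (by fun_prop)

theorem integrable_integral_sq_of_hasLaw_exp {Ω : Type*} [MeasurableSpace Ω] {Q : Measure Ω}
    {Z : Ω → ℝ} (hZ : HasLaw Z (expMeasure 1) Q) :
    Integrable (fun ω => Z ω ^ 2) Q ∧ ∫ ω, Z ω ^ 2 ∂Q = 2 := by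
  have h1 := integrable_pow_expMeasure 2
  have h2 := integral_pow_expMeasure 2
  rw [← hZ.map_eq] at h1 h2
  refine ⟨h1.comp_aemeasurable hZ.aemeasurable, ?_⟩
  rw [integral_map hZ.aemeasurable (by fun_prop)] at h2
  rw [h2]
  norm_num

theorem not_tendsto_of_eventually_eq {u : ℕ → ℝ} {a c : ℝ} (h : ∀ᶠ n in atTop, u n = a)
    (hac : a ≠ c) : ¬ Tendsto u atTop (𝓝 c) := fun hu =>
  hac (tendsto_nhds_unique (tendsto_const_nhds.congr' (h.mono fun _ h => h.symm)) hu)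

/-! ### Block averages and convergence in law: part (a) -/

/-- The coordinates are split into `n / (k + 1)` consecutive blocks of length `k + 1`; this is the
index of entry `j < k` of block `p`. -/
def blockIndex (n k : ℕ) (p : Fin (n / (k + 1))) (j : Fin k) : Fin n :=
  ⟨p * (k + 1) + j, by
    have h1 : (p + 1) * (k + 1) ≤ n :=
      (Nat.mul_le_mul_right _ p.2).trans (Nat.div_mul_le_self n (k + 1))
    have := j.2
    rw [add_one_mul] at h1
    omega⟩

/-- The last place of each block stays unused; block length `k + 1` instead of `k` only avoids
division by zero for `k = 0`. -/
theorem blockIndex_injective (n k : ℕ) :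
    Function.Injective fun q : Fin (n / (k + 1)) × Fin k => blockIndex n k q.1 q.2 := by
  rintro ⟨p, j⟩ ⟨p', j'⟩ h
  have h : (p : ℕ) * (k + 1) + j = p' * (k + 1) + j' := congrArg Fin.val h
  have hj := j.2
  have hj' := j'.2
  have hp : (p : ℕ) = p' := by
    have := congrArg (· / (k + 1)) h
    simpa [Nat.add_div_of_dvd_right, Nat.mul_add_div, mul_comm _ (k + 1),
      Nat.div_eq_of_lt (show (j : ℕ) < k + 1 by omega),
      Nat.div_eq_of_lt (show (j' : ℕ) < k + 1 by omega)] using this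
  rw [hp] at h
  exact Prod.ext (Fin.ext hp) (Fin.ext (Nat.add_left_cancel h))

theorem expPi_map_comp_injective {n : ℕ} {ι : Type*} [Fintype ι] {φ : ι → Fin n}
    (hφ : φ.Injective) :
    (expPi n).map (fun z i => z (φ i)) = Measure.pi fun _ : ι => expMeasure 1 := by
  have h : iIndepFun (fun i (z : Fin n → ℝ) => z i) (expPi n) :=
    iIndepFun_pi (X := fun _ x => x) fun _ => aemeasurable_id
  rw [(h.precomp hφ).map_fun_eq_pi_map fun i => (measurable_pi_apply _).aemeasurable]
  congr
  ext i : 1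
  exact (measurePreserving_eval (fun _ : Fin n => expMeasure 1) (φ i)).map_eq

theorem expPi_map_block (n k : ℕ) (p : Fin (n / (k + 1))) :
    (expPi n).map (fun z j => z (blockIndex n k p j)) = expPi k :=
  expPi_map_comp_injective fun j j' h =>
    (Prod.ext_iff.1 (@blockIndex_injective n k (p, j) (p, j') h)).2

/-- Restricting to the used coordinates gives a product measure over pairs (block, entry), and
currying it gives a product over the blocks. -/
theorem iIndepFun_block (n k : ℕ) :
    iIndepFun (fun p (z : Fin n → ℝ) j => z (blockIndex n k p j)) (expPi n) := by
  have : IsProbabilityMeasure (expPi n) := inferInstanceAs (IsProbabilityMeasure (Measure.pi _))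
  rw [iIndepFun_iff_map_fun_eq_pi_map fun p =>
    (by fun_prop : Measurable fun (z : Fin n → ℝ) j => z (blockIndex n k p j)).aemeasurable]
  simp only [expPi_map_block]
  have h1 := Measure.infinitePi_map_curry
    (fun (_ : Fin (n / (k + 1))) (_ : Fin k) => expMeasure 1)
  simp only [Measure.infinitePi_eq_pi] at h1
  rw [← expPi_map_comp_injective (blockIndex_injective n k),
    Measure.map_map (by fun_prop) (by fun_prop)] at h1
  exact h1

/-- The mean of `f` over the blocks of coordinates. -/
noncomputable def blockMean {k : ℕ} (f : (Fin k → ℝ) → ℝ) {n : ℕ} (x : Fin n → ℝ) : ℝ :=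
  (∑ p, f fun j => x (blockIndex n k p j)) / (n / (k + 1) : ℕ)

theorem measurable_blockMean {k : ℕ} {f : (Fin k → ℝ) → ℝ} (hf : Measurable f) {n : ℕ} :
    Measurable (blockMean f : (Fin n → ℝ) → ℝ) := by
  unfold blockMean
  refine (Finset.measurable_sum _ fun p _ => hf.comp ?_).div_const _
  fun_prop

theorem le_blocks_of_le {n k : ℕ} (h : k + 1 ≤ n) :
    (n : ℝ) ≤ 2 * (k + 1) * (n / (k + 1) : ℕ) := by
  have h1 : 1 ≤ n / (k + 1) := (Nat.one_le_div_iff (by omega)).2 h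
  have h2 := Nat.lt_mul_div_succ n (Nat.succ_pos k)
  have h3 : n ≤ 2 * (k + 1) * (n / (k + 1)) := by
    rw [Nat.succ_eq_add_one] at h2
    calc n ≤ (k + 1) * (n / (k + 1) + 1) := h2.le
      _ ≤ (k + 1) * (n / (k + 1) + n / (k + 1)) := by gcongr
      _ = _ := by ring
  exact_mod_cast h3

/-- Hoeffding's inequality: the values of `f` on the blocks are independent and lie in an interval
of length `2C`, so they are sub-Gaussian with variance proxy `C²`. -/
theorem expPi_blockMean_ge_le {k : ℕ} {f : (Fin k → ℝ) → ℝ} (hf : Measurable f) {c C : ℝ}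
    (hC : 0 < C) (hfC : ∀ x, f x ∈ Set.Icc (c - C) (c + C)) {τ : ℝ} (hτ : 0 ≤ τ) {n : ℕ}
    (hn : k + 1 ≤ n) :
    (expPi n).real {z | τ ≤ blockMean f z - ∫ x, f x ∂(expPi k)} ≤
      Real.exp (-(τ ^ 2 / (2 * C ^ 2)) * (n / (k + 1) : ℕ)) := by
  have : IsProbabilityMeasure (expPi n) := inferInstanceAs (IsProbabilityMeasure (Measure.pi _))
  set m := n / (k + 1) with hm
  have hm0 : (0 : ℝ) < m := by
    have : 1 ≤ n / (k + 1) := (Nat.one_le_div_iff (by omega)).2 hn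
    exact_mod_cast this
  have hblock : ∀ p, Measurable fun z : Fin n → ℝ => f fun j => z (blockIndex n k p j) :=
    fun p => hf.comp (by fun_prop)
  have hint : ∀ p, ∫ z, f (fun j => z (blockIndex n k p j)) ∂(expPi n) = ∫ x, f x ∂(expPi k) :=
    fun p => by
      rw [← expPi_map_block n k p, integral_map
        (by fun_prop : Measurable fun (z : Fin n → ℝ) j => z (blockIndex n k p j)).aemeasurable
        hf.aestronglyMeasurable]
  have hsub : ∀ p, HasSubgaussianMGF
      (fun z : Fin n → ℝ => f (fun j => z (blockIndex n k p j)) - ∫ x, f x ∂(expPi k))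
      ((‖c + C - (c - C)‖₊ / 2) ^ 2) (expPi n) := fun p => by
    have := hasSubgaussianMGF_of_mem_Icc (μ := expPi n) (hblock p).aemeasurable
      (Eventually.of_forall fun z => hfC fun j => z (blockIndex n k p j))
    rwa [hint p] at this
  have hindep : iIndepFun
      (fun p (z : Fin n → ℝ) => f (fun j => z (blockIndex n k p j)) - ∫ x, f x ∂(expPi k))
      (expPi n) :=
    (iIndepFun_block n k).comp (fun _ y => f y - ∫ x, f x ∂(expPi k)) fun _ => hf.sub_const _
  have h := HasSubgaussianMGF.measure_sum_ge_le_of_iIndepFun hindep (s := Finset.univ)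
    (fun p _ => hsub p) (ε := m * τ) (by positivity)
  have e1 : {z : Fin n → ℝ | τ ≤ blockMean f z - ∫ x, f x ∂(expPi k)} =
      {z | m * τ ≤ ∑ p, (f (fun j => z (blockIndex n k p j)) - ∫ x, f x ∂(expPi k))} := by
    ext z
    simp only [Set.mem_ofPred_eq, blockMean, Finset.sum_sub_distrib, Finset.sum_const,
      Finset.card_univ, Fintype.card_fin, nsmul_eq_mul, ← hm]
    rw [le_sub_iff_add_le, le_div_iff₀ hm0, le_sub_iff_add_le, add_mul, mul_comm τ,
      mul_comm _ (m : ℝ)]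
  rw [e1]
  refine h.trans (le_of_eq ?_)
  congr 1
  have e2 : c + C - (c - C) = 2 * C := by ring
  simp only [Finset.sum_const, Finset.card_univ, Fintype.card_fin, nsmul_eq_mul, e2, ← hm,
    NNReal.coe_mul, NNReal.coe_pow, NNReal.coe_div, coe_nnnorm, NNReal.coe_natCast,
    NNReal.coe_ofNat,
    Real.norm_of_nonneg (by positivity : 0 ≤ 2 * C)]
  field_simp

/-- The number of blocks is at least `n / (2(k+1))`, so the bound decays exponentially in `n` and
beats every rate on the scale `√n`. -/
theorem expRare_blockMean_ge {k : ℕ} {f : (Fin k → ℝ) → ℝ} (hf : Measurable f) {c C : ℝ}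
    (hC : 0 < C) (hfC : ∀ x, f x ∈ Set.Icc (c - C) (c + C)) {τ : ℝ} (hτ : 0 < τ) (γ : ℝ) :
    ExpRare γ fun _ => {z | τ ≤ blockMean f z - ∫ x, f x ∂(expPi k)} := by
  refine ⟨1, ?_⟩
  set κ := τ ^ 2 / (2 * C ^ 2) with hκ
  have hκ0 : 0 < κ := by positivity
  filter_upwards [eventually_ge_atTop (k + 1), eventually_div_sqrt_le γ
    (show 0 < κ / (2 * (k + 1)) by positivity)] with n hn hn'
  refine (expPi_blockMean_ge_le hf hC hfC hτ.le hn).trans ?_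
  rw [one_mul, Real.exp_le_exp, neg_mul, neg_le_neg_iff, ← hκ]
  have hn0 : (0 : ℝ) < n := by
    have : 0 < n := by omega
    exact_mod_cast this
  have hs : 0 < √(n : ℝ) := Real.sqrt_pos.2 hn0
  rw [div_le_iff₀ hs] at hn'
  calc γ * √n ≤ κ / (2 * (k + 1)) * √n * √n := by gcongr
    _ = κ / (2 * (k + 1)) * n := by rw [mul_assoc, Real.mul_self_sqrt hn0.le]
    _ ≤ κ / (2 * (k + 1)) * (2 * (k + 1) * (n / (k + 1) : ℕ)) := by
      gcongr
      exact le_blocks_of_le hn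
    _ = κ * (n / (k + 1) : ℕ) := by field_simp

theorem blockMean_neg {k : ℕ} (f : (Fin k → ℝ) → ℝ) {n : ℕ} (x : Fin n → ℝ) :
    blockMean (fun y => -f y) x = -blockMean f x := by
  simp [blockMean, neg_div]

theorem expRare_blockMean {k : ℕ} {f : (Fin k → ℝ) → ℝ} (hf : Measurable f) {c C : ℝ}
    (hC : 0 < C) (hfC : ∀ x, f x ∈ Set.Icc (c - C) (c + C)) {τ : ℝ} (hτ : 0 < τ) (γ : ℝ) :
    ExpRare γ fun _ => {z | τ ≤ |blockMean f z - ∫ x, f x ∂(expPi k)|} := by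
  have hneg : ∀ x, -f x ∈ Set.Icc (-c - C) (-c + C) := fun x => by
    have := hfC x
    constructor <;> linarith [this.1, this.2]
  refine ((expRare_blockMean_ge hf hC hfC hτ γ).union
    (expRare_blockMean_ge hf.neg hC hneg hτ γ)).mono (Eventually.of_forall fun n z hz => ?_)
  rw [Set.mem_ofPred_eq, le_abs] at hz
  rcases hz with h | h
  · exact Or.inl h
  · right
    change τ ≤ blockMean (fun y => -f y) z - ∫ x, -f x ∂(expPi k)
    rw [blockMean_neg, integral_neg]
    linarith

/-- The displacement of coordinate `i` is `-(ρ - 1) + (ρ - mean z) zᵢ / mean z`. In the `ℓ¹` norm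
the factors `zᵢ` add up to `n * mean z`, however large a single one may be. -/
theorem sum_abs_stretch_sub_le {n : ℕ} {z : Fin n → ℝ} (hz : ∀ i, 0 < z i) (hn : 0 < n) (ρ : ℝ) :
    ∑ i, |stretch ρ z i - z i| ≤ n * (|ρ - 1| + |ρ - mean z|) := by
  have hn0 : (0 : ℝ) < n := by exact_mod_cast hn
  have hsum : 0 < ∑ i, z i := Finset.sum_pos (fun i _ => hz i) ⟨⟨0, hn⟩, Finset.mem_univ _⟩
  have hm : 0 < mean z := div_pos hsum hn0
  have hs : ∑ i, z i = n * mean z := by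
    rw [mean]
    field_simp
  have h1 : ∀ i, |stretch ρ z i - z i| ≤ |ρ - 1| + |ρ - mean z| / mean z * z i := fun i => by
    have e : stretch ρ z i - z i = -(ρ - 1) + (ρ - mean z) / mean z * z i := by
      simp only [stretch]
      field_simp
      ring
    rw [e]
    refine (abs_add_le _ _).trans (le_of_eq ?_)
    rw [abs_neg, abs_mul, abs_div, abs_of_pos hm, abs_of_pos (hz i)]
  refine (Finset.sum_le_sum fun i _ => h1 i).trans (le_of_eq ?_)
  rw [Finset.sum_add_distrib, ← Finset.mul_sum, hs]
  simp only [Finset.sum_const, Finset.card_univ, Fintype.card_fin, nsmul_eq_mul]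
  field_simp

/-- The sup distance on a block is at most the `ℓ¹` distance, and the blocks are disjoint. -/
theorem abs_blockMean_sub_le {k : ℕ} {f : (Fin k → ℝ) → ℝ} {L : NNReal} (hf : LipschitzWith L f)
    {n : ℕ} (hn : k + 1 ≤ n) (x z : Fin n → ℝ) :
    |blockMean f x - blockMean f z| ≤ L * (2 * (k + 1)) * ((∑ i, |x i - z i|) / n) := by
  have hm0 : (0 : ℝ) < (n / (k + 1) : ℕ) := by
    have : 1 ≤ n / (k + 1) := (Nat.one_le_div_iff (by omega)).2 hn
    exact_mod_cast this
  have hn0 : (0 : ℝ) < n := by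
    have : 0 < n := by omega
    exact_mod_cast this
  have h1 : ∀ u v : Fin k → ℝ, |f u - f v| ≤ L * ∑ j, |u j - v j| := fun u v => by
    refine (hf.dist_le_mul u v).trans ?_
    gcongr
    refine (dist_pi_le_iff (Finset.sum_nonneg fun j _ => abs_nonneg _)).2 fun j => ?_
    exact Finset.single_le_sum (f := fun j => |u j - v j|) (fun j _ => abs_nonneg _)
      (Finset.mem_univ j)
  have h2 : ∑ p, ∑ j, |x (blockIndex n k p j) - z (blockIndex n k p j)| ≤ ∑ i, |x i - z i| := by
    rw [← Fintype.sum_prod_type' fun p j => |x (blockIndex n k p j) - z (blockIndex n k p j)|]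
    have := Finset.sum_map Finset.univ ⟨_, blockIndex_injective n k⟩ fun i => |x i - z i|
    refine (le_of_eq this.symm).trans ?_
    exact Finset.sum_le_univ_sum_of_nonneg fun i => abs_nonneg _
  rw [blockMean, blockMean, ← sub_div, abs_div, abs_of_pos hm0, ← Finset.sum_sub_distrib,
    div_le_iff₀ hm0]
  calc |∑ p, (f (fun j => x (blockIndex n k p j)) - f fun j => z (blockIndex n k p j))|
      ≤ ∑ p, L * ∑ j, |x (blockIndex n k p j) - z (blockIndex n k p j)| :=
        (Finset.abs_sum_le_sum_abs _ _).trans (Finset.sum_le_sum fun p _ => h1 _ _)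
    _ ≤ L * ∑ i, |x i - z i| := by
        rw [← Finset.mul_sum]
        gcongr
    _ = L * ((∑ i, |x i - z i|) / n) * n := by field_simp
    _ ≤ L * ((∑ i, |x i - z i|) / n) * (2 * (k + 1) * (n / (k + 1) : ℕ)) := by
        have := le_blocks_of_le hn
        gcongr
    _ = _ := by ring

theorem tendsto_unif_blockMean {b : ℝ} (hb : 2 < b) {k : ℕ} {f : (Fin k → ℝ) → ℝ} {L : NNReal}
    (hf : LipschitzWith L f) {c C : ℝ} (hC : 0 < C) (hfC : ∀ x, f x ∈ Set.Icc (c - C) (c + C))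
    {τ : ℝ} (hτ : 0 < τ) :
    Tendsto (fun n => (unif b n).real {x | τ ≤ |blockMean f x - ∫ x, f x ∂(expPi k)|}) atTop
      (𝓝 0) := by
  have hfm : Measurable f := hf.continuous.measurable
  -- The mean displacement is at most `3δ`, from `|ρ - 1| ≤ δ` and `|ρ - mean z| ≤ 2δ`, and is
  -- multiplied by at most `2(L+1)(k+1)`, giving `τ / 2`. Using `L + 1` keeps the denominator
  -- positive when `L = 0`.
  set δ := τ / (12 * (L + 1) * (k + 1)) with hδ
  have hδ0 : 0 < δ := by positivity
  have hγ0 : 0 < √(b - 2) + 1 := by positivity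
  refine tendsto_unif_of_expRare hb (lt_add_one _) hδ0 (fun n => ?_)
    ((expRare_blockMean hfm hC hfC (half_pos hτ) _).union (expRare_mean hδ0 hγ0)) ?_
  · have := measurable_blockMean hfm (n := n)
    exact measurableSet_le measurable_const (by fun_prop)
  filter_upwards [eventually_ge_atTop (k + 1)] with n hn z hz hzB ρ hρ1 hρ2 _ hA
  have hn0 : 0 < n := by omega
  have hn0' : (0 : ℝ) < n := by exact_mod_cast hn0
  simp only [Set.mem_union, Set.mem_ofPred_eq, not_or, not_le] at hzB hA
  have h1 := abs_blockMean_sub_le hf hn (stretch ρ z) z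
  have h2 : (∑ i, |stretch ρ z i - z i|) / n ≤ 3 * δ := by
    rw [div_le_iff₀ hn0', mul_comm _ (n : ℝ)]
    refine (sum_abs_stretch_sub_le hz hn0 ρ).trans ?_
    have h3 : |ρ - 1| ≤ δ := abs_le.2 ⟨by linarith, by linarith⟩
    have h4 : |ρ - mean z| ≤ |ρ - 1| + |mean z - 1| := by
      rw [abs_sub_comm (mean z)]
      exact abs_sub_le _ _ _
    have h5 := hzB.2
    gcongr
    linarith
  have h3 : |blockMean f (stretch ρ z) - blockMean f z| ≤ τ / 2 := by
    refine h1.trans ?_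
    calc (L : ℝ) * (2 * (k + 1)) * ((∑ i, |stretch ρ z i - z i|) / n)
        ≤ (L + 1) * (2 * (k + 1)) * (3 * δ) := by
          gcongr
          linarith
      _ = τ / 2 := by
          rw [hδ]
          field_simp
          ring
  have h4 := abs_sub_le (blockMean f (stretch ρ z)) (blockMean f z) (∫ x, f x ∂(expPi k))
  linarith [hzB.1]

/-- Some permutation carries the first `k` places to the used places of any given block, so by
exchangeability all blocks have the same expectation. -/
theorem integral_unif_blockMean {b : ℝ} (hb : 2 < b) {k n : ℕ} (hn : b < n) (hkn : k + 1 ≤ n)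
    {f : (Fin k → ℝ) → ℝ} (hf : Measurable f) {C : ℝ} (hfC : ∀ x, ‖f x‖ ≤ C) :
    ∫ x, blockMean f x ∂(unif b n) = ∫ x, f (firstCoords k x) ∂(unif b n) := by
  have := (isUniformOnK_unif hb hn).isProbabilityMeasure
  have hm0 : ((n / (k + 1) : ℕ) : ℝ) ≠ 0 := by
    have : 1 ≤ n / (k + 1) := (Nat.one_le_div_iff (by omega)).2 hkn
    exact_mod_cast (by omega : n / (k + 1) ≠ 0)
  have h1 : ∀ p, ∫ x, f (fun j => x (blockIndex n k p j)) ∂(unif b n) =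
      ∫ x, f (firstCoords k x) ∂(unif b n) := fun p => by
    obtain ⟨σ, hσ⟩ := Equiv.Perm.exists_extending_pair
      (Fin.castLE (by omega : k ≤ n)) (blockIndex n k p) (Fin.castLE_injective _) fun j j' h =>
        (Prod.ext_iff.1 (@blockIndex_injective n k (p, j) (p, j') h)).2
    rw [← integral_unif_comp_perm hb hn σ fun x => f (firstCoords k x)]
    simp only [firstCoords_eq (by omega : k ≤ n), hσ]
  have hint : ∀ p, Integrable (fun x : Fin n → ℝ => f fun j => x (blockIndex n k p j))
      (unif b n) := fun p =>
    Integrable.of_bound (hf.comp (by fun_prop)).aestronglyMeasurable C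
      (Eventually.of_forall fun x => hfC _)
  simp only [blockMean]
  rw [integral_div, integral_finsetSum _ fun p _ => hint p]
  simp only [h1, Finset.sum_const, Finset.card_univ, Fintype.card_fin, nsmul_eq_mul]
  exact mul_div_cancel_left₀ _ hm0

theorem abs_blockMean_sub_le_of_bound {k : ℕ} {f : (Fin k → ℝ) → ℝ} {a C : ℝ}
    (hfC : ∀ x, |f x - a| ≤ C) {n : ℕ} (hn : k + 1 ≤ n) (x : Fin n → ℝ) :
    |blockMean f x - a| ≤ C := by
  have hm0 : (0 : ℝ) < (n / (k + 1) : ℕ) := by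
    have : 1 ≤ n / (k + 1) := (Nat.one_le_div_iff (by omega)).2 hn
    exact_mod_cast this
  have e : blockMean f x - a =
      (∑ p, (f (fun j => x (blockIndex n k p j)) - a)) / (n / (k + 1) : ℕ) := by
    simp only [blockMean, Finset.sum_sub_distrib, Finset.sum_const, Finset.card_univ,
      Fintype.card_fin, nsmul_eq_mul]
    field_simp
  rw [e, abs_div, abs_of_pos hm0, div_le_iff₀ hm0]
  refine (Finset.abs_sum_le_sum_abs _ _).trans
    ((Finset.sum_le_sum fun p _ => hfC fun j => x (blockIndex n k p j)).trans (le_of_eq ?_))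
  simp [mul_comm]

/-- The integral equals that of the block average, which is bounded and converges in probability to
the constant `∫ f`; hence the integrals converge. -/
theorem tendsto_integral_firstCoords {b : ℝ} (hb : 2 < b) {k : ℕ} {f : (Fin k → ℝ) → ℝ}
    {L : NNReal} (hf : LipschitzWith L f) {C : ℝ} (hfC : ∀ x y, |f x - f y| ≤ C) :
    Tendsto (fun n => ∫ x : Fin n → ℝ, f (firstCoords k x) ∂(unif b n)) atTop
      (𝓝 (∫ x, f x ∂(expPi k))) := by
  have : IsProbabilityMeasure (expPi k) := inferInstanceAs (IsProbabilityMeasure (Measure.pi _))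
  have hfm : Measurable f := hf.continuous.measurable
  have hC0 : 0 ≤ C := (abs_nonneg _).trans (hfC 0 0)
  have hf0 : ∀ x, f x ∈ Set.Icc (f 0 - (C + 1)) (f 0 + (C + 1)) := fun x => by
    have := abs_le.1 (hfC x 0)
    constructor <;> linarith [this.1, this.2]
  have hfn : ∀ x, ‖f x‖ ≤ |f 0| + C := fun x => by
    have h1 := hfC x 0
    have h2 := abs_add_le (f x - f 0) (f 0)
    rw [sub_add_cancel] at h2
    rw [Real.norm_eq_abs]
    linarith
  set a := ∫ x, f x ∂(expPi k) with ha
  have hfa : ∀ x, |f x - a| ≤ C := fun x => by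
    have hi : Integrable f (expPi k) :=
      Integrable.of_bound hfm.aestronglyMeasurable _ (Eventually.of_forall hfn)
    have h1 : f x - a = ∫ y, (f x - f y) ∂(expPi k) := by
      rw [integral_sub (integrable_const _) hi]
      simp [ha]
    rw [h1, ← Real.norm_eq_abs]
    refine (norm_integral_le_of_norm_le_const (Eventually.of_forall fun y => hfC x y)).trans ?_
    simp
  rw [Metric.tendsto_nhds]
  intro ε hε
  have hlim := (tendsto_unif_blockMean hb hf (by linarith) hf0 (half_pos (half_pos hε))).const_mul C
  rw [mul_zero] at hlim
  filter_upwards [hlim.eventually (gt_mem_nhds (half_pos hε)), eventually_ge_atTop (k + 1),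
    tendsto_natCast_atTop_atTop.eventually (eventually_gt_atTop b)] with n hn hkn hbn
  have := (isUniformOnK_unif hb hbn).isProbabilityMeasure
  have hbm := measurable_blockMean hfm (n := n)
  set A : Set (Fin n → ℝ) := {x | ε / 2 / 2 ≤ |blockMean f x - a|} with hA
  have hAm : MeasurableSet A := measurableSet_le measurable_const (by fun_prop)
  have hbd : ∀ x : Fin n → ℝ, |blockMean f x - a| ≤ C := abs_blockMean_sub_le_of_bound hfa hkn
  have hint : Integrable (fun x => blockMean f x - a) (unif b n) :=
    Integrable.of_bound (by fun_prop : Measurable _).aestronglyMeasurable C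
      (Eventually.of_forall hbd)
  have hint' : Integrable (fun x => blockMean f x) (unif b n) := by
    exact Integrable.of_bound hbm.aestronglyMeasurable (C + |a|) (Eventually.of_forall fun x => by
      have h1 := hbd x
      have h2 := abs_add_le (blockMean f x - a) a
      rw [sub_add_cancel] at h2
      rw [Real.norm_eq_abs]
      linarith)
  have h1 : ∀ x, |blockMean f x - a| ≤ ε / 2 / 2 + A.indicator (fun _ => C) x := fun x => by
    by_cases hx : x ∈ A
    · rw [Set.indicator_of_mem hx]
      linarith [hbd x]
    · rw [Set.indicator_of_notMem hx, add_zero]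
      exact (not_le.1 hx).le
  have hiA : Integrable (A.indicator fun _ => C) (unif b n) :=
    (integrable_const C).indicator hAm
  have h2 : |∫ x, (blockMean f x - a) ∂(unif b n)| ≤ ε / 2 / 2 + C * (unif b n).real A := by
    calc |∫ x, (blockMean f x - a) ∂(unif b n)| ≤ ∫ x, |blockMean f x - a| ∂(unif b n) :=
          abs_integral_le_integral_abs
      _ ≤ ∫ x, (ε / 2 / 2 + A.indicator (fun _ => C) x) ∂(unif b n) :=
          integral_mono hint.abs ((integrable_const _).add hiA) h1
      _ = ε / 2 / 2 + C * (unif b n).real A := by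
          rw [integral_add (integrable_const _) hiA, integral_indicator_const _ hAm]
          simp [mul_comm]
  rw [integral_sub hint' (integrable_const _),
    integral_unif_blockMean hb hbn hkn hfm hfn] at h2
  simp only [integral_const, probReal_univ, one_smul] at h2
  rw [Real.dist_eq]
  linarith

/-- Convergence in law need only be tested on bounded Lipschitz functions. -/
theorem tendstoInDistribution_firstCoords {b : ℝ} (hb : 2 < b) {Ω : ℕ → Type*}
    [∀ n, MeasurableSpace (Ω n)] {P : ∀ n, Measure (Ω n)} [∀ n, IsProbabilityMeasure (P n)]
    {X : ∀ n, Ω n → Fin n → ℝ} (hXm : ∀ n, AEMeasurable (X n) (P n))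
    (hX : ∀ n : ℕ, b < n → IsUniformOnK b n ((P n).map (X n)))
    {Ω' : Type*} [MeasurableSpace Ω'] {Q : Measure Ω'} [IsProbabilityMeasure Q] {Z : ℕ → Ω' → ℝ}
    (hZ : ∀ i, HasLaw (Z i) (expMeasure 1) Q) (hZi : iIndepFun Z Q) (k : ℕ) :
    TendstoInDistribution (fun n ω => firstCoords k (X n ω)) atTop
      (fun ω (i : Fin k) => Z i ω) P Q := by
  have hZm : AEMeasurable (fun ω (i : Fin k) => Z i ω) Q :=
    aemeasurable_pi_lambda _ fun i => (hZ i).aemeasurable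
  have hlaw : Q.map (fun ω (i : Fin k) => Z i ω) = expPi k := by
    have hi := hZi.precomp (g := fun i : Fin k => (i : ℕ)) Fin.val_injective
    rw [hi.map_fun_eq_pi_map fun i : Fin k => (hZ i).aemeasurable, expPi]
    congr
    ext i : 1
    exact (hZ i).map_eq
  refine ⟨fun n => (measurable_firstCoords k n).comp_aemeasurable (hXm n), hZm, ?_⟩
  refine tendsto_iff_forall_lipschitz_integral_tendsto.2 ?_
  rintro f ⟨C, hC⟩ ⟨L, hL⟩
  have hfm : Measurable f := hL.continuous.measurable
  have h := tendsto_integral_firstCoords hb hL hC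
  simp only [ProbabilityMeasure.coe_mk, hlaw]
  refine h.congr' ?_
  filter_upwards [tendsto_natCast_atTop_atTop.eventually (eventually_gt_atTop b)] with n hn
  exact ((integral_map ((measurable_firstCoords k n).comp_aemeasurable (hXm n))
    hfm.aestronglyMeasurable).trans (integral_map_eq_unif hb hn (hXm n) (hX n hn)
    (hfm.comp (measurable_firstCoords k n)))).symm

end SimplexSphere

theorem theorem2 (b : ℝ) (hb : 2 < b) :
    -- the uniform distribution on `K` is well defined as soon as `n > b`
    (∀ n : ℕ, b < n → ∃! ν : Measure (Fin n → ℝ), SimplexSphere.IsUniformOnK b n ν) ∧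
    ∀ (Ω : ℕ → Type*) [∀ n, MeasurableSpace (Ω n)]
      (P : ∀ n, Measure (Ω n)) [∀ n, IsProbabilityMeasure (P n)]
      (X : ∀ n, Ω n → Fin n → ℝ) (_hXm : ∀ n, AEMeasurable (X n) (P n))
      (_hX : ∀ n : ℕ, b < n → SimplexSphere.IsUniformOnK b n ((P n).map (X n)))
      (Ω' : Type*) [MeasurableSpace Ω'] (Q : Measure Ω') [IsProbabilityMeasure Q]
      (Z : ℕ → Ω' → ℝ) (_hZ : ∀ i, HasLaw (Z i) (expMeasure 1) Q) (_hZi : iIndepFun Z Q),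
      -- (a) the first `k` coordinates converge in law
      (∀ k : ℕ, TendstoInDistribution (fun n ω => SimplexSphere.firstCoords k (X n ω)) atTop
        (fun ω (i : Fin k) => Z i ω) P Q) ∧
      -- (b) the second moments do not converge
      ((∀ n : ℕ, b < n → Integrable (fun ω => SimplexSphere.coord (X n ω) 0 ^ 2) (P n) ∧
          ∫ ω, SimplexSphere.coord (X n ω) 0 ^ 2 ∂(P n) = b) ∧
        Integrable (fun ω => Z 0 ω ^ 2) Q ∧ ∫ ω, Z 0 ω ^ 2 ∂Q = 2 ∧
        ¬ Tendsto (fun n => ∫ ω, SimplexSphere.coord (X n ω) 0 ^ 2 ∂(P n)) atTop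
          (𝓝 (∫ ω, Z 0 ω ^ 2 ∂Q))) ∧
      -- (c) the largest coordinate, and the sum of squares of the others
      (SimplexSphere.TendstoInProb P
          (fun n ω => SimplexSphere.maxCoord (X n ω) ^ 2 / ((b - 2) * n)) 1 ∧
        SimplexSphere.TendstoInProb P
          (fun n ω => SimplexSphere.sumSqOthers (X n ω) / n) 2) ∧
      -- (d) the second largest coordinate
      SimplexSphere.TendstoInProb P
        (fun n ω => SimplexSphere.secondMaxCoord (X n ω) ^ 2 / n) 0 := by
  refine ⟨fun n hn => SimplexSphere.existsUnique_isUniformOnK hb hn, ?_⟩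
  intro Ω _ P _ X hXm hX Ω' _ Q _ Z hZ hZi
  have hX1 := fun n hn =>
    SimplexSphere.integrable_integral_sq_coord_zero hb hn (hXm n) (hX n hn)
  have hZ0 := SimplexSphere.integrable_integral_sq_of_hasLaw_exp (hZ 0)
  refine ⟨SimplexSphere.tendstoInDistribution_firstCoords hb hXm hX hZ hZi,
    ⟨hX1, hZ0.1, hZ0.2, ?_⟩,
    ⟨SimplexSphere.tendstoInProb_maxCoord hb hXm hX,
      SimplexSphere.tendstoInProb_sumSqOthers hb hXm hX⟩,
    SimplexSphere.tendstoInProb_secondMaxCoord hb hXm hX⟩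
  rw [hZ0.2]
  refine SimplexSphere.not_tendsto_of_eventually_eq ?_ hb.ne'
  filter_upwards [tendsto_natCast_atTop_atTop.eventually (eventually_gt_atTop b)] with n hn
  exact (hX1 n hn).2
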